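/- Consider the following search problem. An $r\times c$ array $T$ of distinct integers, sorted in ascending order along every row and every column, is accessible only through the quantum oracle $|x\rangle|y\rangle|z\rangle\mapsto|x\rangle|y\rangle|z+T(x,y)\rangle$ (addition modulo $2^w$, where all integers are $w$-bit two's complement words). Given an integer $a$, output a position $(i,j)$ with $T(i,j)=a$ if $a$ occurs in $T$, and "not found" otherwise. An algorithm has bounded error if for every such $T$ and every $a$ its output is correct with probability at least $2/3$. (1) Let $m=\max(r,c)$. There is a bounded-error quantum algorithm for this problem that runs in time $O(\sqrt m)$, and hence makes $O(\sqrt m)$ queries, where the implied constant is absolute. Here time is the number of elementary instructions on registers of $w$ qubits: an oracle query; a reversible update $R_d\leftarrow R_d+f$, where $f$ is a constant, a register, or a bitwise AND, shift, comparison, equality test or conditional selection of registers; a negation of a register; a Hadamard gate or a gate $\mathrm{diag}(1,e^{i\pi/4})$ on the least significant qubit of a register. The instruction sequence is computable from $(r,c)$; it does not depend on $a$ (which is given in a register), on $T$, or on the word length $w$, which is any number such that $r$, $c$, $a$ and the entries of $T$ are $w$-bit two's complement integers. (2) This is asymptotically optimal: there is an absolute constant $\kappa>0$ such that for all $m$ and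 $w$ with $m^2<2^w$, every bounded-error quantum query algorithm (arbitrary unitary operations that do not depend on $T$, but may depend on $a$, interleaved with oracle queries, on any number of $w$-qubit registers) for $m\times m$ arrays of $w$-bit integers uses at least $\kappa\sqrt m$ queries for some $w$-bit integer $a$. -/

import Mathlib

namespace QSearch

/-! ### Sorted arrays -/

/-- `z` is representable as a `w`-bit two's complement integer: `-2^(w-1) ≤ z < 2^(w-1)`. -/
def Fits (w : ℕ) (z : ℤ) : Prop := -(2 : ℤ) ^ w ≤ 2 * z ∧ 2 * z < (2 : ℤ) ^ w

/-- `T` is an array of distinct `w`-bit integers, ascending along every row and every column. -/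
structure IsSortedArray {r c : ℕ} (w : ℕ) (T : Fin r → Fin c → ℤ) : Prop where
  row_sorted : ∀ i, Monotone (T i)
  col_sorted : ∀ j, Monotone fun i => T i j
  distinct : Function.Injective fun p : Fin r × Fin c => T p.1 p.2
  fits : ∀ i j, Fits w (T i j)

/-- `CorrectAnswer T a o`: the answer `o` to the search for `a` in `T` is correct. Here `none` is
"not found" and `some (i, j)` is "found in row `i`, column `j`" (both counted from zero). -/
def CorrectAnswer {r c : ℕ} (T : Fin r → Fin c → ℤ) (a : ℤ) : Option (ℕ × ℕ) → Prop
  | none => ∀ i j, T i j ≠ a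
  | some p => ∃ (i : Fin r) (j : Fin c), (i : ℕ) = p.1 ∧ (j : ℕ) = p.2 ∧ T i j = a

/-! ### Memory: `k` quantum registers of `w` qubits -/

/-- Computational basis states of a memory of `k` registers, each holding a `w`-bit word. -/
abbrev Mem (k w : ℕ) : Type := Fin k → BitVec w

/-- The content of register `x` (zero if there is no such register). -/
def Mem.read {k w : ℕ} (s : Mem k w) (x : ℕ) : BitVec w :=
  if h : x < k then s ⟨x, h⟩ else 0

/-- The reversible operation `R_d ← R_d + f`, addition modulo `2^w`, where `f` may depend on all
the registers other than `R_d` (it is evaluated with `R_d` replaced by zero). -/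
def addInto {k w : ℕ} (d : Fin k) (f : Mem k w → BitVec w) : Equiv.Perm (Mem k w) where
  toFun s := Function.update s d (s d + f (Function.update s d 0))
  invFun s := Function.update s d (s d - f (Function.update s d 0))
  left_inv s := by simp
  right_inv s := by simp

/-- `addInto` for a register given by its number (no effect if there is no such register). -/
def addReg {k w : ℕ} (d : ℕ) (f : Mem k w → BitVec w) : Equiv.Perm (Mem k w) :=
  if h : d < k then addInto ⟨d, h⟩ f else Equiv.refl _

/-- `R_d ← -R_d` modulo `2^w`. -/
def negReg {k w : ℕ} (d : ℕ) : Equiv.Perm (Mem k w) :=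
  if h : d < k then
    { toFun := fun s => Function.update s ⟨d, h⟩ (-s ⟨d, h⟩)
      invFun := fun s => Function.update s ⟨d, h⟩ (-s ⟨d, h⟩)
      left_inv := fun s => by simp
      right_inv := fun s => by simp }
  else Equiv.refl _

/-- Flip the least significant bit of register `d`. -/
def flipLow {k w : ℕ} (d : Fin k) : Equiv.Perm (Mem k w) where
  toFun s := Function.update s d (s d ^^^ 1#w)
  invFun s := Function.update s d (s d ^^^ 1#w)
  left_inv s := by simp
  right_inv s := by simp

theorem flipLow_flipLow {k w : ℕ} (d : Fin k) (s : Mem k w) : flipLow d (flipLow d s) = s :=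
  (flipLow d).left_inv s

theorem getLsbD_flipLow {k w : ℕ} (d : Fin k) (hw : 0 < w) (s : Mem k w) :
    (flipLow d s d).getLsbD 0 = !(s d).getLsbD 0 := by
  simp [flipLow, hw]

/-! ### Unitary operations -/

/-- The matrix of the operation `|s⟩ ↦ |σ s⟩`. -/
def permMat {ι : Type} [DecidableEq ι] (σ : Equiv.Perm ι) : Matrix ι ι ℂ :=
  Matrix.of fun t s => if t = σ s then 1 else 0

theorem permMat_mem {ι : Type} [Fintype ι] [DecidableEq ι] (σ : Equiv.Perm ι) :
    permMat σ ∈ Matrix.unitaryGroup ι ℂ := by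
  rw [Matrix.mem_unitaryGroup_iff']
  ext a b
  simp [Matrix.mul_apply, permMat, Matrix.star_apply, Matrix.one_apply, eq_comm]

/-- The Pauli `Z` gate `diag(1, -1)` on the least significant qubit of register `d`. -/
noncomputable def zMat {k w : ℕ} (d : Fin k) : Matrix (Mem k w) (Mem k w) ℂ :=
  Matrix.diagonal fun s => if (s d).getLsbD 0 then -1 else 1

/-- The Hadamard gate `(X + Z) / √2` on the least significant qubit of register `d`. -/
noncomputable def hadamardMat {k w : ℕ} (d : Fin k) : Matrix (Mem k w) (Mem k w) ℂ :=
  ((Real.sqrt 2)⁻¹ : ℝ) • (permMat (flipLow d) + zMat d)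

theorem hadamardMat_mem {k w : ℕ} (d : Fin k) (hw : 0 < w) :
    hadamardMat (w := w) d ∈ Matrix.unitaryGroup (Mem k w) ℂ := by
  have hXs : star (permMat (flipLow (w := w) d)) = permMat (flipLow d) := by
    ext a b
    have : b = flipLow d a ↔ a = flipLow d b :=
      ⟨fun h => by rw [h, flipLow_flipLow], fun h => by rw [h, flipLow_flipLow]⟩
    simp [permMat, Matrix.star_apply, this]
  have hZs : star (zMat (w := w) d) = zMat d := by
    rw [zMat, Matrix.star_eq_conjTranspose, Matrix.diagonal_conjTranspose]
    congr 1
    ext s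
    by_cases h : (s d).getLsbD 0 <;> simp [h]
  have hXX : permMat (flipLow (w := w) d) * permMat (flipLow d) = 1 := by
    have := (Matrix.mem_unitaryGroup_iff').1 (permMat_mem (flipLow (w := w) d))
    rwa [hXs] at this
  have hZZ : zMat (w := w) d * zMat d = 1 := by
    rw [zMat, Matrix.diagonal_mul_diagonal, ← Matrix.diagonal_one]
    congr 1
    ext s
    by_cases h : (s d).getLsbD 0 <;> simp [h]
  have hXZ : permMat (flipLow (w := w) d) * zMat d + zMat d * permMat (flipLow d) = 0 := by
    ext a b
    rw [Matrix.add_apply, zMat, Matrix.mul_diagonal, Matrix.diagonal_mul]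
    by_cases h : a = flipLow d b
    · subst h
      rw [getLsbD_flipLow d hw]
      by_cases h : (b d).getLsbD 0 <;> simp [permMat, h]
    · simp [permMat, h]
  have h2 : ((Real.sqrt 2)⁻¹ : ℝ) * (Real.sqrt 2)⁻¹ * 2 = 1 := by
    rw [← mul_inv, Real.mul_self_sqrt (by norm_num)]
    norm_num
  rw [Matrix.mem_unitaryGroup_iff', hadamardMat, star_smul, star_add, hXs, hZs, star_trivial,
    smul_mul_smul_comm, mul_add, add_mul, add_mul, hXX, hZZ]
  have : (1 : Matrix (Mem k w) (Mem k w) ℂ) + zMat d * permMat (flipLow d) +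
      (permMat (flipLow d) * zMat d + 1) = (2 : ℝ) • 1 := by
    rw [two_smul]
    calc _ = 1 + 1 + (permMat (flipLow (w := w) d) * zMat d + zMat d * permMat (flipLow d)) := by
            abel
      _ = _ := by rw [hXZ, add_zero]
  rw [this, smul_smul, h2, one_smul]

/-- The gate `diag(1, e^{iπ/4})` on the least significant qubit of register `d`. -/
noncomputable def phaseMat {k w : ℕ} (d : Fin k) : Matrix (Mem k w) (Mem k w) ℂ :=
  Matrix.diagonal fun s =>
    if (s d).getLsbD 0 then Complex.exp (Complex.I * (Real.pi / 4 : ℝ)) else 1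

theorem phaseMat_mem {k w : ℕ} (d : Fin k) :
    phaseMat (w := w) d ∈ Matrix.unitaryGroup (Mem k w) ℂ := by
  rw [Matrix.mem_unitaryGroup_iff', phaseMat, Matrix.star_eq_conjTranspose,
    Matrix.diagonal_conjTranspose, Matrix.diagonal_mul_diagonal, ← Matrix.diagonal_one]
  congr 1
  ext s
  by_cases h : (s d).getLsbD 0
  · simp only [h, if_true, Pi.star_apply, Complex.star_def, ← Complex.exp_conj, ← Complex.exp_add]
    simp [map_ofNat]
  · simp [h]

/-! ### Quantum query algorithms -/

/-- The integer stored at row `x`, column `y` of `T`, as a word (zero outside of the array). -/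
def entry {r c w : ℕ} (T : Fin r → Fin c → ℤ) (x y : BitVec w) : BitVec w :=
  if h : x.toNat < r ∧ y.toNat < c then BitVec.ofInt w (T ⟨x.toNat, h.1⟩ ⟨y.toNat, h.2⟩) else 0

/-- The oracle `|x⟩|y⟩|z⟩ ↦ |x⟩|y⟩|z + T[x, y]⟩`, addition modulo `2^w`, on registers
`R_x`, `R_y`, `R_d`. -/
def queryPerm {r c k w : ℕ} (T : Fin r → Fin c → ℤ) (d x y : ℕ) : Equiv.Perm (Mem k w) :=
  addReg d fun s => entry T (s.read x) (s.read y)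

/-- A step of a quantum query algorithm: an oracle query, or an arbitrary unitary operation that
does not depend on the array. -/
inductive Step (k w : ℕ) : Type
  | query (d x y : ℕ) : Step k w
  | unitary (U : Matrix.unitaryGroup (Mem k w) ℂ) : Step k w

/-- `1` for a query and `0` for any other step. -/
def Step.queryCost {k w : ℕ} : Step k w → ℕ
  | .query _ _ _ => 1
  | .unitary _ => 0

/-- The number of oracle queries made by a sequence of steps. -/
def queryCount {k w : ℕ} (A : List (Step k w)) : ℕ := (A.map Step.queryCost).sum

/-- The matrix by which a step acts when the array is `T`. -/
def Step.mat {r c k w : ℕ} (T : Fin r → Fin c → ℤ) : Step k w → Matrix (Mem k w) (Mem k w) ℂ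
  | .query d x y => permMat (queryPerm T d x y)
  | .unitary U => U.1

/-- The initial basis state: register `0` holds the integer `a`, all other registers are zero. -/
def initMem (k w : ℕ) (a : ℤ) : Mem k w :=
  fun i => if (i : ℕ) = 0 then BitVec.ofInt w a else 0

/-- The state vector after running the steps of `A` in order, from the initial state for `a`. -/
noncomputable def finalState {r c k w : ℕ} (T : Fin r → Fin c → ℤ) (a : ℤ)
    (A : List (Step k w)) : Mem k w → ℂ :=
  A.foldl (fun ψ u => (u.mat T).mulVec ψ) (Pi.single (initMem k w a) 1)

/-- The answer read off a measured basis state: "not found" if register `1` is zero, otherwise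
the position given by registers `2` (row) and `3` (column). -/
def answer {k w : ℕ} (s : Mem k w) : Option (ℕ × ℕ) :=
  if s.read 1 = 0 then none else some ((s.read 2).toNat, (s.read 3).toNat)

open Classical in
/-- The probability that measuring all registers at the end gives a correct answer. -/
noncomputable def successProb {r c k w : ℕ} (T : Fin r → Fin c → ℤ) (a : ℤ)
    (A : List (Step k w)) : ℝ :=
  ∑ s : Mem k w, if CorrectAnswer T a (answer s) then ‖finalState T a A s‖ ^ 2 else 0

/-- The algorithm `A` (which may depend on the integer that is searched for) searches all sorted
`r × c` arrays of distinct `w`-bit integers with error probability at most `1/3`. -/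
def Searches {k w : ℕ} (r c : ℕ) (A : ℤ → List (Step k w)) : Prop :=
  ∀ a : ℤ, Fits w a → ∀ T : Fin r → Fin c → ℤ, IsSortedArray w T →
    2 / 3 ≤ successProb T a (A a)

/-! ### Elementary instructions and programs -/

/-- The elementary instructions of a quantum computer operating on words; each takes unit time. -/
inductive Op : Type
  | imm | copy | neg | and | shr | lt | eq | sel | had | phase | query

/-- Instruction `op` with target register `d` and operands `x`, `y`. -/
structure Instr : Type where
  op : Op
  d : ℕ
  x : ℕ
  y : ℕ

/-- The step performed by an instruction on a memory of `k` registers of `w` qubits. -/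
noncomputable def Instr.toStep (k w : ℕ) (I : Instr) : Step k w :=
  let perm (σ : Equiv.Perm (Mem k w)) : Step k w := .unitary ⟨permMat σ, permMat_mem σ⟩
  match I.op with
  -- `R_d ← R_d + x`, for the constant `x`
  | .imm => perm (addReg I.d fun _ => BitVec.ofNat w I.x)
  -- `R_d ← R_d + R_x`
  | .copy => perm (addReg I.d fun s => s.read I.x)
  -- `R_d ← -R_d`
  | .neg => perm (negReg I.d)
  -- `R_d ← R_d + (R_x AND R_y)`, bitwise
  | .and => perm (addReg I.d fun s => s.read I.x &&& s.read I.y)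
  -- `R_d ← R_d + (R_x >> R_y)`
  | .shr => perm (addReg I.d fun s => s.read I.x >>> (s.read I.y).toNat)
  -- `R_d ← R_d + [R_x < R_y]`, comparing signed integers
  | .lt => perm (addReg I.d fun s => if (s.read I.x).toInt < (s.read I.y).toInt then 1 else 0)
  -- `R_d ← R_d + [R_x = R_y]`
  | .eq => perm (addReg I.d fun s => if s.read I.x = s.read I.y then 1 else 0)
  -- `R_d ← R_d + R_y` if `R_x` is not zero
  | .sel => perm (addReg I.d fun s => if s.read I.x = 0 then 0 else s.read I.y)
  -- Hadamard gate on the least significant qubit of `R_d`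
  | .had => if h : I.d < k ∧ 0 < w then .unitary ⟨_, hadamardMat_mem ⟨I.d, h.1⟩ h.2⟩
      else .unitary 1
  -- `diag(1, e^{iπ/4})` on the least significant qubit of `R_d`
  | .phase => if h : I.d < k then .unitary ⟨_, phaseMat_mem ⟨I.d, h⟩⟩ else .unitary 1
  -- `R_d ← R_d + T[R_x, R_y]`
  | .query => .query I.d I.x I.y

/-- A program: a number of registers and a sequence of elementary instructions. -/
abbrev Program : Type := ℕ × List Instr

/-- The running time of a program: the number of elementary instructions, queries included. -/
def Program.time (P : Program) : ℕ := P.2.length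

/-- The query algorithm that a program performs on a machine with words of `w` bits. -/
noncomputable def Program.steps (P : Program) (w : ℕ) : List (Step P.1 w) :=
  P.2.map (Instr.toStep P.1 w)

/-! Programs are finite data, so that one can speak of computing a program. -/

def Op.equivFin : Op ≃ Fin 11 where
  toFun
    | .imm => 0 | .copy => 1 | .neg => 2 | .and => 3 | .shr => 4 | .lt => 5
    | .eq => 6 | .sel => 7 | .had => 8 | .phase => 9 | .query => 10
  invFun := ![.imm, .copy, .neg, .and, .shr, .lt, .eq, .sel, .had, .phase, .query]
  left_inv o := by cases o <;> rfl
  right_inv i := by fin_cases i <;> rfl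

instance : Primcodable Op := Primcodable.ofEquiv (Fin 11) Op.equivFin

def Instr.equivProd : Instr ≃ Op × ℕ × ℕ × ℕ where
  toFun I := (I.op, I.d, I.x, I.y)
  invFun p := ⟨p.1, p.2.1, p.2.2.1, p.2.2.2⟩
  left_inv _ := rfl
  right_inv _ := rfl

instance : Primcodable Instr := Primcodable.ofEquiv (Op × ℕ × ℕ × ℕ) Instr.equivProd

end QSearch

/-! Upper bound. Extend the array by small entries above and to the left and by large entries
elsewhere. A staircase then separates the cells smaller than `a` from the others (`Below`,
`Bracket`). Every diagonal crosses it once, and an occurrence of `a` in row `i`, column `j` forces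
the crossing on diagonal `j - (i + 1)` to be `(i + 1, j)` (`Bracket.eq_of_eq`). It remains to search
fewer than `r + c` diagonals for the one crossing at which `a` stands; distinctness makes it unique.
From a known crossing, the crossing `2 ^ e` diagonals further on is found by binary search with `e +
1` queries (`execs_stepsCode_of_bracket`).

Plain amplitude amplification over the diagonals would pay logarithmic factors, because each trial
would walk the staircase from its start. Instead the bits of the diagonal number are tossed one by
one, the most significant first, each followed by its conditional jump, and rounds of amplification
are placed between groups of tosses. A round triples the cost and multiplies a small success
probability by almost 9, while a toss halves it. A level of one round and three (four) tosses thus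
changes the probability by about 9/8 (9/16). If `e` bits remain below a level, its own work is `O(e
^ 2)`, so costs satisfy `L' = 3 * L + O(e ^ 2)`. Long jumps sit in the outer levels, which are
executed seldom, and the recursion sums to `O(3 ^ J)` for `J` levels without a logarithm. With `J =
Nat.clog 9 m` this is `O(√m)`. A suitable number of four-toss levels makes the bits cover all
diagonals while the probability stays bounded below, and two more rounds raise it above 2/3. The
analysis is exact: from each admissible basis state the marked part of the output is a multiple of
one basis state (`marked_searchCode`), so a round acts on amplitudes by `α ↦ 4 * α ^ 3 - 3 * α`
(`marked_amplify`).

Lower bound. In an array ordered by antidiagonals, any single cell of the longest antidiagonal can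
be given a new value `a` without spoiling the order. Finding `a` is then unstructured search among
`m` cells, and a hybrid argument applies: summed over the `m` modified arrays, the distance from the
run on the unmodified array grows by at most 2 per query (`l2_foldl_sub_le`), whereas correctness
needs a final distance of at least `√m / 5` (`le_sum_norm_sq_sub`). -/

namespace QSearch

open Matrix

/-! ### Matrices of instruction sequences -/

theorem permMat_mulVec_single {ι : Type} [Fintype ι] [DecidableEq ι] (σ : Equiv.Perm ι) (s : ι) :
    permMat σ *ᵥ Pi.single s 1 = Pi.single (σ s) 1 := by
  ext t
  simp [permMat, Pi.single_apply]

theorem permMat_mul {ι : Type} [Fintype ι] [DecidableEq ι] (σ τ : Equiv.Perm ι) :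
    permMat σ * permMat τ = permMat (σ * τ) := by
  ext a b
  simp only [permMat, Matrix.mul_apply, Matrix.of_apply, mul_ite, mul_one, mul_zero,
    Finset.sum_ite_eq', Finset.mem_univ, if_true, Equiv.Perm.mul_apply]
  by_cases h : a = σ (τ b) <;> simp [h]

theorem star_permMat {ι : Type} [Fintype ι] [DecidableEq ι] (σ : Equiv.Perm ι) :
    star (permMat σ) = permMat σ⁻¹ := by
  ext a b
  have : b = σ a ↔ a = σ⁻¹ b := by rw [Equiv.Perm.eq_inv_iff_eq, eq_comm]
  simp [permMat, Matrix.star_apply, this]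

theorem permMat_one {ι : Type} [DecidableEq ι] :
    permMat (1 : Equiv.Perm ι) = 1 := by
  ext a b
  by_cases h : a = b
  · subst h; simp [permMat]
  · simp [permMat, h]

theorem Step.mat_mem {r c k w : ℕ} (T : Fin r → Fin c → ℤ) (u : Step k w) :
    u.mat T ∈ Matrix.unitaryGroup (Mem k w) ℂ := by
  cases u with
  | query d x y => exact permMat_mem _
  | unitary U => exact U.2

/-- The matrix of an instruction. -/
noncomputable def instrMat {r c : ℕ} (T : Fin r → Fin c → ℤ) (k w : ℕ) (I : Instr) :
    Matrix (Mem k w) (Mem k w) ℂ :=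
  (I.toStep k w).mat T

/-- The matrix of an instruction sequence. -/
noncomputable def progMat {r c : ℕ} (T : Fin r → Fin c → ℤ) (k w : ℕ) :
    List Instr → Matrix (Mem k w) (Mem k w) ℂ
  | [] => 1
  | I :: L => progMat T k w L * instrMat T k w I

section
variable {r c : ℕ} (T : Fin r → Fin c → ℤ) (k w : ℕ)

theorem progMat_nil : progMat T k w [] = 1 := rfl

theorem progMat_cons (I : Instr) (L : List Instr) :
    progMat T k w (I :: L) = progMat T k w L * instrMat T k w I := rfl

theorem progMat_append (L₁ L₂ : List Instr) :
    progMat T k w (L₁ ++ L₂) = progMat T k w L₂ * progMat T k w L₁ := by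
  induction L₁ with
  | nil => simp [progMat_nil]
  | cons I L ih => simp [progMat_cons, ih, Matrix.mul_assoc]

theorem progMat_mem (L : List Instr) : progMat T k w L ∈ Matrix.unitaryGroup (Mem k w) ℂ := by
  induction L with
  | nil => exact one_mem _
  | cons I L ih => exact mul_mem ih (Step.mat_mem T _)

theorem foldl_steps (L : List Instr) (ψ : Mem k w → ℂ) :
    (L.map (Instr.toStep k w)).foldl (fun ψ u => (u.mat T) *ᵥ ψ) ψ = progMat T k w L *ᵥ ψ := by
  induction L generalizing ψ with
  | nil => simp [progMat_nil]
  | cons I L ih => simp [ih, progMat_cons, instrMat, Matrix.mulVec_mulVec]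

theorem finalState_map (a : ℤ) (L : List Instr) :
    finalState T a (L.map (Instr.toStep k w)) =
      progMat T k w L *ᵥ Pi.single (initMem k w a) 1 :=
  foldl_steps T k w L _

end

/-! ### Operators that only change some registers -/

/-- `s` and `t` agree on all registers outside of `R`. -/
def AgreeOff {k w : ℕ} (R : Set ℕ) (s t : Mem k w) : Prop := ∀ x, x ∉ R → s.read x = t.read x

namespace AgreeOff
variable {k w : ℕ} {R R' : Set ℕ} {s t u : Mem k w}

theorem refl (R : Set ℕ) (s : Mem k w) : AgreeOff R s s := fun _ _ => rfl
theorem symm (h : AgreeOff R s t) : AgreeOff R t s := fun x hx => (h x hx).symm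
theorem trans (h : AgreeOff R s t) (h' : AgreeOff R t u) : AgreeOff R s u :=
  fun x hx => (h x hx).trans (h' x hx)
theorem mono (hR : R ⊆ R') (h : AgreeOff R s t) : AgreeOff R' s t :=
  fun x hx => h x fun hx' => hx (hR hx')

end AgreeOff

/-- The operator `A` only changes registers in `R`. -/
def ActsOn {k w : ℕ} (R : Set ℕ) (A : Matrix (Mem k w) (Mem k w) ℂ) : Prop :=
  ∀ t s, A t s ≠ 0 → AgreeOff R t s

namespace ActsOn
variable {k w : ℕ} {R R' : Set ℕ} {A B : Matrix (Mem k w) (Mem k w) ℂ}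

theorem mono (hR : R ⊆ R') (h : ActsOn R A) : ActsOn R' A := fun t s hts => (h t s hts).mono hR

theorem one : ActsOn R (1 : Matrix (Mem k w) (Mem k w) ℂ) := by
  intro t s h
  by_cases hts : t = s
  · subst hts; exact AgreeOff.refl _ _
  · simp [hts] at h

theorem diagonal (f : Mem k w → ℂ) : ActsOn R (Matrix.diagonal f) := by
  intro t s h
  by_cases hts : t = s
  · subst hts; exact AgreeOff.refl _ _
  · simp [hts] at h

theorem mul (hA : ActsOn R A) (hB : ActsOn R B) : ActsOn R (A * B) := by
  intro t s h
  rw [Matrix.mul_apply] at h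
  obtain ⟨u, -, hu⟩ := Finset.exists_ne_zero_of_sum_ne_zero h
  exact (hA t u (left_ne_zero_of_mul hu)).trans (hB u s (right_ne_zero_of_mul hu))

theorem star (hA : ActsOn R A) : ActsOn R (star A) := by
  intro t s h
  rw [Matrix.star_apply] at h
  exact (hA s t (by simpa using h)).symm

theorem permMat {σ : Equiv.Perm (Mem k w)} (h : ∀ s, AgreeOff R (σ s) s) :
    ActsOn R (permMat σ) := by
  intro t s hts
  have : t = σ s := by
    by_contra hne
    simp [QSearch.permMat, hne] at hts
  exact this ▸ h s

end ActsOn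

/-! ### One round of amplitude amplification -/

/-- The part of a vector that is supported on the basis states with `χ`. -/
def marked {ι : Type} (χ : ι → Bool) (ψ : ι → ℂ) : ι → ℂ := fun s => if χ s then ψ s else 0

section
variable {ι : Type} (χ : ι → Bool) (φ ψ : ι → ℂ) (z : ℂ)

theorem marked_add : marked χ (φ + ψ) = marked χ φ + marked χ ψ := by
  ext s; by_cases h : χ s <;> simp [marked, h]

theorem marked_sub : marked χ (φ - ψ) = marked χ φ - marked χ ψ := by
  ext s; by_cases h : χ s <;> simp [marked, h]

theorem marked_smul : marked χ (z • φ) = z • marked χ φ := by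
  ext s; by_cases h : χ s <;> simp [marked, h]

theorem marked_marked : marked χ (marked χ φ) = marked χ φ := by
  ext s; by_cases h : χ s <;> simp [marked, h]

theorem marked_single [DecidableEq ι] (s : ι) :
    marked χ (Pi.single s (1 : ℂ)) = (if χ s then (1 : ℂ) else 0) • Pi.single s (1 : ℂ) := by
  ext t
  by_cases ht : t = s
  · subst ht; by_cases h : χ t <;> simp [marked, h]
  · simp [marked, ht]

/-- The diagonal matrix that flips the sign of the basis states with `χ`. -/
noncomputable def signMat [DecidableEq ι] : Matrix ι ι ℂ :=
  Matrix.diagonal fun s => if χ s then -1 else 1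

theorem signMat_mulVec [Fintype ι] [DecidableEq ι] :
    signMat χ *ᵥ φ = φ - (2 : ℂ) • marked χ φ := by
  ext s
  by_cases h : χ s <;> simp [signMat, Matrix.mulVec_diagonal, marked, h]
  ring

theorem star_signMat [Fintype ι] [DecidableEq ι] : star (signMat χ) = signMat χ := by
  rw [signMat, Matrix.star_eq_conjTranspose, Matrix.diagonal_conjTranspose]
  congr 1
  ext s
  by_cases h : χ s <;> simp [h]

/-- If running `U` from the basis state `s` marks `f` with amplitude `α`, then one round of
amplitude amplification marks `f` with amplitude `4 α ^ 3 - 3 α`. -/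
theorem marked_amplify [Fintype ι] [DecidableEq ι] {U : Matrix ι ι ℂ}
    (hU : U ∈ Matrix.unitaryGroup ι ℂ) (ε : ι → Bool) {s f : ι} {α : ℝ}
    (h : marked χ (U *ᵥ Pi.single s 1) = (α : ℂ) • Pi.single f 1)
    (hs : ε s = true) (hε : ∀ t, t ≠ s → U f t ≠ 0 → ε t = false) :
    marked χ ((U * signMat ε * star U * signMat χ * U) *ᵥ Pi.single s 1) =
      ((4 * α ^ 3 - 3 * α : ℝ) : ℂ) • Pi.single f 1 := by
  have hUU : star U * U = 1 := (Matrix.mem_unitaryGroup_iff').1 hU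
  have hUU' : U * star U = 1 := (Matrix.mem_unitaryGroup_iff).1 hU
  -- For `α = 0` the hypothesis says nothing about `f`, which need not be marked. Here the part of
  -- the round before the last `U` just maps `s` to `-s`.
  by_cases hα : α = 0
  · subst hα
    simp only [Complex.ofReal_zero, zero_smul] at h
    have h1 : marked ε (Pi.single s (1 : ℂ)) = Pi.single s 1 := by
      rw [marked_single, hs]; simp
    simp only [← Matrix.mulVec_mulVec]
    rw [signMat_mulVec χ, h, smul_zero, sub_zero, Matrix.mulVec_mulVec _ (star U), hUU,
      Matrix.one_mulVec, signMat_mulVec, h1]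
    have : (Pi.single s 1 : ι → ℂ) - (2 : ℂ) • Pi.single s (1 : ℂ) = (-1 : ℂ) • Pi.single s 1 := by
      module
    rw [this, Matrix.mulVec_smul, marked_smul, h]
    simp
  have hα' : (α : ℂ) ≠ 0 := by exact_mod_cast hα
  have hUf : U f s = α := by
    have h1 := congrFun h f
    have h2 : χ f = true := by
      by_contra hf
      simp only [marked, hf, Pi.smul_apply, Pi.single_eq_same, smul_eq_mul, mul_one] at h1
      exact hα' (by simpa using h1.symm)
    simpa [marked, h2] using h1
  have hf : marked χ (Pi.single f (1 : ℂ)) = Pi.single f 1 := by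
    have h2 := congrArg (marked χ) h
    rw [marked_marked, h, marked_smul] at h2
    exact (smul_right_injective _ hα' h2).symm
  set y : ι → ℂ := star U *ᵥ Pi.single f 1 with hy
  have hyt : ∀ t, y t = star (U f t) := fun t => by simp [hy, Matrix.star_apply]
  -- Among the states with `ε`, only `s` can occur in row `f` of `U`, and its entry there is `α`.
  -- Hence the reflection acts on `star U` applied to `f` as the reflection about `s` alone.
  have hεy : marked ε y = (α : ℂ) • Pi.single s 1 := by
    ext t
    by_cases hts : t = s
    · subst hts
      simp [marked, hs, hyt, hUf]
    · by_cases hUt : U f t = 0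
      · simp [marked, hyt, hUt, hts]
      · simp [marked, hε t hts hUt, hts]
  have hεs : marked ε (Pi.single s (1 : ℂ)) = Pi.single s 1 := by
    rw [marked_single, hs]; simp
  simp only [← Matrix.mulVec_mulVec]
  rw [signMat_mulVec χ, h, Matrix.mulVec_sub, Matrix.mulVec_mulVec _ (star U), hUU,
    Matrix.one_mulVec, Matrix.mulVec_smul, Matrix.mulVec_smul, ← hy, signMat_mulVec, marked_sub,
    marked_smul, marked_smul, hεy, hεs]
  have h3 : (Pi.single s 1 - (2 : ℂ) • (α : ℂ) • y - (2 : ℂ) • (Pi.single s (1 : ℂ) -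
      (2 : ℂ) • (α : ℂ) • (α : ℂ) • Pi.single s (1 : ℂ)) : ι → ℂ) =
      (4 * (α : ℂ) ^ 2 - 1) • Pi.single s (1 : ℂ) - (2 * (α : ℂ)) • y := by
    module
  rw [h3, Matrix.mulVec_sub, Matrix.mulVec_smul, Matrix.mulVec_smul, hy, Matrix.mulVec_mulVec,
    hUU', Matrix.one_mulVec, marked_sub, marked_smul, marked_smul, h, hf]
  push_cast
  module

end

/-! ### Norms of state vectors -/

section
variable {ι : Type} [Fintype ι]

theorem sum_norm_sq_mulVec [DecidableEq ι] {U : Matrix ι ι ℂ} (hU : U ∈ Matrix.unitaryGroup ι ℂ)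
    (ψ : ι → ℂ) : ∑ s, ‖(U *ᵥ ψ) s‖ ^ 2 = ∑ s, ‖ψ s‖ ^ 2 := by
  have key : ∀ φ : ι → ℂ, ((∑ s, ‖φ s‖ ^ 2 : ℝ) : ℂ) = star φ ⬝ᵥ φ := by
    intro φ
    simp only [dotProduct, Pi.star_apply, Complex.ofReal_sum]
    refine Finset.sum_congr rfl fun s _ => ?_
    rw [Complex.star_def, mul_comm, Complex.mul_conj, Complex.normSq_eq_norm_sq]
  apply Complex.ofReal_injective
  rw [key, key, Matrix.star_mulVec, Matrix.dotProduct_mulVec, Matrix.vecMul_vecMul,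
    ← Matrix.star_eq_conjTranspose, (Matrix.mem_unitaryGroup_iff').1 hU, Matrix.vecMul_one]

end

end QSearch

/-! ### Reversible classical computation by instruction sequences -/

namespace QSearch

open Matrix

/-! ### Reading registers -/

section
variable {k w : ℕ}

theorem Mem.read_update {d : ℕ} (h : d < k) (s : Mem k w) (v : BitVec w) (x : ℕ) :
    Mem.read (Function.update s ⟨d, h⟩ v) x = if x = d then v else s.read x := by
  unfold Mem.read
  by_cases hx : x < k
  · by_cases hxd : x = d
    · subst hxd; simp [hx]
    · simp [hx, hxd, Fin.ext_iff]
  · have : x ≠ d := by omega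
    simp [hx, this]

theorem Mem.ext_read {s t : Mem k w} (h : ∀ x, x < k → s.read x = t.read x) : s = t := by
  ext1 i
  have := h i i.2
  simpa [Mem.read] using this

theorem Mem.apply_eq_read (s : Mem k w) {d : ℕ} (h : d < k) : s ⟨d, h⟩ = s.read d := by
  simp [Mem.read, h]

theorem read_addReg {d : ℕ} (h : d < k) (f : Mem k w → BitVec w) (s : Mem k w) (x : ℕ) :
    Mem.read (addReg d f s) x =
      if x = d then s.read d + f (Function.update s ⟨d, h⟩ 0) else s.read x := by
  simp only [addReg, h, dif_pos, addInto, Equiv.coe_fn_mk, Mem.read_update, Mem.apply_eq_read]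

theorem read_negReg {d : ℕ} (h : d < k) (s : Mem k w) (x : ℕ) :
    Mem.read (negReg d s) x = if x = d then - s.read d else s.read x := by
  simp only [negReg, h, dif_pos, Equiv.coe_fn_mk, Mem.read_update, Mem.apply_eq_read]

theorem agreeOff_addReg (d : ℕ) (f : Mem k w → BitVec w) (s : Mem k w) :
    AgreeOff {d} (addReg d f s) s := by
  intro x hx
  by_cases h : d < k
  · rw [read_addReg h, if_neg (by simpa using hx)]
  · simp [addReg, h]

theorem agreeOff_negReg (d : ℕ) (s : Mem k w) : AgreeOff {d} (negReg d s) s := by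
  intro x hx
  by_cases h : d < k
  · rw [read_negReg h, if_neg (by simpa using hx)]
  · simp [negReg, h]

/-- `-(-x + f) = x - f`, as `f` does not see its target register. This inverts additive instructions
although there is no instruction for subtraction. -/
theorem negReg_addReg_negReg (d : ℕ) (f : Mem k w → BitVec w) :
    negReg d * addReg d f * negReg d = (addReg d f)⁻¹ := by
  by_cases h : d < k
  · rw [eq_inv_iff_mul_eq_one]
    ext1 s
    simp [negReg, addReg, h, addInto, sub_eq_add_neg]
  · simp [negReg, addReg, h]
    rfl

theorem negReg_inv (d : ℕ) : (negReg d : Equiv.Perm (Mem k w))⁻¹ = negReg d := by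
  rw [inv_eq_iff_mul_eq_one]
  ext1 s
  by_cases h : d < k
  · simp [negReg, h]
  · simp [negReg, h]

end

/-! ### Classical instructions -/

instance : DecidableEq Op := fun a b =>
  decidable_of_iff (Op.equivFin a = Op.equivFin b) Op.equivFin.injective.eq_iff

/-- Instructions that map basis states to basis states. -/
def Instr.IsClassical (I : Instr) : Prop := I.op ≠ .had ∧ I.op ≠ .phase

section
variable {r c : ℕ} (T : Fin r → Fin c → ℤ) {k w : ℕ}

/-- The value that a classical instruction adds to its target register, if register `x`
holds `g x`. -/
def Instr.val (g : ℕ → BitVec w) (I : Instr) : BitVec w :=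
  match I.op with
  | .imm => BitVec.ofNat w I.x
  | .copy => g I.x
  | .and => g I.x &&& g I.y
  | .shr => g I.x >>> (g I.y).toNat
  | .lt => if (g I.x).toInt < (g I.y).toInt then 1 else 0
  | .eq => if g I.x = g I.y then 1 else 0
  | .sel => if g I.x = 0 then 0 else g I.y
  | .query => entry T (g I.x) (g I.y)
  | _ => 0

/-- The permutation of the basis states by a classical instruction. -/
def Instr.perm (k w : ℕ) (I : Instr) : Equiv.Perm (Mem k w) :=
  if I.op = .neg then negReg I.d else addReg I.d fun s => I.val T s.read

/-- The permutation of the basis states by a sequence of classical instructions. -/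
def progPerm (k w : ℕ) : List Instr → Equiv.Perm (Mem k w)
  | [] => 1
  | I :: L => progPerm k w L * I.perm T k w

theorem instrMat_eq_permMat {I : Instr} (hI : I.IsClassical) :
    instrMat T k w I = permMat (I.perm T k w) := by
  obtain ⟨op, d, x, y⟩ := I
  obtain ⟨h1, h2⟩ := hI
  cases op <;> first | rfl | exact absurd rfl h1 | exact absurd rfl h2

theorem progMat_eq_permMat {L : List Instr} (hL : ∀ I ∈ L, I.IsClassical) :
    progMat T k w L = permMat (progPerm T k w L) := by
  induction L with
  | nil => exact permMat_one.symm
  | cons I L ih =>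
    rw [progMat_cons, progPerm, ih fun J hJ => hL J (List.mem_cons_of_mem _ hJ),
      instrMat_eq_permMat T (hL I List.mem_cons_self), permMat_mul]

/-- The effect of a classical instruction on the contents of the registers. -/
def Instr.exec (g : ℕ → BitVec w) (I : Instr) : ℕ → BitVec w :=
  if I.op = .neg then Function.update g I.d (-g I.d) else Function.update g I.d (g I.d + I.val T g)

/-- The effect of a sequence of classical instructions on the contents of the registers. -/
def execs (g : ℕ → BitVec w) (L : List Instr) : ℕ → BitVec w := L.foldl (Instr.exec T) g

/-- A classical instruction on `k` registers whose target is not an operand. -/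
def Instr.WF (k : ℕ) (I : Instr) : Prop :=
  I.IsClassical ∧ I.d < k ∧ (I.op = .imm ∨ I.op = .neg ∨ (I.x ≠ I.d ∧ I.y ≠ I.d))

theorem Instr.val_congr {I : Instr} {g h : ℕ → BitVec w}
    (hI : I.op = .imm ∨ I.op = .neg ∨ (g I.x = h I.x ∧ g I.y = h I.y)) :
    I.val T g = I.val T h := by
  obtain ⟨op, d, x, y⟩ := I
  rcases hI with hI | hI | ⟨h1, h2⟩
  · simp only at hI; subst hI; rfl
  · simp only at hI; subst hI; rfl
  · simp only at h1 h2
    cases op <;> simp [Instr.val, h1, h2]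

/-- Since the target is not an operand, evaluating the added value with the target set to zero makes
no difference. Straight-line execution on register contents is therefore a faithful model. -/
theorem read_perm {I : Instr} (hI : I.WF k) (s : Mem k w) :
    (I.perm T k w s).read = I.exec T s.read := by
  obtain ⟨-, hd, hxy⟩ := hI
  ext1 x
  unfold Instr.perm Instr.exec
  by_cases hn : I.op = .neg
  · simp [hn, read_negReg hd, Function.update_apply]
  · simp only [hn, if_false, read_addReg hd, Function.update_apply]
    refine if_congr Iff.rfl ?_ rfl
    congr 1
    apply Instr.val_congr
    rcases hxy with h | h | ⟨h1, h2⟩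
    · exact Or.inl h
    · exact Or.inr (Or.inl h)
    · right; right
      rw [Mem.read_update, Mem.read_update, if_neg h1, if_neg h2]
      exact ⟨rfl, rfl⟩

theorem read_progPerm {L : List Instr} (hL : ∀ I ∈ L, I.WF k) (s : Mem k w) :
    (progPerm T k w L s).read = execs T s.read L := by
  induction L generalizing s with
  | nil => rfl
  | cons I L ih =>
    rw [progPerm, Equiv.Perm.mul_apply, ih fun J hJ => hL J (List.mem_cons_of_mem _ hJ),
      read_perm T (hL I List.mem_cons_self)]
    rfl

theorem execs_append (g : ℕ → BitVec w) (L₁ L₂ : List Instr) :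
    execs T g (L₁ ++ L₂) = execs T (execs T g L₁) L₂ := List.foldl_append

theorem Instr.exec_of_ne (g : ℕ → BitVec w) (I : Instr) {x : ℕ} (h : x ≠ I.d) :
    I.exec T g x = g x := by
  unfold Instr.exec
  split_ifs <;> simp [h]

theorem execs_of_forall_ne (g : ℕ → BitVec w) {L : List Instr} {x : ℕ} (h : ∀ I ∈ L, x ≠ I.d) :
    execs T g L x = g x := by
  induction L generalizing g with
  | nil => rfl
  | cons I L ih =>
    change execs T (I.exec T g) L x = _
    rw [ih _ fun J hJ => h J (List.mem_cons_of_mem _ hJ),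
      Instr.exec_of_ne T g I (h I List.mem_cons_self)]

end

/-! ### Running an instruction sequence backwards -/

/-- An instruction sequence that undoes an instruction (other than a phase gate). -/
def Instr.undo (I : Instr) : List Instr :=
  if I.op = .neg ∨ I.op = .had then [I] else [⟨.neg, I.d, 0, 0⟩, I, ⟨.neg, I.d, 0, 0⟩]

/-- An instruction sequence that undoes a sequence without phase gates. -/
def undo (L : List Instr) : List Instr := L.reverse.flatMap Instr.undo

theorem undo_cons (I : Instr) (L : List Instr) : undo (I :: L) = undo L ++ I.undo := by
  simp [undo]

section
variable {r c : ℕ} (T : Fin r → Fin c → ℤ) {k w : ℕ}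

theorem star_hadamardMat (d : Fin k) : star (hadamardMat (w := w) d) = hadamardMat d := by
  have hX : star (permMat (flipLow (w := w) d)) = permMat (flipLow d) := by
    rw [star_permMat]; rfl
  have hZ : star (zMat (w := w) d) = zMat d := by
    rw [zMat, Matrix.star_eq_conjTranspose, Matrix.diagonal_conjTranspose]
    congr 1
    ext s
    by_cases h : (s d).getLsbD 0 <;> simp [h]
  rw [hadamardMat, star_smul, star_add, hX, hZ, star_trivial]

theorem progMat_instr_undo {I : Instr} (hI : I.op ≠ .phase) :
    progMat T k w I.undo = star (instrMat T k w I) := by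
  by_cases hh : I.op = .had
  · have h1 : I.undo = [I] := by simp [Instr.undo, hh]
    rw [h1, progMat_cons, progMat_nil, Matrix.one_mul]
    obtain ⟨op, d, x, y⟩ := I
    simp only at hh
    subst hh
    unfold instrMat Instr.toStep
    simp only
    split_ifs with h
    · exact (star_hadamardMat _).symm
    · simp [Step.mat]
  · rw [instrMat_eq_permMat T ⟨hh, hI⟩, star_permMat]
    by_cases hn : I.op = .neg
    · have h1 : I.undo = [I] := by simp [Instr.undo, hn]
      rw [h1, progMat_cons, progMat_nil, Matrix.one_mul, instrMat_eq_permMat T ⟨hh, hI⟩]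
      simp [Instr.perm, hn, negReg_inv]
    · have h1 : I.undo = [⟨.neg, I.d, 0, 0⟩, I, ⟨.neg, I.d, 0, 0⟩] := by
        simp [Instr.undo, hn, hh]
      have h2 : Instr.IsClassical ⟨.neg, I.d, 0, 0⟩ := ⟨by simp, by simp⟩
      rw [h1, progMat_cons, progMat_cons, progMat_cons, progMat_nil, Matrix.one_mul,
        instrMat_eq_permMat T ⟨hh, hI⟩, instrMat_eq_permMat T h2, permMat_mul, permMat_mul]
      congr 1
      simp only [Instr.perm, hn, if_false, if_true]
      exact negReg_addReg_negReg _ _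

theorem progMat_undo {L : List Instr} (hL : ∀ I ∈ L, I.op ≠ .phase) :
    progMat T k w (undo L) = star (progMat T k w L) := by
  induction L with
  | nil => simp [undo, progMat_nil]
  | cons I L ih =>
    rw [undo_cons, progMat_append, ih fun J hJ => hL J (List.mem_cons_of_mem _ hJ), progMat_cons,
      progMat_instr_undo T (hL I List.mem_cons_self), star_mul]

theorem length_undo_le (L : List Instr) : (undo L).length ≤ 3 * L.length := by
  induction L with
  | nil => simp [undo]
  | cons I L ih =>
    have : I.undo.length ≤ 3 := by unfold Instr.undo; split_ifs <;> simp
    rw [undo_cons, List.length_append, List.length_cons]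
    omega

/-! ### Instructions only change their target -/

theorem actsOn_instrMat {I : Instr} : ActsOn {I.d} (instrMat T k w I) := by
  by_cases hp : I.op = .phase
  · obtain ⟨op, d, x, y⟩ := I
    simp only at hp
    subst hp
    unfold instrMat Instr.toStep
    simp only
    split_ifs
    · exact ActsOn.diagonal _
    · exact ActsOn.one
  by_cases hh : I.op = .had
  · obtain ⟨op, d, x, y⟩ := I
    simp only at hh
    subst hh
    unfold instrMat Instr.toStep
    simp only
    split_ifs with h
    · intro t s hts
      have h1 : permMat (flipLow ⟨d, h.1⟩) t s ≠ 0 ∨ zMat ⟨d, h.1⟩ t s ≠ 0 := by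
        by_contra hcon
        push Not at hcon
        exact hts (by simp [Step.mat, hadamardMat, hcon.1, hcon.2])
      rcases h1 with h1 | h1
      · refine ActsOn.permMat (fun u x hx => ?_) _ _ h1
        simp only [flipLow, Equiv.coe_fn_mk]
        rw [Mem.read_update, if_neg (by simpa using hx)]
      · exact ActsOn.diagonal _ _ _ h1
    · exact ActsOn.one
  · rw [instrMat_eq_permMat T ⟨hh, hp⟩]
    refine ActsOn.permMat fun s => ?_
    unfold Instr.perm
    split_ifs
    · exact agreeOff_negReg _ _
    · exact agreeOff_addReg _ _ _

theorem actsOn_progMat {R : Set ℕ} {L : List Instr} (hL : ∀ I ∈ L, I.d ∈ R) :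
    ActsOn R (progMat T k w L) := by
  induction L with
  | nil => exact ActsOn.one
  | cons I L ih =>
    exact (ih fun J hJ => hL J (List.mem_cons_of_mem _ hJ)).mul
      ((actsOn_instrMat T).mono (by simpa using hL I List.mem_cons_self))

/-! ### The two gates that are not classical -/

/-- The fourth power of `e^{iπ/4}` is `-1`; this is the only use made of the phase gate. -/
theorem progMat_phase_four {d : ℕ} (hd : d < k) :
    progMat T k w (List.replicate 4 ⟨.phase, d, 0, 0⟩) =
      signMat fun s : Mem k w => (s.read d).getLsbD 0 := by
  have h1 : instrMat T k w ⟨.phase, d, 0, 0⟩ = phaseMat ⟨d, hd⟩ := by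
    unfold instrMat Instr.toStep
    simp [hd, Step.mat]
  have h2 : Complex.exp (Complex.I * (Real.pi / 4 : ℝ)) * (Complex.exp (Complex.I *
      (Real.pi / 4 : ℝ)) * (Complex.exp (Complex.I * (Real.pi / 4 : ℝ)) *
      Complex.exp (Complex.I * (Real.pi / 4 : ℝ)))) = -1 := by
    rw [← Complex.exp_add, ← Complex.exp_add, ← Complex.exp_add, ← Complex.exp_pi_mul_I]
    congr 1
    push_cast
    ring
  simp only [List.replicate, progMat_cons, progMat_nil, Matrix.one_mul, h1, phaseMat,
    Matrix.diagonal_mul_diagonal, signMat]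
  congr 1
  ext s
  rw [Mem.apply_eq_read s hd]
  by_cases h : (s.read d).getLsbD 0
  · simp only [h, if_true]
    rw [← h2]
    ring
  · simp [h]

theorem instrMat_had_mulVec {d : ℕ} (hd : d < k) (hw : 0 < w) {s : Mem k w} (hs : s.read d = 0) :
    instrMat T k w ⟨.had, d, 0, 0⟩ *ᵥ Pi.single s 1 =
      (((Real.sqrt 2)⁻¹ : ℝ) : ℂ) • (Pi.single (Function.update s ⟨d, hd⟩ 1) 1 + Pi.single s 1) := by
  have h1 : instrMat T k w ⟨.had, d, 0, 0⟩ = hadamardMat ⟨d, hd⟩ := by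
    unfold instrMat Instr.toStep
    simp [hd, hw, Step.mat]
  have h2 : zMat ⟨d, hd⟩ *ᵥ Pi.single s (1 : ℂ) = Pi.single s 1 := by
    ext t
    by_cases hts : t = s
    · subst hts
      simp [zMat, Matrix.mulVec_diagonal, Mem.apply_eq_read, hs]
    · simp [zMat, Matrix.mulVec_diagonal, hts]
  have h3 : flipLow ⟨d, hd⟩ s = Function.update s ⟨d, hd⟩ 1 := by
    simp only [flipLow, Equiv.coe_fn_mk, Mem.apply_eq_read, hs]
    congr 1
    simp
  rw [h1, hadamardMat, Matrix.smul_mulVec, Matrix.add_mulVec, permMat_mulVec_single, h2, h3]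
  rfl

end

end QSearch

/-! ### The staircase boundary and the walk along it -/

namespace QSearch

/-! ### Words -/

theorem toInt_ofInt_of_fits {w : ℕ} {z : ℤ} (h : Fits w z) : (BitVec.ofInt w z).toInt = z := by
  obtain ⟨h1, h2⟩ := h
  rw [BitVec.toInt_ofInt]
  have h3 : ((2 ^ w : ℕ) : ℤ) = 2 ^ w := by push_cast; rfl
  rw [Int.bmod_eq_of_le_mul_two] <;> omega

theorem toNat_ofInt_of_fits {w : ℕ} {z : ℤ} (h0 : 0 ≤ z) (h : Fits w z) :
    ((BitVec.ofInt w z).toNat : ℤ) = z := by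
  obtain ⟨h1, h2⟩ := h
  rw [BitVec.toNat_ofInt]
  have h3 : ((2 ^ w : ℕ) : ℤ) = 2 ^ w := by push_cast; rfl
  rw [Int.toNat_of_nonneg (Int.emod_nonneg _ (by rw [h3]; positivity))]
  apply Int.emod_eq_of_lt h0
  omega

theorem ofNat_eq_ofInt (w d : ℕ) : BitVec.ofNat w d = BitVec.ofInt w (d : ℤ) :=
  (BitVec.ofInt_natCast w d).symm

theorem ofInt_sub (w : ℕ) (x y : ℤ) :
    BitVec.ofInt w (x - y) = BitVec.ofInt w x - BitVec.ofInt w y := by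
  rw [sub_eq_add_neg, BitVec.ofInt_add, BitVec.ofInt_neg, sub_eq_add_neg]

theorem BitVec_natCast_ne_zero {w n : ℕ} (h0 : 0 < n) (h : n < 2 ^ w) : BitVec.ofNat w n ≠ 0 := by
  intro hn
  have := congrArg BitVec.toNat hn
  rw [BitVec.toNat_ofNat, Nat.mod_eq_of_lt h] at this
  simp at this
  omega

/-- A sum of at most three truth values vanishes only if all of them are false. -/
theorem truth_sum_eq_zero {w : ℕ} (hw : 2 ≤ w) (A B C D : Prop) [Decidable A] [Decidable B]
    [Decidable C] [Decidable D] :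
    ((if A then 1 else 0) &&& (if B then 1 else 0)) + (if C then 1 else 0) +
      (if D then 1 else 0) = (0 : BitVec w) ↔ ¬((A ∧ B) ∨ C ∨ D) := by
  -- With at least two bits the values 1, 2 and 3 do not wrap around to zero.
  have h4 : 4 ≤ 2 ^ w := by
    calc 4 = 2 ^ 2 := rfl
      _ ≤ 2 ^ w := Nat.pow_le_pow_right (by norm_num) hw
  have h1 : (1 : BitVec w) ≠ 0 := BitVec_natCast_ne_zero (n := 1) (by norm_num) (by omega)
  have h2 : (1 + 1 : BitVec w) ≠ 0 := by
    have := BitVec_natCast_ne_zero (w := w) (n := 2) (by norm_num) (by omega)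
    rwa [show 2 = 1 + 1 from rfl, BitVec.ofNat_add] at this
  have h3 : (1 + 1 + 1 : BitVec w) ≠ 0 := by
    have := BitVec_natCast_ne_zero (w := w) (n := 3) (by norm_num) (by omega)
    rwa [show 3 = 1 + 1 + 1 from rfl, BitVec.ofNat_add, BitVec.ofNat_add] at this
  have h5 : (1 : BitVec w) &&& 0 = 0 := BitVec.and_zero
  have h6 : (0 : BitVec w) &&& 1 = 0 := BitVec.zero_and
  have h7 : (0 : BitVec w) &&& 0 = 0 := BitVec.zero_and
  by_cases hA : A <;> by_cases hB : B <;> by_cases hC : C <;> by_cases hD : D <;>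
    simp only [hA, hB, hC, hD, h1, h2, h3, h5, h6, h7, if_true, if_false, BitVec.and_self,
      zero_add, add_zero, and_self, or_self, not_true, not_false_iff, and_true, and_false, or_true,
      or_false]

/-! ### The instruction sequences -/

/-- One step of the binary search: unless register `β` is zero, decrease the position in registers
`n + 10` and `n + 11` by `d` in both coordinates if it stays on the upper side of the boundary;
put the result into registers `n` and `n + 1`. -/
def stepCode (c β n d : ℕ) : List Instr :=
  [⟨.imm, n + 6, d, 0⟩,
   ⟨.imm, n + 2, d, 0⟩, ⟨.neg, n + 2, 0, 0⟩, ⟨.copy, n + 2, n + 10, 0⟩,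
   ⟨.imm, n + 3, d, 0⟩, ⟨.neg, n + 3, 0, 0⟩, ⟨.copy, n + 3, n + 11, 0⟩,
   ⟨.imm, n + 4, c, 0⟩, ⟨.copy, n + 4, n + 3, 0⟩,
   ⟨.query, n + 5, n + 2, n + 4⟩,
   ⟨.lt, n + 7, n + 5, 0⟩, ⟨.lt, n + 8, n + 3, 4⟩,
   ⟨.and, n + 9, n + 7, n + 8⟩, ⟨.lt, n + 9, n + 2, 4⟩, ⟨.eq, n + 9, β, 4⟩,
   ⟨.copy, n, n + 2, 0⟩, ⟨.sel, n, n + 9, n + 6⟩,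
   ⟨.copy, n + 1, n + 3, 0⟩, ⟨.sel, n + 1, n + 9, n + 6⟩]

section
variable {r c w : ℕ} (T : Fin r → Fin c → ℤ)

/-- The condition under which a step of the binary search leaves the position `(P, Q)` alone. -/
def Rejects (A B P Q : BitVec w) (d : ℕ) : Prop :=
  ((entry T (P - BitVec.ofNat w d) (BitVec.ofNat w c + (Q - BitVec.ofNat w d))).toInt < A.toInt ∧
    (Q - BitVec.ofNat w d).toInt < 0) ∨ (P - BitVec.ofNat w d).toInt < 0 ∨ B = 0

open Classical in
-- Register `n + 9` counts the reasons for staying put. Both coordinates are decreased by `d`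
-- unconditionally, and `sel` adds `d` back if this count is not zero. All scratch registers are
-- fresh, so nothing has to be erased inside the step.
theorem execs_stepCode (hw : 2 ≤ w) {g : ℕ → BitVec w} {β n d : ℕ} (hn : 20 ≤ n)
    (hβ : n + 10 ≤ β) (h4 : g 4 = 0) (h0 : ∀ i, i < 10 → g (n + i) = 0) :
    execs T g (stepCode c β n d) n =
        (if Rejects T (g 0) (g β) (g (n + 10)) (g (n + 11)) d then g (n + 10)
          else g (n + 10) - BitVec.ofNat w d) ∧
      execs T g (stepCode c β n d) (n + 1) =
        (if Rejects T (g 0) (g β) (g (n + 10)) (g (n + 11)) d then g (n + 11)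
          else g (n + 11) - BitVec.ofNat w d) := by
  obtain ⟨n, rfl⟩ : ∃ m, n = m + 20 := ⟨n - 20, by omega⟩
  have b0 : β ≠ n + 20 := by omega
  have b1 : β ≠ n + 21 := by omega
  have b2 : β ≠ n + 22 := by omega
  have b3 : β ≠ n + 23 := by omega
  have b4 : β ≠ n + 24 := by omega
  have b5 : β ≠ n + 25 := by omega
  have b6 : β ≠ n + 26 := by omega
  have b7 : β ≠ n + 27 := by omega
  have b8 : β ≠ n + 28 := by omega
  have b9 : β ≠ n + 29 := by omega
  have z0 := h0 0 (by norm_num)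
  have z1 := h0 1 (by norm_num)
  have z2 := h0 2 (by norm_num)
  have z3 := h0 3 (by norm_num)
  have z4 := h0 4 (by norm_num)
  have z5 := h0 5 (by norm_num)
  have z6 := h0 6 (by norm_num)
  have z7 := h0 7 (by norm_num)
  have z8 := h0 8 (by norm_num)
  have z9 := h0 9 (by norm_num)
  simp only [add_assoc, Nat.reduceAdd, add_zero] at z0 z1 z2 z3 z4 z5 z6 z7 z8 z9
  have key := truth_sum_eq_zero hw
    ((entry T (g (n + 30) - BitVec.ofNat w d)
      (BitVec.ofNat w c + (g (n + 31) - BitVec.ofNat w d))).toInt < (g 0).toInt)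
    ((g (n + 31) - BitVec.ofNat w d).toInt < 0) ((g (n + 30) - BitVec.ofNat w d).toInt < 0)
    (g β = 0)
  have e1 : ∀ x y : BitVec w, -x + y = y - x := fun x y => by ring
  have e2 : (0 : BitVec w).toInt = 0 := by simp
  constructor <;>
  · simp only [stepCode, execs, List.foldl_cons, List.foldl_nil, Instr.exec, Instr.val,
      Function.update_apply, reduceCtorEq, if_false, if_true, Nat.reduceEqDiff,
      Nat.add_left_cancel_iff, Nat.add_assoc, Nat.reduceAdd, zero_add, b2, b3, b4, b5, b6, b7,
      b8, b9, z0, z1, z2, z3, z4, z5, z6, z7, z8, z9, h4, e1, e2, key, Rejects,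
      ite_not]
    split_ifs <;> simp

theorem stepCode_d {c β n d : ℕ} {I : Instr} (hI : I ∈ stepCode c β n d) :
    n ≤ I.d ∧ I.d < n + 10 := by
  simp only [stepCode, List.mem_cons, List.not_mem_nil, or_false] at hI
  rcases hI with h | h | h | h | h | h | h | h | h | h | h | h | h | h | h | h | h | h | h <;>
    subst h <;> constructor <;> simp only <;> omega

theorem stepCode_wf {c β n d k : ℕ} (hn : 20 ≤ n) (hβ : n + 10 ≤ β) (hk : n + 10 ≤ k)
    {I : Instr} (hI : I ∈ stepCode c β n d) : I.WF k := by
  simp only [stepCode, List.mem_cons, List.not_mem_nil, or_false] at hI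
  rcases hI with h | h | h | h | h | h | h | h | h | h | h | h | h | h | h | h | h | h | h <;>
    subst h <;> simp [Instr.WF, Instr.IsClassical] <;> omega

end

end QSearch

namespace QSearch

/-! ### The boundary between the small and the large entries -/

section
variable {r c : ℕ} {T : Fin r → Fin c → ℤ} {a : ℤ}

/-- The cell in row `p - 1`, column `q - 1` (of the array extended by small entries above and to
the left, and large entries elsewhere) is smaller than `a`. -/
def Below (T : Fin r → Fin c → ℤ) (a p q : ℤ) : Prop :=
  p ≤ 0 ∨ q ≤ 0 ∨ ∃ (i : Fin r) (j : Fin c), (i : ℤ) + 1 = p ∧ (j : ℤ) + 1 = q ∧ T i j < a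

theorem Below.mono {w : ℕ} (hT : IsSortedArray w T) {p q p' q' : ℤ} (hp : p' ≤ p) (hq : q' ≤ q)
    (h : Below T a p q) : Below T a p' q' := by
  by_cases hp0 : p' ≤ 0
  · exact Or.inl hp0
  by_cases hq0 : q' ≤ 0
  · exact Or.inr (Or.inl hq0)
  rcases h with h | h | ⟨i, j, hi, hj, h⟩
  · omega
  · omega
  · refine Or.inr (Or.inr ⟨⟨(p' - 1).toNat, by omega⟩, ⟨(q' - 1).toNat, by omega⟩, ?_, ?_, ?_⟩)
    · simp only; omega
    · simp only; omega
    · refine lt_of_le_of_lt ?_ h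
      refine (hT.col_sorted _ (?_ : _ ≤ i)).trans (hT.row_sorted i (?_ : _ ≤ j))
      · rw [Fin.le_def]; simp only; omega
      · rw [Fin.le_def]; simp only; omega

/-- The left neighbour of an occurrence of `a` is strictly smaller because entries are distinct.
Together with `not_below_of_eq` this ties the occurrence to a crossing of the boundary. -/
theorem below_of_eq {w : ℕ} (hT : IsSortedArray w T) {i : Fin r} {j : Fin c} (h : T i j = a) :
    Below T a (i + 1) j := by
  by_cases hj : (j : ℕ) = 0
  · right; left; omega
  · refine Or.inr (Or.inr ⟨i, ⟨j - 1, by omega⟩, rfl, ?_, ?_⟩)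
    · simp only; omega
    · rw [← h]
      refine lt_of_le_of_ne (hT.row_sorted i (by rw [Fin.le_def]; simp)) fun heq => ?_
      have := hT.distinct (a₁ := (i, ⟨j - 1, by omega⟩)) (a₂ := (i, j)) heq
      simp only [Prod.mk.injEq, true_and, Fin.ext_iff] at this
      omega

theorem not_below_of_eq {w : ℕ} (hT : IsSortedArray w T) {i : Fin r} {j : Fin c} (h : T i j = a) :
    ¬ Below T a (i + 2) (j + 1) := by
  rintro (h' | h' | ⟨i', j', hi, hj, h'⟩)
  · omega
  · omega
  · have hjj : j' = j := by ext; omega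
    subst hjj
    have := hT.col_sorted j' (show i ≤ i' by rw [Fin.le_def]; omega)
    simp only at this
    omega

/-- `(p, q)` is a position from which going up and left by at most `n` cells along the diagonal
leads to the boundary. -/
structure Bracket (T : Fin r → Fin c → ℤ) (a n p q : ℤ) : Prop where
  nonneg : 0 ≤ p
  le : p ≤ r
  le_col : n ≤ q
  below : Below T a (p - n) (q - n)
  not_below : ¬ Below T a (p + 1) (q + 1)

/-- Going up and left by `d` cells does not cross the boundary. -/
def Accepts (T : Fin r → Fin c → ℤ) (a p q d : ℤ) : Prop :=
  d ≤ p ∧ ((c : ℤ) ≤ q - d ∨ ∃ (i : Fin r) (j : Fin c), (i : ℤ) = p - d ∧ (j : ℤ) = q - d ∧ a ≤ T i j)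

/-- The column test accounts for the large entries to the right of the array. The region beneath it
needs no test, as `p - d < r`. -/
theorem accepts_iff {p q d : ℤ} (hd : 1 ≤ d) (hp : p ≤ r) (hq : d ≤ q) :
    Accepts T a p q d ↔ ¬ Below T a (p - d + 1) (q - d + 1) := by
  constructor
  · rintro ⟨h1, h2⟩ (h | h | ⟨i, j, hi, hj, h⟩)
    · omega
    · omega
    · rcases h2 with h2 | ⟨i', j', hi', hj', h2⟩
      · omega
      · have h3 : i = i' := by ext; omega
        have h4 : j = j' := by ext; omega
        subst h3 h4
        omega
  · intro h
    have h1 : d ≤ p := by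
      by_contra hcon
      exact h (Or.inl (by omega))
    refine ⟨h1, ?_⟩
    by_cases h2 : (c : ℤ) ≤ q - d
    · exact Or.inl h2
    · refine Or.inr ⟨⟨(p - d).toNat, by omega⟩, ⟨(q - d).toNat, by omega⟩, ?_, ?_, ?_⟩
      · simp only; omega
      · simp only; omega
      · by_contra hcon
        refine h (Or.inr (Or.inr ⟨_, _, ?_, ?_, not_le.1 hcon⟩))
        · simp only; omega
        · simp only; omega

theorem Bracket.accept {n p q d : ℤ} (h : Bracket T a (n + d) p q) (hd : 1 ≤ d) (hn : 0 ≤ n)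
    (hacc : Accepts T a p q d) : Bracket T a n (p - d) (q - d) where
  nonneg := by have := hacc.1; omega
  le := by have := h.le; omega
  le_col := by have := h.le_col; omega
  below := by
    have := h.below
    rwa [show p - d - n = p - (n + d) by ring, show q - d - n = q - (n + d) by ring]
  not_below := (accepts_iff hd h.le (by have := h.le_col; omega)).1 hacc

/-- A rejected step puts the boundary less than `d` cells away: `Below` holds `d - 1` cells up the
diagonal. Hence a bracket of any length `n ≥ d - 1` suffices. -/
theorem Bracket.reject {w : ℕ} (hT : IsSortedArray w T) {n p q d : ℤ}
    (h : Bracket T a (n + d) p q) (hd : 1 ≤ d) (hn : 0 ≤ n) (hdn : d ≤ n + 1)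
    (hrej : ¬ Accepts T a p q d) : Bracket T a n p q where
  nonneg := h.nonneg
  le := h.le
  le_col := by have := h.le_col; omega
  below := by
    rw [accepts_iff hd h.le (by have := h.le_col; omega), not_not] at hrej
    exact hrej.mono hT (by omega) (by omega)
  not_below := h.not_below

/-- Moving right stays on the large side. Going back `n` cells along the new diagonal ends at `(p -
n, q)`, straight above the crossing `(p, q)`, hence on the small side. -/
theorem Bracket.jump {w : ℕ} (hT : IsSortedArray w T) {p q n : ℤ} (h : Bracket T a 0 p q)
    (hn : 0 ≤ n) : Bracket T a n p (q + n) where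
  nonneg := h.nonneg
  le := h.le
  le_col := by have := h.le_col; omega
  below := h.below.mono hT (by omega) (by omega)
  not_below := fun hb => h.not_below (hb.mono hT (by omega) (by omega))

theorem Bracket.col_le {p q : ℤ} (h : Bracket T a 0 p q) (hp : 1 ≤ p) : q ≤ c := by
  rcases h.below with h | h | ⟨i, j, hi, hj, h⟩ <;> omega

/-- Along a diagonal `Below` changes only once, by monotonicity, and an occurrence of `a` shows
where. -/
theorem Bracket.eq_of_eq {w : ℕ} (hT : IsSortedArray w T) {p q : ℤ} (h : Bracket T a 0 p q)
    {i : Fin r} {j : Fin c} (hij : T i j = a) (hd : (j : ℤ) - (i + 1) = q - p) :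
    p = i + 1 ∧ q = j := by
  have h1 := below_of_eq hT hij
  have h2 := not_below_of_eq hT hij
  have h3 := h.below
  rw [sub_zero, sub_zero] at h3
  by_contra hcon
  rcases lt_trichotomy p (i + 1) with hlt | heq | hgt
  · exact h.not_below (h1.mono hT (by omega) (by omega))
  · omega
  · exact h2 (h3.mono hT (by omega) (by omega))

/-- The walk cannot leave through the top edge before or on the diagonal of `a`. At `p = 0` the top
row would be large from column `q` on, whereas the top row is small just left of the column of `a`.
-/
theorem Bracket.pos_of_eq {w : ℕ} (hT : IsSortedArray w T) {p q : ℤ} (h : Bracket T a 0 p q)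
    {i : Fin r} {j : Fin c} (hij : T i j = a) (hd : q - p ≤ (j : ℤ) - (i + 1)) : 1 ≤ p := by
  by_contra hcon
  have := h.nonneg
  exact h.not_below ((below_of_eq hT hij).mono hT (by omega) (by omega))

theorem Bracket.start (T : Fin r → Fin c → ℤ) (a : ℤ) : Bracket T a 0 r 0 where
  nonneg := by omega
  le := le_rfl
  le_col := le_rfl
  below := Or.inr (Or.inl (by omega))
  not_below := by
    rintro (h | h | ⟨i, j, hi, hj, h⟩) <;> omega

end

/-- A sorted array of distinct `w`-bit integers is too small for a walk along its boundary to
overflow a `w`-bit word. -/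
theorem two_mul_add_lt {r c w : ℕ} {T : Fin r → Fin c → ℤ} (hT : IsSortedArray w T)
    (hr : Fits w r) (hc : Fits w c) (hr1 : 1 ≤ r) (hc1 : 1 ≤ c) : 2 * (r + c) < 2 ^ w + 4 := by
  have hcard : r * c ≤ 2 ^ w := by
    have hinj : Function.Injective fun p : Fin r × Fin c => BitVec.ofInt w (T p.1 p.2) := by
      intro p q hpq
      apply hT.distinct
      have := congrArg BitVec.toInt hpq
      simpa only [toInt_ofInt_of_fits (hT.fits _ _)] using this
    have hinj' : Function.Injective fun p : Fin r × Fin c =>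
        (BitVec.ofInt w (T p.1 p.2)).toFin := fun p q hpq =>
      hinj (BitVec.eq_of_toFin_eq hpq)
    simpa using Fintype.card_le_of_injective _ hinj'
  have hr2 : 2 * r < 2 ^ w := by exact_mod_cast hr.2
  have hc2 : 2 * c < 2 ^ w := by exact_mod_cast hc.2
  -- If a side is at most 2, the bound on the other side is enough. Otherwise `(r - 2) * (c - 2) ≥
  -- 1` gives `2 * (r + c) ≤ r * c + 3`.
  by_cases h1 : r = 1
  · omega
  by_cases h2 : c = 1
  · omega
  by_cases h3 : r = 2
  · omega
  by_cases h4 : c = 2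
  · omega
  obtain ⟨r, rfl⟩ : ∃ k, r = k + 3 := ⟨r - 3, by omega⟩
  obtain ⟨c, rfl⟩ : ∃ k, c = k + 3 := ⟨c - 3, by omega⟩
  have : (r + 3) * (c + 3) = r * c + 3 * r + 3 * c + 9 := by ring
  omega

end QSearch

namespace QSearch

/-! ### Binary search for the boundary -/

section
variable {r c w : ℕ} {T : Fin r → Fin c → ℤ} {a : ℤ}

theorem entry_ofInt {i : Fin r} {j : Fin c} {x y : ℤ} (hr : Fits w r) (hc : Fits w c)
    (hx : (i : ℤ) = x) (hy : (j : ℤ) = y) :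
    entry T (BitVec.ofInt w x) (BitVec.ofInt w y) = BitVec.ofInt w (T i j) := by
  have h0 : (0 : ℤ) < 2 ^ w := by positivity
  have h1 : (BitVec.ofInt w x).toNat = i := by
    have := toNat_ofInt_of_fits (w := w) (z := x) (by omega)
      ⟨by omega, by have := hr.2; omega⟩
    omega
  have h2 : (BitVec.ofInt w y).toNat = j := by
    have := toNat_ofInt_of_fits (w := w) (z := y) (by omega)
      ⟨by omega, by have := hc.2; omega⟩
    omega
  unfold entry
  rw [dif_pos ⟨by rw [h1]; exact i.2, by rw [h2]; exact j.2⟩]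
  congr 2
  · ext; exact h1
  · ext; exact h2

/-- The column is stored as `q - c`: a jump may carry `q` up to `c + D`, which need not fit a signed
word, while `q - c - d` lies between `-c` and `D`. When the queried cell is outside of the array,
the sign tests decide, whatever the query returns. -/
theorem not_rejects_iff (hT : IsSortedArray w T) (ha : Fits w a) (hr : Fits w r) (hc : Fits w c)
    {B : BitVec w} (hB : B ≠ 0) {p q : ℤ} {d D : ℕ} (hd : 1 ≤ d) (hp0 : 0 ≤ p) (hp : p ≤ r)
    (hq : (d : ℤ) ≤ q) (hqD : q ≤ c + D) (hdD : d ≤ D) (hD : Fits w D) :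
    ¬ Rejects T (BitVec.ofInt w a) B (BitVec.ofInt w p) (BitVec.ofInt w (q - c)) d ↔
      Accepts T a p q d := by
  have h1 : BitVec.ofInt w p - BitVec.ofNat w d = BitVec.ofInt w (p - d) := by
    rw [ofNat_eq_ofInt, ofInt_sub]
  have h2 : BitVec.ofInt w (q - c) - BitVec.ofNat w d = BitVec.ofInt w (q - c - d) := by
    rw [ofNat_eq_ofInt, ofInt_sub _ (q - c)]
  have h3 : BitVec.ofNat w c + BitVec.ofInt w (q - c - d) = BitVec.ofInt w (q - d) := by
    rw [ofNat_eq_ofInt, ← BitVec.ofInt_add]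
    congr 1
    ring
  obtain ⟨hr1, hr2⟩ := hr
  obtain ⟨hc1, hc2⟩ := hc
  obtain ⟨hD1, hD2⟩ := hD
  have hdD' : (d : ℤ) ≤ D := by exact_mod_cast hdD
  have f1 : (BitVec.ofInt w (p - d)).toInt = p - d :=
    toInt_ofInt_of_fits ⟨by omega, by omega⟩
  have f2 : (BitVec.ofInt w (q - c - d)).toInt = q - c - d :=
    toInt_ofInt_of_fits ⟨by omega, by omega⟩
  unfold Rejects Accepts
  rw [h1, h2, h3, f1, f2, toInt_ofInt_of_fits ha]
  by_cases hpd : p - d < 0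
  · constructor
    · intro h; exact absurd (Or.inr (Or.inl hpd)) h
    · rintro ⟨h, -⟩; omega
  by_cases hqd : (c : ℤ) ≤ q - d
  · constructor
    · intro _; exact ⟨by omega, Or.inl hqd⟩
    · rintro - (⟨-, h⟩ | h | h)
      · omega
      · omega
      · exact hB h
  · have hi : (((⟨(p - d).toNat, by omega⟩ : Fin r) : ℕ) : ℤ) = p - d := by simp only; omega
    have hj : (((⟨(q - d).toNat, by omega⟩ : Fin c) : ℕ) : ℤ) = q - d := by simp only; omega
    rw [entry_ofInt ⟨hr1, hr2⟩ ⟨hc1, hc2⟩ hi hj, toInt_ofInt_of_fits (hT.fits _ _)]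
    constructor
    · intro h
      refine ⟨by omega, Or.inr ⟨_, _, hi, hj, ?_⟩⟩
      by_contra hcon
      exact h (Or.inl ⟨not_le.1 hcon, by omega⟩)
    · rintro ⟨h1, h2 | ⟨i', j', hi', hj', h2⟩⟩ (⟨h3, -⟩ | h3 | h3)
      · omega
      · omega
      · exact hB h3
      · have e1 : i' = ⟨(p - d).toNat, by omega⟩ := by ext; simp only at hi ⊢; omega
        have e2 : j' = ⟨(q - d).toNat, by omega⟩ := by ext; simp only at hj ⊢; omega
        rw [e1, e2] at h2
        omega
      · omega
      · exact hB h3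

/-- Binary search with steps `2 ^ (t - 1), …, 2, 1, 1`, from the position in registers
`o + 10 * (t + 1)` and `o + 10 * (t + 1) + 1`, to the position in registers `o` and `o + 1`. -/
def stepsCode (c β o : ℕ) : ℕ → List Instr
  | 0 => stepCode c β o 1
  | t + 1 => stepCode c β (o + 10 * (t + 1)) (2 ^ t) ++ stepsCode c β o t

theorem stepsCode_d {c β o t : ℕ} {I : Instr} (hI : I ∈ stepsCode c β o t) :
    o ≤ I.d ∧ I.d < o + 10 * (t + 1) := by
  induction t with
  | zero => exact stepCode_d hI
  | succ t ih =>
    rcases List.mem_append.1 hI with h | h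
    · have := stepCode_d h; omega
    · have := ih h; omega

theorem stepsCode_wf {c β o t k : ℕ} (ho : 20 ≤ o) (hβ : o + 10 * (t + 1) ≤ β)
    (hk : o + 10 * (t + 1) ≤ k) {I : Instr} (hI : I ∈ stepsCode c β o t) : I.WF k := by
  induction t with
  | zero => exact stepCode_wf ho hβ hk hI
  | succ t ih =>
    rcases List.mem_append.1 hI with h | h
    · exact stepCode_wf (by omega) (by omega) (by omega) h
    · exact ih (by omega) (by omega) h

/-- The registers that the binary search needs are as expected. -/
structure StepsReady (g : ℕ → BitVec w) (β o t : ℕ) : Prop where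
  le : 20 ≤ o
  control : o + 10 * (t + 1) ≤ β
  zero : g 4 = 0
  fresh : ∀ x, o ≤ x → x < o + 10 * (t + 1) → g x = 0

theorem StepsReady.next {g : ℕ → BitVec w} {β o t d : ℕ} (h : StepsReady g β o (t + 1)) :
    StepsReady (execs T g (stepCode c β (o + 10 * (t + 1)) d)) β o t := by
  have hx : ∀ x, x < o + 10 * (t + 1) →
      execs T g (stepCode c β (o + 10 * (t + 1)) d) x = g x := fun x hx =>
    execs_of_forall_ne T g fun I hI => by have := stepCode_d hI; omega
  have := h.le
  have := h.control
  refine ⟨h.le, by omega, ?_, fun x h1 h2 => ?_⟩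
  · rw [hx _ (by omega)]; exact h.zero
  · rw [hx _ (by omega)]; exact h.fresh x h1 (by omega)

/-- This serves two cases that must pass through the search unchanged: a coin showing zero, and a
dead position. -/
theorem execs_stepsCode_of_rejects (hw : 2 ≤ w) {g : ℕ → BitVec w} {β o t : ℕ}
    (h : StepsReady g β o t) (hrej : ∀ d, 1 ≤ d → d ≤ 2 ^ t →
      Rejects T (g 0) (g β) (g (o + 10 * (t + 1))) (g (o + 10 * (t + 1) + 1)) d) :
    execs T g (stepsCode c β o t) o = g (o + 10 * (t + 1)) ∧
      execs T g (stepsCode c β o t) (o + 1) = g (o + 10 * (t + 1) + 1) := by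
  induction t generalizing g with
  | zero =>
    have := execs_stepCode T hw (β := β) (d := 1) h.le h.control h.zero
      (fun i hi => h.fresh (o + i) (by omega) (by omega))
    rw [if_pos (hrej 1 le_rfl le_rfl), if_pos (hrej 1 le_rfl le_rfl)] at this
    exact this
  | succ t ih =>
    have hle := h.le
    have hβ := h.control
    have h1 := execs_stepCode T hw (β := β) (d := 2 ^ t) (n := o + 10 * (t + 1)) (by omega)
      (by omega) h.zero (fun i hi => h.fresh _ (by omega) (by omega))
    have h2 := hrej (2 ^ t) Nat.one_le_two_pow (Nat.pow_le_pow_right (by norm_num) (by omega))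
    have e10 : o + 10 * (t + 1) + 10 = o + 10 * (t + 1 + 1) := by ring
    have e11 : o + 10 * (t + 1) + 11 = o + 10 * (t + 1 + 1) + 1 := by ring
    rw [e10, e11, if_pos h2, if_pos h2] at h1
    have h3 : ∀ x, (x < o + 10 * (t + 1) ∨ o + 10 * (t + 2) ≤ x) →
        execs T g (stepCode c β (o + 10 * (t + 1)) (2 ^ t)) x = g x := fun x hx =>
      execs_of_forall_ne T g fun I hI => by have := stepCode_d hI; omega
    rw [stepsCode, execs_append]
    obtain ⟨h4, h5⟩ := ih (h.next (d := 2 ^ t)) (fun d hd hdt => by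
      rw [h1.1, h1.2, h3 0 (by omega), h3 β (by omega)]
      exact hrej d hd (hdt.trans (Nat.pow_le_pow_right (by norm_num) (by omega))))
    rw [h4, h5, h1.1, h1.2]
    exact ⟨rfl, rfl⟩

/-- Whether or not a step of length `2 ^ t` is taken, a bracket of length `2 ^ (t + 1)` shrinks to
one of length `2 ^ t`. The extra step of length 1 closes the last bracket, whose length is 1. Steps
follow the diagonal, so `q - p` is kept. -/
theorem execs_stepsCode_of_bracket (hw : 2 ≤ w) (hT : IsSortedArray w T) (ha : Fits w a)
    (hr : Fits w r) (hc : Fits w c) {g : ℕ → BitVec w} {β o t D : ℕ} (h : StepsReady g β o t)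
    (h0 : g 0 = BitVec.ofInt w a) (hβ0 : g β ≠ 0) {p q : ℤ}
    (hp : g (o + 10 * (t + 1)) = BitVec.ofInt w p)
    (hq : g (o + 10 * (t + 1) + 1) = BitVec.ofInt w (q - c)) (hb : Bracket T a (2 ^ t) p q)
    (hqD : q ≤ c + D) (htD : 2 ^ t ≤ D) (hD : Fits w D) :
    ∃ p' q' : ℤ, execs T g (stepsCode c β o t) o = BitVec.ofInt w p' ∧
      execs T g (stepsCode c β o t) (o + 1) = BitVec.ofInt w (q' - c) ∧
      q' - p' = q - p ∧ Bracket T a 0 p' q' := by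
  have sub1 : ∀ (x : ℤ) (d : ℕ), BitVec.ofInt w x - BitVec.ofNat w d = BitVec.ofInt w (x - d) :=
    fun x d => by rw [ofNat_eq_ofInt, ofInt_sub]
  induction t generalizing g p q with
  | zero =>
    have h1 := execs_stepCode T hw (β := β) (d := 1) h.le h.control h.zero
      (fun i hi => h.fresh (o + i) (by omega) (by omega))
    simp only [zero_add, mul_one, add_assoc, Nat.reduceAdd] at hp hq
    rw [h0, hp, hq] at h1
    have hcol := hb.le_col
    have key := not_rejects_iff hT ha hr hc hβ0 (d := 1) le_rfl hb.nonneg hb.le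
      (by simpa using hcol) hqD (by simpa using htD) hD
    have hb' : Bracket T a (0 + ((1 : ℕ) : ℤ)) p q := by simpa using hb
    by_cases hrej : Rejects T (BitVec.ofInt w a) (g β) (BitVec.ofInt w p)
      (BitVec.ofInt w (q - c)) 1
    · rw [if_pos hrej, if_pos hrej] at h1
      exact ⟨p, q, h1.1, h1.2, rfl, hb'.reject hT (by norm_num) le_rfl (by norm_num)
        (fun hacc => key.2 hacc hrej)⟩
    · rw [if_neg hrej, if_neg hrej, sub1, sub1] at h1
      refine ⟨_, q - (1 : ℕ), h1.1, ?_, by ring, hb'.accept (by norm_num) le_rfl (key.1 hrej)⟩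
      refine h1.2.trans ?_
      congr 1
      ring
  | succ t ih =>
    have hle := h.le
    have hβ := h.control
    have h1 := execs_stepCode T hw (β := β) (d := 2 ^ t) (n := o + 10 * (t + 1)) (by omega)
      (by omega) h.zero (fun i hi => h.fresh _ (by omega) (by omega))
    have h3 : ∀ x, (x < o + 10 * (t + 1) ∨ o + 10 * (t + 2) ≤ x) →
        execs T g (stepCode c β (o + 10 * (t + 1)) (2 ^ t)) x = g x := fun x hx =>
      execs_of_forall_ne T g fun I hI => by have := stepCode_d hI; omega
    have e10 : o + 10 * (t + 1) + 10 = o + 10 * (t + 1 + 1) := by ring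
    have e11 : o + 10 * (t + 1) + 11 = o + 10 * (t + 1 + 1) + 1 := by ring
    rw [h0, e10, e11, hp, hq] at h1
    have hcol := hb.le_col
    have h2t : (1 : ℤ) ≤ 2 ^ t := one_le_pow₀ (by norm_num)
    have h2t' : 2 ^ t ≤ D := (Nat.pow_le_pow_right (by norm_num) (by omega)).trans htD
    have hb' : Bracket T a (2 ^ t + ((2 ^ t : ℕ) : ℤ)) p q := by
      have : (2 : ℤ) ^ t + ((2 ^ t : ℕ) : ℤ) = 2 ^ (t + 1) := by push_cast; ring
      rwa [this]
    have hcast : ((2 ^ t : ℕ) : ℤ) = 2 ^ t := by push_cast; rfl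
    have key := not_rejects_iff hT ha hr hc hβ0 (d := 2 ^ t) Nat.one_le_two_pow hb.nonneg hb.le
      (by rw [pow_succ] at hcol; omega) hqD h2t' hD
    rw [stepsCode, execs_append]
    have hnext := h.next (T := T) (d := 2 ^ t)
    have h0' := (h3 0 (by omega)).trans h0
    have hβ' : execs T g (stepCode c β (o + 10 * (t + 1)) (2 ^ t)) β ≠ 0 := by
      rwa [h3 β (by omega)]
    by_cases hrej : Rejects T (BitVec.ofInt w a) (g β) (BitVec.ofInt w p)
      (BitVec.ofInt w (q - c)) (2 ^ t)
    · rw [if_pos hrej, if_pos hrej] at h1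
      exact ih hnext h0' hβ' h1.1 h1.2 (hb'.reject hT (by omega) (by omega) (by omega)
        (fun hacc => key.2 hacc hrej)) hqD h2t'
    · rw [if_neg hrej, if_neg hrej, sub1, sub1] at h1
      obtain ⟨p', q', e1, e2, e3, e4⟩ := ih (q := q - (2 ^ t : ℕ)) hnext h0' hβ' h1.1
        (h1.2.trans (by congr 1; ring)) (hb'.accept (by omega) (by omega) (key.1 hrej))
        (by omega) h2t'
      exact ⟨p', q', e1, e2, by rw [e3]; ring, e4⟩

/-! ### A conditional jump along the boundary -/

/-- The first of the registers for the part of the program that has `e` bits still to choose. -/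
def off (e : ℕ) : ℕ := 10 * (e + 1) ^ 2 + 10

theorem off_succ (e : ℕ) : off (e + 1) = off e + 10 * (e + 2) + 10 * (e + 1) := by
  unfold off; ring

theorem le_off (e : ℕ) : 20 ≤ off e := by
  have : 1 ≤ (e + 1) ^ 2 := Nat.one_le_pow _ _ (by omega)
  unfold off
  omega

/-- If register `off e + 10 * (e + 1) + 2` is not zero, move `2 ^ e` steps along the boundary. -/
def moveCode (r c e : ℕ) : List Instr :=
  if 2 ^ e + 2 ≤ r + c then
    [⟨.imm, off e + 10 * (e + 1) + 3, 2 ^ e, 0⟩,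
     ⟨.copy, off e + 10 * (e + 1), off (e + 1), 0⟩,
     ⟨.copy, off e + 10 * (e + 1) + 1, off (e + 1) + 1, 0⟩,
     ⟨.sel, off e + 10 * (e + 1) + 1, off e + 10 * (e + 1) + 2, off e + 10 * (e + 1) + 3⟩] ++
      stepsCode c (off e + 10 * (e + 1) + 2) (off e) e
  else
    [⟨.eq, off e + 10 * (e + 1) + 3, off e + 10 * (e + 1) + 2, 4⟩,
     ⟨.sel, off e, off e + 10 * (e + 1) + 3, off (e + 1)⟩,
     ⟨.copy, off e + 1, off (e + 1) + 1, 0⟩]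

theorem moveCode_d {r c e : ℕ} {I : Instr} (hI : I ∈ moveCode r c e) :
    off e ≤ I.d ∧ I.d < off (e + 1) ∧ I.d ≠ off e + 10 * (e + 1) + 2 := by
  rw [off_succ]
  unfold moveCode at hI
  split_ifs at hI
  · rcases List.mem_append.1 hI with h | h
    · simp only [List.mem_cons, List.not_mem_nil, or_false] at h
      rcases h with h | h | h | h <;> subst h <;> refine ⟨?_, ?_, ?_⟩ <;> simp only <;> omega
    · have := stepsCode_d h
      omega
  · simp only [List.mem_cons, List.not_mem_nil, or_false] at hI
    rcases hI with h | h | h <;> subst h <;> refine ⟨?_, ?_, ?_⟩ <;> simp only <;> omega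

theorem moveCode_wf {r c e k : ℕ} (hk : off (e + 1) ≤ k) {I : Instr} (hI : I ∈ moveCode r c e) :
    I.WF k := by
  have hoff := le_off e
  unfold moveCode at hI
  rw [off_succ] at hI hk
  split_ifs at hI
  · rcases List.mem_append.1 hI with h | h
    · simp only [List.mem_cons, List.not_mem_nil, or_false] at h
      rcases h with h | h | h | h <;> subst h <;> simp [Instr.WF, Instr.IsClassical] <;> omega
    · exact stepsCode_wf hoff (by omega) (by omega) h
  · simp only [List.mem_cons, List.not_mem_nil, or_false] at hI
    rcases hI with h | h | h <;> subst h <;> simp [Instr.WF, Instr.IsClassical] <;> omega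

/-- The registers below `off (e + 1)` are as expected before `moveCode r c e`. -/
structure MoveReady (a : ℤ) (g : ℕ → BitVec w) (e : ℕ) : Prop where
  input : g 0 = BitVec.ofInt w a
  zero : g 4 = 0
  fresh : ∀ x, off e ≤ x → x < off (e + 1) → x ≠ off e + 10 * (e + 1) + 2 → g x = 0

/-- The position `(P, Q)` on the boundary is reached after `τ` steps. -/
def Alive (T : Fin r → Fin c → ℤ) (a τ : ℤ) (P Q : BitVec w) : Prop :=
  ∃ p q : ℤ, P = BitVec.ofInt w p ∧ Q = BitVec.ofInt w (q - c) ∧ 1 ≤ p ∧ Bracket T a 0 p q ∧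
    q - p + r = τ

theorem execs_moveCode_of_zero (hw : 2 ≤ w) {g : ℕ → BitVec w} {e : ℕ} (h : MoveReady a g e)
    (hβ : g (off e + 10 * (e + 1) + 2) = 0) :
    execs T g (moveCode r c e) (off e) = g (off (e + 1)) ∧
      execs T g (moveCode r c e) (off e + 1) = g (off (e + 1) + 1) := by
  have hoff := le_off e
  have hfresh : ∀ x, off e ≤ x → x < off e + 10 * (e + 2) → x ≠ off e + 10 * (e + 1) + 2 →
      g x = 0 := fun x h1 h2 h3 => h.fresh x h1 (by rw [off_succ]; omega) h3
  unfold moveCode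
  rw [off_succ]
  generalize off e = o at *
  split_ifs
  · rw [execs_append]
    set n := o + 10 * (e + 1) with hn
    set g' := execs T g _ with hg'
    have n0 : g n = 0 := hfresh _ (by omega) (by omega) (by omega)
    have n1 : g (n + 1) = 0 := hfresh _ (by omega) (by omega) (by omega)
    have n3 : g (n + 3) = 0 := hfresh _ (by omega) (by omega) (by omega)
    have a1 : o + 10 * (e + 2) + 10 * (e + 1) ≠ n := by omega
    have a2 : o + 10 * (e + 2) + 10 * (e + 1) ≠ n + 1 := by omega
    have a3 : o + 10 * (e + 2) + 10 * (e + 1) ≠ n + 3 := by omega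
    have b1 : o + 10 * (e + 2) + 10 * (e + 1) + 1 ≠ n := by omega
    have b3 : o + 10 * (e + 2) + 10 * (e + 1) + 1 ≠ n + 3 := by omega
    have c1 : g' n = g (o + 10 * (e + 2) + 10 * (e + 1)) := by
      simp only [hg', execs, List.foldl_cons, List.foldl_nil, Instr.exec, Instr.val,
        Function.update_apply, reduceCtorEq, if_false, if_true, n0, a3]
      simp
    have c2 : g' (n + 1) = g (o + 10 * (e + 2) + 10 * (e + 1) + 1) := by
      simp only [hg', execs, List.foldl_cons, List.foldl_nil, Instr.exec, Instr.val,
        Function.update_apply, reduceCtorEq, if_false, if_true, n0, n1, n3, zero_add, a3, b3, b1,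
        hβ]
      simp
    have c3 : ∀ x, x ≠ n → x ≠ n + 1 → x ≠ n + 3 → g' x = g x := by
      intro x h1 h2 h3
      refine execs_of_forall_ne T g fun I hI => ?_
      simp only [List.mem_cons, List.not_mem_nil, or_false] at hI
      rcases hI with h | h | h | h <;> subst h <;> simpa
    have hready : StepsReady g' (n + 2) o e := by
      refine ⟨hoff, by omega, ?_, fun x h1 h2 => ?_⟩
      · rw [c3 _ (by omega) (by omega) (by omega)]; exact h.zero
      · rw [c3 _ (by omega) (by omega) (by omega)]
        exact hfresh x h1 (by omega) (by omega)
    have := execs_stepsCode_of_rejects hw (T := T) hready fun d _ _ =>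
      Or.inr (Or.inr (by rw [c3 _ (by omega) (by omega) (by omega)]; exact hβ))
    rw [c1, c2] at this
    exact this
  · set n := o + 10 * (e + 1) with hn
    have n0 : g o = 0 := hfresh _ (by omega) (by omega) (by omega)
    have n1 : g (o + 1) = 0 := hfresh _ (by omega) (by omega) (by omega)
    have n3 : g (n + 3) = 0 := hfresh _ (by omega) (by omega) (by omega)
    have a1 : o + 10 * (e + 2) + 10 * (e + 1) ≠ n + 3 := by omega
    have a2 : o + 10 * (e + 2) + 10 * (e + 1) + 1 ≠ n + 3 := by omega
    have a3 : o + 10 * (e + 2) + 10 * (e + 1) + 1 ≠ o := by omega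
    have a4 : o ≠ n + 3 := by omega
    have a5 : o + 1 ≠ n + 3 := by omega
    have a6 : n + 3 ≠ o := by omega
    have hw1 : (1 : BitVec w) ≠ 0 := by
      have : 2 ^ 1 ≤ 2 ^ w := Nat.pow_le_pow_right (by norm_num) (by omega)
      exact BitVec_natCast_ne_zero (n := 1) (by norm_num) (by omega)
    have z4 := h.zero
    constructor
    · simp only [execs, List.foldl_cons, List.foldl_nil, Instr.exec, Instr.val,
        Function.update_apply, reduceCtorEq, if_false, if_true, n0, n3, zero_add, a1, a4,
        hβ, z4, hw1]
      simp
    · simp only [execs, List.foldl_cons, List.foldl_nil, Instr.exec, Instr.val,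
        Function.update_apply, reduceCtorEq, if_false, if_true, a2, a3, a5]
      simp [n1]

/-- Row coordinate 0 marks a walk that has left the array, and it is absorbing. By
`Bracket.pos_of_eq` a live walk never dies while the diagonal of `a` is still at or ahead of the
target, so no occurrence is lost. -/
theorem execs_moveCode_of_ne_zero (hw : 2 ≤ w) (hT : IsSortedArray w T) (ha : Fits w a)
    (hr : Fits w r) (hc : Fits w c) (hr1 : 1 ≤ r) (hc1 : 1 ≤ c)
    {g : ℕ → BitVec w} {e : ℕ} (h : MoveReady a g e) (hβ : g (off e + 10 * (e + 1) + 2) ≠ 0) :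
    (g (off (e + 1)) = 0 → execs T g (moveCode r c e) (off e) = 0) ∧
    ∀ τ, Alive T a τ (g (off (e + 1))) (g (off (e + 1) + 1)) →
      (execs T g (moveCode r c e) (off e) = 0 ∨
        Alive T a (τ + 2 ^ e) (execs T g (moveCode r c e) (off e))
          (execs T g (moveCode r c e) (off e + 1))) ∧
      ∀ (i : Fin r) (j : Fin c), T i j = a → τ + 2 ^ e ≤ (j : ℤ) - (i + 1) + r →
        Alive T a (τ + 2 ^ e) (execs T g (moveCode r c e) (off e))
          (execs T g (moveCode r c e) (off e + 1)) := by
  have hoff := le_off e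
  have hfresh : ∀ x, off e ≤ x → x < off e + 10 * (e + 2) → x ≠ off e + 10 * (e + 1) + 2 →
      g x = 0 := fun x h1 h2 h3 => h.fresh x h1 (by rw [off_succ]; omega) h3
  unfold moveCode
  rw [off_succ]
  generalize off e = o at *
  have hlt := two_mul_add_lt hT hr hc hr1 hc1
  split_ifs with he
  · rw [execs_append]
    -- The guard in `moveCode` gives `2 * 2 ^ e ≤ 2 * (r + c) - 4`, which is less than `2 ^ w` by
    -- `two_mul_add_lt`.
    have hD : Fits w ((2 ^ e : ℕ) : ℤ) := by
      have h1 : ((2 ^ w : ℕ) : ℤ) = 2 ^ w := by push_cast; rfl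
      have h2 : (0 : ℤ) ≤ ((2 ^ e : ℕ) : ℤ) := by positivity
      have h3 : (0 : ℤ) ≤ 2 ^ w := by positivity
      constructor <;> omega
    set n := o + 10 * (e + 1) with hn
    set g' := execs T g _ with hg'
    have n0 : g n = 0 := hfresh _ (by omega) (by omega) (by omega)
    have n1 : g (n + 1) = 0 := hfresh _ (by omega) (by omega) (by omega)
    have n3 : g (n + 3) = 0 := hfresh _ (by omega) (by omega) (by omega)
    have a1 : o + 10 * (e + 2) + 10 * (e + 1) ≠ n := by omega
    have a2 : o + 10 * (e + 2) + 10 * (e + 1) ≠ n + 1 := by omega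
    have a3 : o + 10 * (e + 2) + 10 * (e + 1) ≠ n + 3 := by omega
    have b1 : o + 10 * (e + 2) + 10 * (e + 1) + 1 ≠ n := by omega
    have b3 : o + 10 * (e + 2) + 10 * (e + 1) + 1 ≠ n + 3 := by omega
    have c1 : g' n = g (o + 10 * (e + 2) + 10 * (e + 1)) := by
      simp only [hg', execs, List.foldl_cons, List.foldl_nil, Instr.exec, Instr.val,
        Function.update_apply, reduceCtorEq, if_false, if_true, n0, a3]
      simp
    have c2 : g' (n + 1) = g (o + 10 * (e + 2) + 10 * (e + 1) + 1) + BitVec.ofNat w (2 ^ e) := by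
      have d1 : n + 1 ≠ n := by omega
      have d2 : n + 1 ≠ n + 3 := by omega
      have d3 : n + 2 ≠ n := by omega
      have d4 : n + 2 ≠ n + 1 := by omega
      have d5 : n + 2 ≠ n + 3 := by omega
      have d6 : n + 3 ≠ n := by omega
      have d7 : n + 3 ≠ n + 1 := by omega
      simp only [hg', execs, List.foldl_cons, List.foldl_nil, Instr.exec, Instr.val,
        Function.update_apply, reduceCtorEq, if_false, if_true, n0, n1, n3, zero_add, a3, b3, b1,
        hβ, d1, d2, d3, d4, d5, d6, d7]
    have c3 : ∀ x, x ≠ n → x ≠ n + 1 → x ≠ n + 3 → g' x = g x := by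
      intro x h1 h2 h3
      refine execs_of_forall_ne T g fun I hI => ?_
      simp only [List.mem_cons, List.not_mem_nil, or_false] at hI
      rcases hI with h | h | h | h <;> subst h <;> simpa
    have hready : StepsReady g' (n + 2) o e := by
      refine ⟨hoff, by omega, ?_, fun x h1 h2 => ?_⟩
      · rw [c3 _ (by omega) (by omega) (by omega)]; exact h.zero
      · rw [c3 _ (by omega) (by omega) (by omega)]
        exact hfresh x h1 (by omega) (by omega)
    have hβ' : g' (n + 2) ≠ 0 := by rwa [c3 _ (by omega) (by omega) (by omega)]
    refine ⟨fun hP => ?_, ?_⟩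
    · have := (execs_stepsCode_of_rejects hw (T := T) hready fun d hd1 hd2 =>
        Or.inr (Or.inl (by
          have hf : Fits w (0 - d : ℤ) := by
            have : ((2 ^ w : ℕ) : ℤ) = 2 ^ w := by push_cast; rfl
            constructor <;> omega
          rw [c1, hP, ofNat_eq_ofInt, show (0 : BitVec w) = BitVec.ofInt w 0 by simp, ← ofInt_sub,
            toInt_ofInt_of_fits hf]
          omega))).1
      rw [this, c1, hP]
    · rintro τ ⟨p, q, hP, hQ, hp1, hb, hτ⟩
      have hq2 : q ≤ c := hb.col_le hp1
      obtain ⟨p', q', e1, e2, e3, e4⟩ := execs_stepsCode_of_bracket hw hT ha hr hc (p := p)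
        (q := q + (2 ^ e : ℕ)) (D := 2 ^ e) hready
        ((c3 0 (by omega) (by omega) (by omega)).trans h.input) hβ' (c1.trans hP)
        (by
          rw [c2, hQ, ofNat_eq_ofInt, ← BitVec.ofInt_add]
          congr 1
          ring)
        (by
          have := hb.jump hT (n := 2 ^ e) (by positivity)
          push_cast
          exact this)
        (by omega) le_rfl hD
      have hτ' : q' - p' + r = τ + 2 ^ e := by push_cast at e3; omega
      have alive : 1 ≤ p' → Alive T a (τ + 2 ^ e) _ _ := fun hp' =>
        ⟨p', q', e1, e2, hp', e4, hτ'⟩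
      constructor
      · by_cases hp' : 1 ≤ p'
        · exact Or.inr (alive hp')
        · left
          have : p' = 0 := by have := e4.nonneg; omega
          rw [e1, this]
          simp
      · intro i j hij hle
        exact alive (e4.pos_of_eq hT hij (by omega))
  · set n := o + 10 * (e + 1) with hn
    have n0 : g o = 0 := hfresh _ (by omega) (by omega) (by omega)
    have n3 : g (n + 3) = 0 := hfresh _ (by omega) (by omega) (by omega)
    have a4 : o ≠ n + 3 := by omega
    have z4 := h.zero
    have hdead : execs T g [⟨.eq, n + 3, n + 2, 4⟩, ⟨.sel, o, n + 3,
        o + 10 * (e + 2) + 10 * (e + 1)⟩,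
        ⟨.copy, o + 1, o + 10 * (e + 2) + 10 * (e + 1) + 1, 0⟩] o = 0 := by
      simp only [execs, List.foldl_cons, List.foldl_nil, Instr.exec, Instr.val,
        Function.update_apply, reduceCtorEq, if_false, if_true, n0, n3, zero_add, a4,
        hβ, z4]
      simp
    refine ⟨fun _ => hdead, ?_⟩
    rintro τ ⟨p, q, hP, hQ, hp1, hb, hτ⟩
    refine ⟨Or.inl hdead, fun i j hij hle => ?_⟩
    -- The guard fails, so the target diagonal is at least `r + c - 1`, as `τ ≥ 0`. Diagonals of
    -- entries end at `r + c - 2`.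
    exfalso
    have h1 := hb.le
    have h2 := hb.le_col
    have : ((2 ^ e : ℕ) : ℤ) = 2 ^ e := by push_cast; rfl
    omega

end

end QSearch

/-! ### Recognising a hit, and reflection about clean work registers -/

namespace QSearch

open Matrix

/-! ### Checking a position -/

/-- Set the flag in register `15` if the position in registers `20` and `21` is one at which `a`
occurs; its row and column are put into registers `8` and `9`. -/
def baseCode (c : ℕ) : List Instr :=
  [⟨.imm, 8, 1, 0⟩, ⟨.neg, 8, 0, 0⟩, ⟨.copy, 8, 20, 0⟩,
   ⟨.imm, 9, c, 0⟩, ⟨.copy, 9, 21, 0⟩,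
   ⟨.query, 10, 8, 9⟩,
   ⟨.eq, 11, 10, 0⟩, ⟨.lt, 12, 4, 20⟩, ⟨.lt, 13, 21, 4⟩,
   ⟨.and, 14, 11, 12⟩, ⟨.and, 15, 13, 14⟩]

theorem baseCode_d {c : ℕ} {I : Instr} (hI : I ∈ baseCode c) : 8 ≤ I.d ∧ I.d < 16 := by
  simp only [baseCode, List.mem_cons, List.not_mem_nil, or_false] at hI
  rcases hI with h | h | h | h | h | h | h | h | h | h | h <;> subst h <;> simp

theorem baseCode_wf {c k : ℕ} (hk : 16 ≤ k) {I : Instr} (hI : I ∈ baseCode c) : I.WF k := by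
  simp only [baseCode, List.mem_cons, List.not_mem_nil, or_false] at hI
  rcases hI with h | h | h | h | h | h | h | h | h | h | h <;> subst h <;>
    simp [Instr.WF, Instr.IsClassical] <;> omega

section
variable {r c w : ℕ} {T : Fin r → Fin c → ℤ} {a : ℤ}

theorem truth_and_getLsbD (hw : 0 < w) (A B C : Prop) [Decidable A] [Decidable B] [Decidable C] :
    (((if A then 1 else 0) &&& ((if B then 1 else 0) &&& (if C then 1 else 0)) : BitVec w).getLsbD
      0 = true) ↔ A ∧ B ∧ C := by
  have h1 : (1 : BitVec w).getLsbD 0 = true := by simp [hw]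
  have h0 : (0 : BitVec w).getLsbD 0 = false := by simp
  simp only [BitVec.getLsbD_and]
  by_cases hA : A <;> by_cases hB : B <;> by_cases hC : C <;>
    simp only [hA, hB, hC, if_true, if_false, h0, h1] <;> simp

/-- The two sign tests are indispensable: a query outside of the array returns zero, which may equal
`a`. -/
theorem execs_baseCode (hw : 0 < w) {g : ℕ → BitVec w} (h4 : g 4 = 0)
    (hfresh : ∀ x, 8 ≤ x → x < 16 → g x = 0) :
    ((execs T g (baseCode c) 15).getLsbD 0 = true ↔ (g 21).toInt < 0 ∧
      entry T (g 20 - BitVec.ofNat w 1) (BitVec.ofNat w c + g 21) = g 0 ∧ 0 < (g 20).toInt) ∧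
    execs T g (baseCode c) 8 = g 20 - BitVec.ofNat w 1 ∧
    execs T g (baseCode c) 9 = BitVec.ofNat w c + g 21 := by
  have e1 : ∀ x y : BitVec w, -x + y = y - x := fun x y => by ring
  have e2 : (0 : BitVec w).toInt = 0 := by simp
  have z8 := hfresh 8 (by norm_num) (by norm_num)
  have z9 := hfresh 9 (by norm_num) (by norm_num)
  have z10 := hfresh 10 (by norm_num) (by norm_num)
  have z11 := hfresh 11 (by norm_num) (by norm_num)
  have z12 := hfresh 12 (by norm_num) (by norm_num)
  have z13 := hfresh 13 (by norm_num) (by norm_num)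
  have z14 := hfresh 14 (by norm_num) (by norm_num)
  have z15 := hfresh 15 (by norm_num) (by norm_num)
  refine ⟨?_, ?_, ?_⟩
  · rw [← truth_and_getLsbD hw]
    simp only [baseCode, execs, List.foldl_cons, List.foldl_nil, Instr.exec, Instr.val,
      Function.update_apply, reduceCtorEq, if_false, if_true, Nat.reduceEqDiff, zero_add,
      z8, z9, z10, z11, z12, z13, z14, z15, h4, e1, e2]
  · simp only [baseCode, execs, List.foldl_cons, List.foldl_nil, Instr.exec, Instr.val,
      Function.update_apply, reduceCtorEq, if_false, if_true, Nat.reduceEqDiff, zero_add,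
      z8, e1]
  · simp only [baseCode, execs, List.foldl_cons, List.foldl_nil, Instr.exec, Instr.val,
      Function.update_apply, reduceCtorEq, if_false, if_true, Nat.reduceEqDiff, zero_add,
      z9]

/-! ### Positions from which the search succeeds -/

theorem Alive.fits {τ : ℤ} {P Q : BitVec w} (hr : Fits w r) (hc : Fits w c)
    (h : Alive T a τ P Q) : 1 ≤ P.toInt ∧ P.toInt ≤ r ∧ 0 ≤ Q.toInt + c ∧ Q.toInt ≤ 0 ∧
      P = BitVec.ofInt w P.toInt ∧ Q = BitVec.ofInt w Q.toInt ∧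
      Bracket T a 0 P.toInt (Q.toInt + c) ∧ Q.toInt + c - P.toInt + r = τ := by
  obtain ⟨p, q, rfl, rfl, hp, hb, hτ⟩ := h
  have h1 := hb.le
  have h2 := hb.le_col
  have h3 := hb.col_le hp
  obtain ⟨hr1, hr2⟩ := hr
  obtain ⟨hc1, hc2⟩ := hc
  have f1 : (BitVec.ofInt w p).toInt = p := toInt_ofInt_of_fits ⟨by omega, by omega⟩
  have f2 : (BitVec.ofInt w (q - c)).toInt = q - c := toInt_ofInt_of_fits ⟨by omega, by omega⟩
  rw [f1, f2]
  refine ⟨hp, h1, by omega, by omega, rfl, rfl, ?_, by omega⟩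
  rwa [sub_add_cancel]

/-- The position `(P, Q)` lies on the boundary, or it is dead. -/
def Valid (T : Fin r → Fin c → ℤ) (a : ℤ) (P Q : BitVec w) : Prop := P = 0 ∨ ∃ τ, Alive T a τ P Q

/-- From the position `(P, Q)`, less than `2 ^ e` steps along the boundary lead to `a`. -/
def Hit (T : Fin r → Fin c → ℤ) (a : ℤ) (e : ℕ) (P Q : BitVec w) : Prop :=
  ∃ τ, Alive T a τ P Q ∧ ∃ (i : Fin r) (j : Fin c), T i j = a ∧ τ ≤ (j : ℤ) - (i + 1) + r ∧
    (j : ℤ) - (i + 1) + r < τ + 2 ^ e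

theorem Alive.ne_zero {τ : ℤ} {P Q : BitVec w} (hr : Fits w r) (hc : Fits w c)
    (h : Alive T a τ P Q) : P ≠ 0 := by
  intro h0
  have := (h.fits hr hc).1
  rw [h0] at this
  simp at this

theorem Alive.unique {τ τ' : ℤ} {P Q : BitVec w} (hr : Fits w r) (hc : Fits w c)
    (h : Alive T a τ P Q) (h' : Alive T a τ' P Q) : τ = τ' := by
  obtain ⟨-, -, -, -, -, -, -, h1⟩ := h.fits hr hc
  obtain ⟨-, -, -, -, -, -, -, h2⟩ := h'.fits hr hc
  omega

theorem IsSortedArray.eq_of_eq (hT : IsSortedArray w T) {i i' : Fin r} {j j' : Fin c}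
    (h : T i j = T i' j') : i = i' ∧ j = j' := by
  have := hT.distinct (a₁ := (i, j)) (a₂ := (i', j')) h
  simpa using this

theorem not_hit_zero (hr : Fits w r) (hc : Fits w c) (e : ℕ) (Q : BitVec w) :
    ¬ Hit T a e 0 Q := fun ⟨_, h, _⟩ => h.ne_zero hr hc rfl

theorem baseCode_flag (hw : 0 < w) (hT : IsSortedArray w T) (ha : Fits w a) (hr : Fits w r)
    (hc : Fits w c) {g : ℕ → BitVec w} (h0 : g 0 = BitVec.ofInt w a) (h4 : g 4 = 0)
    (hfresh : ∀ x, 8 ≤ x → x < 16 → g x = 0) (hv : Valid T a (g 20) (g 21)) :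
    ((execs T g (baseCode c) 15).getLsbD 0 = true ↔ Hit T a 0 (g 20) (g 21)) ∧
    (Hit T a 0 (g 20) (g 21) → ∃ (i : Fin r) (j : Fin c), T i j = a ∧
      execs T g (baseCode c) 8 = BitVec.ofInt w i ∧
      execs T g (baseCode c) 9 = BitVec.ofInt w j) := by
  obtain ⟨h1, h2, h3⟩ := execs_baseCode (T := T) hw h4 hfresh
  rw [h1, h2, h3, h0]
  rcases hv with hv | ⟨τ, hv⟩
  · rw [hv]
    refine ⟨⟨fun h => ?_, fun h => absurd h (not_hit_zero hr hc _ _)⟩,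
      fun h => absurd h (not_hit_zero hr hc _ _)⟩
    simp at h
  · obtain ⟨p1, p2, q1, q2, hP, hQ, hb, hτ⟩ := hv.fits hr hc
    have e1 : g 20 - BitVec.ofNat w 1 = BitVec.ofInt w ((g 20).toInt - 1) := by
      rw [ofInt_sub, ← hP]
      rfl
    have e2 : BitVec.ofNat w c + g 21 = BitVec.ofInt w ((g 21).toInt + c) := by
      rw [BitVec.ofInt_add, ← hQ, ofNat_eq_ofInt, add_comm]
    have back : Hit T a 0 (g 20) (g 21) → ∃ (i : Fin r) (j : Fin c), T i j = a ∧
        (i : ℤ) = (g 20).toInt - 1 ∧ (j : ℤ) = (g 21).toInt + c := by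
      rintro ⟨τ', hτ', i, j, hij, h1, h2⟩
      have := hv.unique hr hc hτ'
      rw [pow_zero] at h2
      have := hb.eq_of_eq hT hij (by omega)
      exact ⟨i, j, hij, by omega, by omega⟩
    refine ⟨⟨?_, ?_⟩, ?_⟩
    · rintro ⟨hq, hent, -⟩
      have hi : (((⟨((g 20).toInt - 1).toNat, by omega⟩ : Fin r) : ℕ) : ℤ) = (g 20).toInt - 1 := by
        simp only; omega
      have hj : (((⟨((g 21).toInt + c).toNat, by omega⟩ : Fin c) : ℕ) : ℤ) = (g 21).toInt + c := by
        simp only; omega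
      rw [e1, e2, entry_ofInt hr hc hi hj] at hent
      have := congrArg BitVec.toInt hent
      rw [toInt_ofInt_of_fits (hT.fits _ _), toInt_ofInt_of_fits ha] at this
      exact ⟨τ, hv, _, _, this, by omega, by omega⟩
    · intro h
      obtain ⟨i, j, hij, hi, hj⟩ := back h
      refine ⟨by omega, ?_, by omega⟩
      rw [e1, e2, entry_ofInt hr hc hi hj, hij]
    · intro h
      obtain ⟨i, j, hij, hi, hj⟩ := back h
      exact ⟨i, j, hij, by rw [e1, hi], by rw [e2, hj]⟩

/-- The next `2 ^ (e + 1)` diagonals split into the `2 ^ e` ahead of the current crossing and the `2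
^ e` ahead of the crossing after the jump. Since `a` occurs at most once, it cannot lie in both
halves; hence the two outcomes of a coin toss never interfere in the marked part. -/
theorem hit_succ (hT : IsSortedArray w T) (hr : Fits w r) (hc : Fits w c) {e : ℕ}
    {P Q P' Q' : BitVec w} (hv : Valid T a P Q) (h0 : P = 0 → P' = 0)
    (h1 : ∀ τ, Alive T a τ P Q → (P' = 0 ∨ Alive T a (τ + 2 ^ e) P' Q') ∧
      ∀ (i : Fin r) (j : Fin c), T i j = a → τ + 2 ^ e ≤ (j : ℤ) - (i + 1) + r →
        Alive T a (τ + 2 ^ e) P' Q') :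
    (Hit T a (e + 1) P Q ↔ Hit T a e P Q ∨ Hit T a e P' Q') ∧
      ¬ (Hit T a e P Q ∧ Hit T a e P' Q') := by
  have h2e : (2 : ℤ) ^ (e + 1) = 2 ^ e + 2 ^ e := by ring
  have hpos : (0 : ℤ) < 2 ^ e := by positivity
  rcases hv with hv | ⟨τ, hv⟩
  · have := h0 hv
    subst hv this
    refine ⟨⟨fun h => absurd h (not_hit_zero hr hc _ _), ?_⟩,
      fun h => absurd h.1 (not_hit_zero hr hc _ _)⟩
    rintro (h | h) <;> exact absurd h (not_hit_zero hr hc _ _)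
  obtain ⟨h2, h3⟩ := h1 τ hv
  have alive' : ∀ τ', Alive T a τ' P' Q' → τ' = τ + 2 ^ e := by
    intro τ' hτ'
    rcases h2 with h2 | h2
    · exact absurd h2 (hτ'.ne_zero hr hc)
    · exact hτ'.unique hr hc h2
  refine ⟨⟨?_, ?_⟩, ?_⟩
  · rintro ⟨τ', hτ', i, j, hij, hle, hlt⟩
    obtain rfl := hv.unique hr hc hτ'
    by_cases hcase : (j : ℤ) - (i + 1) + r < τ + 2 ^ e
    · exact Or.inl ⟨τ, hv, i, j, hij, hle, hcase⟩
    · exact Or.inr ⟨_, h3 i j hij (by omega), i, j, hij, by omega, by omega⟩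
  · rintro (⟨τ', hτ', i, j, hij, hle, hlt⟩ | ⟨τ', hτ', i, j, hij, hle, hlt⟩)
    · exact ⟨τ', hτ', i, j, hij, hle, by omega⟩
    · obtain rfl := alive' τ' hτ'
      exact ⟨τ, hv, i, j, hij, by omega, by omega⟩
  · rintro ⟨⟨τ₁, hτ₁, i, j, hij, hle, hlt⟩, ⟨τ₂, hτ₂, i', j', hij', hle', hlt'⟩⟩
    obtain rfl := alive' τ₂ hτ₂
    obtain rfl := hv.unique hr hc hτ₁
    obtain ⟨rfl, rfl⟩ := hT.eq_of_eq (hij.trans hij'.symm)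
    omega

/-! ### Reflection about the states with vanishing work registers -/

/-- Set register `M + 2 * n` to one if the `n` registers from register `8` on are all zero. -/
def testCode (M : ℕ) : ℕ → List Instr
  | 0 => [⟨.imm, M, 1, 0⟩]
  | n + 1 => testCode M n ++
      [⟨.eq, M + 2 * n + 1, 8 + n, 4⟩, ⟨.sel, M + 2 * n + 2, M + 2 * n + 1, M + 2 * n⟩]

theorem testCode_d {M n : ℕ} {I : Instr} (hI : I ∈ testCode M n) :
    M ≤ I.d ∧ I.d ≤ M + 2 * n := by
  induction n with
  | zero =>
    simp only [testCode, List.mem_singleton] at hI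
    subst hI
    simp
  | succ n ih =>
    rcases List.mem_append.1 hI with h | h
    · have := ih h; omega
    · simp only [List.mem_cons, List.not_mem_nil, or_false] at h
      rcases h with h | h <;> subst h <;> constructor <;> simp only <;> omega

theorem testCode_wf {M n k : ℕ} (hn : 8 + n ≤ M) (hk : M + 2 * n < k) {I : Instr}
    (hI : I ∈ testCode M n) : I.WF k := by
  induction n with
  | zero =>
    simp only [testCode, List.mem_singleton] at hI
    subst hI
    simp [Instr.WF, Instr.IsClassical]
    omega
  | succ n ih =>
    rcases List.mem_append.1 hI with h | h
    · exact ih (by omega) (by omega) h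
    · simp only [List.mem_cons, List.not_mem_nil, or_false] at h
      rcases h with h | h <;> subst h <;> simp [Instr.WF, Instr.IsClassical] <;> omega

open Classical in
theorem execs_testCode (hw : 0 < w) {g : ℕ → BitVec w} {M n : ℕ} (hn : 8 + n ≤ M) (h4 : g 4 = 0)
    (hM : ∀ x, M ≤ x → g x = 0) :
    execs T g (testCode M n) (M + 2 * n) = if ∀ x, 8 ≤ x → x < 8 + n → g x = 0 then 1 else 0 := by
  have hw1 : (1 : BitVec w) ≠ 0 := by
    have : 2 ^ 1 ≤ 2 ^ w := Nat.pow_le_pow_right (by norm_num) (by omega)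
    exact BitVec_natCast_ne_zero (n := 1) (by norm_num) (by omega)
  induction n with
  | zero =>
    rw [if_pos (fun x h1 h2 => by omega)]
    simp only [testCode, execs, List.foldl_cons, List.foldl_nil, Instr.exec, Instr.val,
      Function.update_apply, reduceCtorEq, if_false, if_true, mul_zero, add_zero, hM M le_rfl,
      zero_add]
    rfl
  | succ n ih =>
    have h1 := ih (by omega)
    rw [testCode, execs_append]
    have h2 : ∀ x, (x < M ∨ M + 2 * n < x) → execs T g (testCode M n) x = g x := fun x hx =>
      execs_of_forall_ne T g fun I hI => by have := testCode_d hI; omega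
    set g' := execs T g (testCode M n)
    have a1 : M + 2 * n + 2 ≠ M + 2 * n + 1 := by omega
    have a2 : M + 2 * n ≠ M + 2 * n + 1 := by omega
    have b1 : g' (M + 2 * n + 1) = 0 := by rw [h2 _ (by omega), hM _ (by omega)]
    have b2 : g' (M + 2 * n + 2) = 0 := by rw [h2 _ (by omega), hM _ (by omega)]
    have b3 : g' (8 + n) = g (8 + n) := h2 _ (by omega)
    have b4 : g' 4 = 0 := by rw [h2 _ (by omega), h4]
    have hiff : (∀ x, 8 ≤ x → x < 8 + n + 1 → g x = 0) ↔
        (∀ x, 8 ≤ x → x < 8 + n → g x = 0) ∧ g (8 + n) = 0 := by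
      constructor
      · intro h
        exact ⟨fun x hx hx' => h x hx (by omega), h _ (by omega) (by omega)⟩
      · rintro ⟨h, h'⟩ x hx hx'
        rcases Nat.lt_or_ge x (8 + n) with hlt | hge
        · exact h x hx hlt
        · rwa [show x = 8 + n by omega]
    simp only [execs, List.foldl_cons, List.foldl_nil, Instr.exec, Instr.val,
      Function.update_apply, reduceCtorEq, if_false, if_true, mul_add, mul_one, ← add_assoc, a1,
      b1, b2, b3, b4, zero_add, a2]
    rw [if_congr hiff rfl rfl, h1]
    by_cases hc1 : g (8 + n) = 0
    · simp only [hc1, if_true, if_false, hw1, and_true]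
      congr
    · simp only [hc1, if_true, if_false, and_false]

end

/-- Reflection about the states in which registers `8, …, off e - 1` vanish. -/
def reflectCode (M e : ℕ) : List Instr :=
  testCode M (off e - 8) ++ List.replicate 4 ⟨.phase, M + 2 * (off e - 8), 0, 0⟩ ++
    undo (testCode M (off e - 8))

theorem star_permMat_mul_signMat_mul {ι : Type} [Fintype ι] [DecidableEq ι] (χ : ι → Bool)
    (σ : Equiv.Perm ι) :
    star (permMat σ) * signMat χ * permMat σ = signMat fun s => χ (σ s) := by
  have h : signMat χ * permMat σ = permMat σ * signMat fun s => χ (σ s) := by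
    ext t s
    rw [signMat, signMat, Matrix.diagonal_mul, Matrix.mul_diagonal]
    by_cases hts : t = σ s
    · rw [hts, mul_comm]
    · simp [permMat, hts]
  rw [Matrix.mul_assoc, h, ← Matrix.mul_assoc, (Matrix.mem_unitaryGroup_iff').1 (permMat_mem σ),
    Matrix.one_mul]

section
variable {r c w k : ℕ} (T : Fin r → Fin c → ℤ)

/-- The test that is evaluated by `reflectCode`. -/
def reflectTest (M e : ℕ) (s : Mem k w) : Bool :=
  ((progPerm T k w (testCode M (off e - 8)) s).read (M + 2 * (off e - 8))).getLsbD 0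

theorem progMat_reflectCode {M e : ℕ} (hM : off e ≤ M) (hk : M + 2 * off e ≤ k) :
    progMat T k w (reflectCode M e) = signMat (reflectTest T M e) := by
  have hoff := le_off e
  have hwf : ∀ I ∈ testCode M (off e - 8), I.WF k := fun I hI =>
    testCode_wf (by omega) (by omega) hI
  rw [reflectCode, progMat_append, progMat_append, progMat_undo T fun I hI => (hwf I hI).1.2,
    progMat_phase_four T (by omega), progMat_eq_permMat T fun I hI => (hwf I hI).1,
    ← Matrix.mul_assoc, star_permMat_mul_signMat_mul]
  rfl

/-- Only states with clean test registers matter for amplification. Elsewhere the reflection is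
merely some diagonal matrix of signs. -/
theorem reflectTest_iff (hw : 0 < w) {M e : ℕ} (hM : off e ≤ M) (hk : M + 2 * off e ≤ k)
    {s : Mem k w} (h4 : s.read 4 = 0) (hs : ∀ x, M ≤ x → s.read x = 0) :
    reflectTest T M e s = true ↔ ∀ x, 8 ≤ x → x < off e → s.read x = 0 := by
  have hoff := le_off e
  have hwf : ∀ I ∈ testCode M (off e - 8), I.WF k := fun I hI =>
    testCode_wf (by omega) (by omega) hI
  have h1 : (1 : BitVec w).getLsbD 0 = true := by simp [hw]
  rw [reflectTest, read_progPerm T hwf, execs_testCode hw (by omega) h4 hs,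
    show 8 + (off e - 8) = off e by omega]
  split_ifs with h
  · simp only [h1, true_iff]; exact h
  · constructor
    · intro h'; simp at h'
    · intro h'; exact absurd h' h

end

end QSearch

/-! ### The nested search and its amplitude -/

namespace QSearch

open Matrix

/-! ### The search -/

/-- A coin toss followed by a conditional jump along the boundary. -/
def bitCode (r c e : ℕ) : List Instr :=
  ⟨.had, off e + 10 * (e + 1) + 2, 0, 0⟩ :: moveCode r c e

/-- Flip the sign of the states with a flag. -/
def flagCode : List Instr := List.replicate 4 ⟨.phase, 15, 0, 0⟩

/-- The search algorithm for a list that consists of coin tosses (`true`) and rounds of amplitude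
amplification (`false`), together with the inverse algorithm. -/
def searchCode (r c M : ℕ) : List Bool → List Instr × List Instr
  | [] => (baseCode c, undo (baseCode c))
  | true :: l =>
    (bitCode r c (l.count true) ++ (searchCode r c M l).1,
      (searchCode r c M l).2 ++ undo (bitCode r c (l.count true)))
  | false :: l =>
    ((searchCode r c M l).1 ++ flagCode ++ (searchCode r c M l).2 ++
        reflectCode M (l.count true) ++ (searchCode r c M l).1,
      (searchCode r c M l).2 ++ reflectCode M (l.count true) ++ (searchCode r c M l).1 ++
        flagCode ++ (searchCode r c M l).2)

/-- The amplitude with which `searchCode` finds what it searches for. -/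
noncomputable def amplitude : List Bool → ℝ
  | [] => 1
  | true :: l => (Real.sqrt 2)⁻¹ * amplitude l
  | false :: l => 4 * amplitude l ^ 3 - 3 * amplitude l

theorem off_mono : Monotone off := by
  refine monotone_nat_of_le_succ fun e => ?_
  rw [off_succ]
  omega

section
variable {r c w k : ℕ} (T : Fin r → Fin c → ℤ) {a : ℤ}

/-- The states with a flag. -/
def flagged (s : Mem k w) : Bool := (s.read 15).getLsbD 0

theorem bitCode_not_phase {e : ℕ} {I : Instr} (hI : I ∈ bitCode r c e) : I.op ≠ .phase := by
  rcases List.mem_cons.1 hI with h | h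
  · subst h; simp
  · exact (moveCode_wf le_rfl h).1.2

/-- The inverse is built along with the search. Applying `undo` to a whole level is not possible
because of the phase gates, and would lengthen the code by up to a factor 3 at every level. The
reflections are their own inverses, so reversing the order of the blocks is enough. -/
theorem progMat_searchCode_snd {M : ℕ} (l : List Bool) (hM : off (l.count true) ≤ M)
    (hk : M + 2 * off (l.count true) ≤ k) :
    progMat T k w (searchCode r c M l).2 = star (progMat T k w (searchCode r c M l).1) := by
  have hoff := le_off (l.count true)
  induction l with
  | nil => exact progMat_undo T fun I hI => (baseCode_wf le_rfl hI).1.2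
  | cons b l ih =>
    cases b
    · rw [List.count_cons_of_ne (by simp)] at hM hk hoff
      have h15 : 15 < k := by omega
      simp only [searchCode, flagCode, progMat_append, ih hM hk hoff, progMat_phase_four T h15,
        progMat_reflectCode T hM hk, star_mul, star_signMat, star_star, Matrix.mul_assoc]
    · have hle := off_mono (List.count_le_count_cons (a := true) (b := true) (l := l))
      have h1 := le_off (l.count true)
      simp only [searchCode, progMat_append, ih (by omega) (by omega) h1,
        progMat_undo T fun I hI => bitCode_not_phase hI, star_mul]

/-- The start position, in registers from `off (l.count true)` on, is never changed. Searches from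
different positions therefore do not mix, and the reflection, which tests only work registers,
isolates the start state. -/
theorem actsOn_searchCode {M : ℕ} (l : List Bool) (hM : off (l.count true) ≤ M)
    (hk : M + 2 * off (l.count true) ≤ k) :
    ActsOn {x | 8 ≤ x ∧ x < off (l.count true)} (progMat T k w (searchCode r c M l).1) := by
  have hoff := le_off (l.count true)
  induction l with
  | nil =>
    refine actsOn_progMat T fun I hI => ?_
    have := baseCode_d hI
    rw [Set.mem_ofPred_eq]
    omega
  | cons b l ih =>
    cases b
    · rw [List.count_cons_of_ne (by simp)] at hM hk hoff ⊢
      have h15 : 15 < k := by omega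
      have h1 := progMat_searchCode_snd (w := w) T l hM hk
      simp only [searchCode, flagCode, progMat_append, h1, progMat_phase_four T h15,
        progMat_reflectCode T hM hk]
      have ih := ih hM hk hoff
      exact ih.mul ((ActsOn.diagonal _).mul (ih.star.mul ((ActsOn.diagonal _).mul ih)))
    · have h1 := le_off (l.count true)
      rw [List.count_cons_self] at hM hk ⊢
      have h2 := off_succ (l.count true)
      simp only [searchCode, progMat_append]
      have hsub : {x | 8 ≤ x ∧ x < off (l.count true)} ⊆
          {x | 8 ≤ x ∧ x < off (l.count true + 1)} := fun x hx =>
        ⟨hx.1, by have := hx.2; omega⟩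
      refine ((ih (by omega) (by omega) h1).mono hsub).mul
        (actsOn_progMat T fun I hI => ?_)
      rw [Set.mem_ofPred_eq]
      rcases List.mem_cons.1 hI with h | h
      · subst h; simp only; omega
      · have := moveCode_d h; omega

/-- The state is as expected before a search with `e` coin tosses. -/
structure Config (T : Fin r → Fin c → ℤ) (a : ℤ) (M e : ℕ) (s : Mem k w) : Prop where
  input : s.read 0 = BitVec.ofInt w a
  zero : s.read 4 = 0
  fresh : ∀ x, 8 ≤ x → x < off e → s.read x = 0
  temp : ∀ x, M ≤ x → s.read x = 0
  valid : Valid T a (s.read (off e)) (s.read (off e + 1))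

/-- The effect of `moveCode` on a state. -/
theorem config_move (hw : 2 ≤ w) (hT : IsSortedArray w T) (ha : Fits w a) (hr : Fits w r)
    (hc : Fits w c) (hr1 : 1 ≤ r) (hc1 : 1 ≤ c) {M e : ℕ} (hM : off (e + 1) + 2 ≤ M) (hk : M ≤ k)
    {s : Mem k w} (hs : Config T a M (e + 1) s) {d : ℕ} (hd : d = off e + 10 * (e + 1) + 2)
    (hdk : d < k) {v : BitVec w} {t : Mem k w}
    (ht : t = progPerm T k w (moveCode r c e) (Function.update s ⟨d, hdk⟩ v)) :
    Config T a M e t ∧ AgreeOff {x | 8 ≤ x ∧ x < off (e + 1)} t s ∧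
      (v = 0 → t.read (off e) = s.read (off (e + 1)) ∧
        t.read (off e + 1) = s.read (off (e + 1) + 1)) ∧
      (v ≠ 0 → (s.read (off (e + 1)) = 0 → t.read (off e) = 0) ∧
        ∀ τ, Alive T a τ (s.read (off (e + 1))) (s.read (off (e + 1) + 1)) →
          (t.read (off e) = 0 ∨ Alive T a (τ + 2 ^ e) (t.read (off e)) (t.read (off e + 1))) ∧
          ∀ (i : Fin r) (j : Fin c), T i j = a → τ + 2 ^ e ≤ (j : ℤ) - (i + 1) + r →
            Alive T a (τ + 2 ^ e) (t.read (off e)) (t.read (off e + 1))) := by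
  have hoff := le_off e
  have hsucc := off_succ e
  set u : Mem k w := Function.update s ⟨d, hdk⟩ v with hu
  have hur : ∀ x, u.read x = if x = d then v else s.read x := fun x => Mem.read_update _ _ _ _
  have hut : ∀ x, x ≠ d → u.read x = s.read x := fun x hx => by rw [hur, if_neg hx]
  have hud : u.read d = v := by rw [hur, if_pos rfl]
  have htr : t.read = execs T u.read (moveCode r c e) := by
    rw [ht]
    exact read_progPerm T (fun I hI => moveCode_wf (by omega) hI) u
  have htx : ∀ x, (x < off e ∨ off (e + 1) ≤ x) → t.read x = s.read x := by
    intro x hx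
    rw [htr, execs_of_forall_ne T _ fun I hI => by have := moveCode_d hI; omega]
    exact hut x (by omega)
  have hready : MoveReady a u.read e := by
    refine ⟨?_, ?_, fun x h1 h2 h3 => ?_⟩
    · rw [hut _ (by omega), hs.input]
    · rw [hut _ (by omega), hs.zero]
    · rw [hut _ (by omega), hs.fresh x (by omega) h2]
  have hP : u.read (off (e + 1)) = s.read (off (e + 1)) := hut _ (by omega)
  have hQ : u.read (off (e + 1) + 1) = s.read (off (e + 1) + 1) := hut _ (by omega)
  have hzero : v = 0 → t.read (off e) = s.read (off (e + 1)) ∧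
      t.read (off e + 1) = s.read (off (e + 1) + 1) := by
    intro hv
    have := execs_moveCode_of_zero (T := T) hw hready (by rw [← hd, hud, hv])
    rwa [← htr, hP, hQ] at this
  have hne := fun hv : v ≠ 0 => execs_moveCode_of_ne_zero hw hT ha hr hc hr1 hc1 hready
    (by rwa [← hd, hud])
  rw [← htr, hP, hQ] at hne
  refine ⟨⟨?_, ?_, fun x h1 h2 => ?_, fun x hx => ?_, ?_⟩, ?_, hzero, hne⟩
  · rw [htx _ (by omega), hs.input]
  · rw [htx _ (by omega), hs.zero]
  · rw [htx _ (by omega), hs.fresh x h1 (by omega)]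
  · rw [htx _ (by omega), hs.temp x hx]
  · by_cases hv : v = 0
    · rw [(hzero hv).1, (hzero hv).2]
      exact hs.valid
    · rcases hs.valid with h | ⟨τ, h⟩
      · exact Or.inl ((hne hv).1 h)
      · rcases ((hne hv).2 τ h).1 with h | h
        · exact Or.inl h
        · exact Or.inr ⟨_, h⟩
  · intro x hx
    rw [Set.mem_ofPred_eq] at hx
    exact htx x (by omega)

open Classical in
/-- The marked part of the state after a search. -/
theorem marked_searchCode (hw : 2 ≤ w) (hT : IsSortedArray w T) (ha : Fits w a) (hr : Fits w r)
    (hc : Fits w c) (hr1 : 1 ≤ r) (hc1 : 1 ≤ c) {M : ℕ} (l : List Bool)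
    (hM : off (l.count true) + 2 ≤ M) (hk : M + 2 * off (l.count true) ≤ k)
    {s : Mem k w} (hs : Config T a M (l.count true) s) :
    ∃ f : Mem k w, AgreeOff {x | 8 ≤ x ∧ x < off (l.count true)} f s ∧
      marked flagged (progMat T k w (searchCode r c M l).1 *ᵥ Pi.single s 1) =
        ((if Hit T a (l.count true) (s.read (off (l.count true)))
            (s.read (off (l.count true) + 1)) then amplitude l else 0 : ℝ) : ℂ) • Pi.single f 1 ∧
      (Hit T a (l.count true) (s.read (off (l.count true))) (s.read (off (l.count true) + 1)) →
        ∃ (i : Fin r) (j : Fin c), T i j = a ∧ f.read 8 = BitVec.ofInt w i ∧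
          f.read 9 = BitVec.ofInt w j) := by
  induction l generalizing s with
  | nil =>
    have hwf : ∀ I ∈ baseCode c, I.WF k := fun I hI =>
      baseCode_wf (by have := le_off 0; simp only [List.count_nil] at hM hk; omega) hI
    have hread := read_progPerm T hwf s
    have h20 : off 0 = 20 := rfl
    obtain ⟨h1, h2⟩ := baseCode_flag (by omega) hT ha hr hc hs.input hs.zero
      (fun x h1 h2 => hs.fresh x h1 (by simp only [List.count_nil]; omega)) hs.valid
    refine ⟨progPerm T k w (baseCode c) s, fun x hx => ?_, ?_, ?_⟩
    · rw [hread]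
      refine execs_of_forall_ne T _ fun I hI => ?_
      have := baseCode_d hI
      rw [Set.mem_ofPred_eq, List.count_nil, h20] at hx
      omega
    · simp only [searchCode]
      rw [progMat_eq_permMat T fun I hI => (hwf I hI).1, permMat_mulVec_single, marked_single]
      congr 1
      simp only [flagged, amplitude, hread, h1]
      simp only [List.count_nil, h20]
      split_ifs <;> simp
    · rw [hread]
      exact h2
  | cons b l ih =>
    cases b
    · have hcount : List.count true (false :: l) = List.count true l :=
        List.count_cons_of_ne (by simp)
      rw [hcount] at hM hk hs ⊢
      have hoff := le_off (l.count true)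
      obtain ⟨f, hfs, hf, hpos⟩ := ih hM hk hs
      refine ⟨f, hfs, ?_, hpos⟩
      have h1 := progMat_searchCode_snd (w := w) T l (by omega) hk
      simp only [searchCode, flagCode, progMat_append, h1, progMat_phase_four T
        (show 15 < k by omega), progMat_reflectCode (e := l.count true) T (by omega) hk]
      have key := marked_amplify (χ := flagged) (progMat_mem T k w (searchCode r c M l).1)
        (reflectTest T M (l.count true)) hf
        ((reflectTest_iff T (by omega) (by omega) hk hs.zero hs.temp).2 hs.fresh)
        (by
          intro t hts hUt
          -- A state `t` that `U` can map to `f` agrees with `s` off the work registers. If it also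
          -- passes the test, its work registers vanish as those of `s` do, so `t = s`.
          have htf := actsOn_searchCode T l (by omega) hk f t hUt
          have hts' := htf.symm.trans hfs
          rw [Bool.eq_false_iff]
          intro htest
          have htest := (reflectTest_iff T (by omega) (by omega) hk
            ((hts' 4 (by simp)).trans hs.zero)
            (fun x hx => (hts' x (by rw [Set.mem_ofPred_eq]; omega)).trans (hs.temp x hx))).1 htest
          apply hts
          apply Mem.ext_read
          intro x _
          by_cases hx : 8 ≤ x ∧ x < off (l.count true)
          · rw [htest x hx.1 hx.2, hs.fresh x hx.1 hx.2]
          · exact hts' x hx)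
      have e1 : ∀ A B C D E : Matrix (Mem k w) (Mem k w) ℂ,
          A * (B * (C * (D * E))) = A * B * C * D * E := fun A B C D E => by
        simp only [Matrix.mul_assoc]
      rw [e1]
      refine key.trans ?_
      congr 2
      split_ifs
      · rfl
      · norm_num
    · have hcount : List.count true (true :: l) = List.count true l + 1 := List.count_cons_self
      rw [hcount] at hM hk hs ⊢
      set e := l.count true with he
      have hoff := le_off e
      have hsucc := off_succ e
      have hdk : off e + 10 * (e + 1) + 2 < k := by omega
      have hw1 : (1 : BitVec w) ≠ 0 := by
        have : 2 ^ 1 ≤ 2 ^ w := Nat.pow_le_pow_right (by norm_num) (by omega)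
        exact BitVec_natCast_ne_zero (n := 1) (by norm_num) (by omega)
      have hs0 : s.read (off e + 10 * (e + 1) + 2) = 0 := hs.fresh _ (by omega) (by omega)
      have hupd : Function.update s ⟨off e + 10 * (e + 1) + 2, hdk⟩ 0 = s := by
        apply Mem.ext_read
        intro x _
        rw [Mem.read_update]
        split_ifs with h
        · rw [h, hs0]
        · rfl
      have m0 := config_move T hw hT ha hr hc hr1 hc1 hM (by omega) hs rfl hdk (v := 0) rfl
      have m1 := config_move T hw hT ha hr hc hr1 hc1 hM (by omega) hs rfl hdk (v := 1) rfl
      rw [hupd] at m0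
      set t0 := progPerm T k w (moveCode r c e) s with ht0
      set t1 := progPerm T k w (moveCode r c e)
        (Function.update s ⟨off e + 10 * (e + 1) + 2, hdk⟩ 1) with ht1
      obtain ⟨c0, g0, z0, -⟩ := m0
      obtain ⟨c1, g1, -, z1⟩ := m1
      obtain ⟨f0, q0, r0, p0⟩ := ih (by omega) (by omega) c0
      obtain ⟨f1, q1, r1, p1⟩ := ih (by omega) (by omega) c1
      rw [(z0 rfl).1, (z0 rfl).2] at r0 p0
      -- The Hadamard gate splits `s` into the unmoved branch `t0` and the moved branch `t1`. At
      -- most one of them has a marked part, so that part is just scaled by `1 / √2`.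
      obtain ⟨hits, hexcl⟩ := hit_succ hT hr hc hs.valid (z1 hw1).1 (z1 hw1).2
      have hvec : progMat T k w (searchCode r c M (true :: l)).1 *ᵥ Pi.single s 1 =
          (((Real.sqrt 2)⁻¹ : ℝ) : ℂ) • (progMat T k w (searchCode r c M l).1 *ᵥ Pi.single t1 1 +
            progMat T k w (searchCode r c M l).1 *ᵥ Pi.single t0 1) := by
        simp only [searchCode, bitCode, ← he, progMat_append, progMat_cons]
        rw [← Matrix.mulVec_mulVec, ← Matrix.mulVec_mulVec,
          instrMat_had_mulVec T hdk (by omega) hs0, Matrix.mulVec_smul, Matrix.mulVec_smul,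
          Matrix.mulVec_add, Matrix.mulVec_add,
          progMat_eq_permMat T fun I hI => (moveCode_wf (k := k) (by omega) hI).1,
          permMat_mulVec_single, permMat_mulVec_single]
      rw [hvec, marked_smul, marked_add, r0, r1]
      have hsub : {x | 8 ≤ x ∧ x < off e} ⊆ {x | 8 ≤ x ∧ x < off (e + 1)} := fun x hx =>
        ⟨hx.1, by have := hx.2; omega⟩
      by_cases h0 : Hit T a e (s.read (off (e + 1))) (s.read (off (e + 1) + 1))
      · have h1 : ¬ Hit T a e (t1.read (off e)) (t1.read (off e + 1)) := fun h => hexcl ⟨h0, h⟩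
        refine ⟨f0, (q0.mono hsub).trans g0, ?_, fun _ => p0 h0⟩
        rw [if_pos h0, if_neg h1, if_pos (hits.2 (Or.inl h0)), Complex.ofReal_zero, zero_smul,
          zero_add, smul_smul, ← Complex.ofReal_mul]
        rfl
      · by_cases h1 : Hit T a e (t1.read (off e)) (t1.read (off e + 1))
        · refine ⟨f1, (q1.mono hsub).trans g1, ?_, fun _ => p1 h1⟩
          rw [if_neg h0, if_pos h1, if_pos (hits.2 (Or.inr h1)), Complex.ofReal_zero, zero_smul,
            add_zero, smul_smul, ← Complex.ofReal_mul]
          rfl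
        · have h2 : ¬ Hit T a (e + 1) (s.read (off (e + 1))) (s.read (off (e + 1) + 1)) := by
            rw [hits]; exact not_or.2 ⟨h0, h1⟩
          refine ⟨s, AgreeOff.refl _ _, ?_, fun h => absurd h h2⟩
          rw [if_neg h0, if_neg h1, if_neg h2, Complex.ofReal_zero, zero_smul, zero_smul,
            zero_smul, add_zero, smul_zero]

end

end QSearch

/-! ### Parameters, success probability and the final program -/

namespace QSearch

open Matrix

/-! ### The schedule of coin tosses and amplifications -/

/-- `n` levels with four coin tosses each, above a level with nine coin tosses. -/
def lowerSchedule : ℕ → List Bool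
  | 0 => [false, true, true, true, true, true, true, true, true, true]
  | n + 1 => [false, true, true, true, true] ++ lowerSchedule n

/-- `n` levels with three coin tosses each, above `lowerSchedule j`. -/
def upperSchedule (j : ℕ) : ℕ → List Bool
  | 0 => lowerSchedule j
  | n + 1 => [false, true, true, true] ++ upperSchedule j n

/-- The number of levels for arrays with at most `m` rows and columns. -/
def depth (m : ℕ) : ℕ := Nat.clog 9 m

/-- The number of levels with four coin tosses. -/
def lowerDepth (m : ℕ) : ℕ := Nat.log 2 (9 ^ depth m / 8 ^ depth m)

/-- The list of coin tosses and amplifications for arrays with at most `m` rows and columns. -/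
def schedule (m : ℕ) : List Bool :=
  [false, false] ++ upperSchedule (lowerDepth m) (depth m - lowerDepth m)

theorem amplitude_true_sq (l : List Bool) :
    amplitude (true :: l) ^ 2 = amplitude l ^ 2 / 2 := by
  rw [amplitude, mul_pow, inv_pow, Real.sq_sqrt (by norm_num)]
  ring

theorem amplitude_false_sq (l : List Bool) :
    amplitude (false :: l) ^ 2 = amplitude l ^ 2 * (3 - 4 * amplitude l ^ 2) ^ 2 := by
  rw [amplitude]
  ring

/-- The upper bound `9 / 512 * (9 / 16) ^ n` is what amplification by exactly 9 would give. The
bottom level loses a fraction of at most `1 / 192`. A later level entered with probability `p` loses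
a fraction of at most about `p / 6`; summed geometrically with ratio `9 / 16`, this is the term with
`8 / 21`. -/
theorem amplitude_lowerSchedule (n : ℕ) :
    9 / 512 * (9 / 16 : ℝ) ^ n * (1 - 1 / 192 - 8 / 21 * (9 / 512 - 9 / 512 * (9 / 16) ^ n)) ≤
        amplitude (lowerSchedule n) ^ 2 ∧
      amplitude (lowerSchedule n) ^ 2 ≤ 9 / 512 * (9 / 16) ^ n := by
  induction n with
  | zero =>
    simp only [lowerSchedule, amplitude_false_sq, amplitude_true_sq]
    norm_num [amplitude]
  | succ n ih =>
    simp only [lowerSchedule, List.cons_append, List.nil_append, amplitude_false_sq,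
      amplitude_true_sq, pow_succ (9 / 16 : ℝ)]
    have hx0 : (0 : ℝ) < (9 / 16) ^ n := by positivity
    have hx1 : ((9 / 16 : ℝ)) ^ n ≤ 1 := pow_le_one₀ (by norm_num) (by norm_num)
    obtain ⟨h1, h2⟩ := ih
    generalize (9 / 16 : ℝ) ^ n = x at *
    have hp0 := sq_nonneg (amplitude (lowerSchedule n))
    generalize amplitude (lowerSchedule n) ^ 2 = p at *
    have e : p / 2 / 2 / 2 / 2 * (3 - 4 * (p / 2 / 2 / 2 / 2)) ^ 2 =
      9 * p / 16 - 24 * p ^ 2 / 256 + p ^ 3 / 256 := by ring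
    rw [e]
    have hp2 : p ^ 2 ≤ (9 / 512 * x) ^ 2 := pow_le_pow_left₀ hp0 h2 2
    have hp3 : 0 ≤ p ^ 3 := by positivity
    constructor
    · nlinarith
    · have : p ^ 3 ≤ p ^ 2 * 1 := by
        rw [pow_succ]
        exact mul_le_mul_of_nonneg_left (by linarith) (sq_nonneg p)
      nlinarith

/-- Now the probability grows by `9 / 8` per level and the relative loss is at most about `p / 3`.
Summed geometrically this stays below `8 / 3` times the last ideal probability. The losses of the
lower levels are bounded by letting their number tend to infinity. -/
theorem amplitude_upperSchedule (j n : ℕ)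
    (hN : 9 / 512 * (9 / 16 : ℝ) ^ j * (9 / 8) ^ n ≤ 1) :
    9 / 512 * (9 / 16 : ℝ) ^ j * (9 / 8) ^ n * (1 - 1 / 192 - 8 / 21 * (9 / 512) -
        8 / 3 * (9 / 512 * (9 / 16) ^ j * (9 / 8) ^ n)) ≤ amplitude (upperSchedule j n) ^ 2 ∧
      amplitude (upperSchedule j n) ^ 2 ≤ 9 / 512 * (9 / 16) ^ j * (9 / 8) ^ n := by
  induction n with
  | zero =>
    obtain ⟨h1, h2⟩ := amplitude_lowerSchedule j
    have hx0 : (0 : ℝ) < (9 / 16) ^ j := by positivity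
    simp only [upperSchedule, pow_zero, mul_one]
    refine ⟨le_trans ?_ h1, h2⟩
    generalize (9 / 16 : ℝ) ^ j = x at *
    nlinarith
  | succ n ih =>
    simp only [upperSchedule, List.cons_append, List.nil_append, amplitude_false_sq,
      amplitude_true_sq]
    rw [pow_succ, ← mul_assoc] at hN ⊢
    have hx0 : (0 : ℝ) < 9 / 512 * (9 / 16 : ℝ) ^ j * (9 / 8) ^ n := by positivity
    generalize 9 / 512 * (9 / 16 : ℝ) ^ j * (9 / 8) ^ n = x at *
    obtain ⟨h1, h2⟩ := ih (by linarith)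
    have hp0 := sq_nonneg (amplitude (upperSchedule j n))
    generalize amplitude (upperSchedule j n) ^ 2 = p at *
    have e : p / 2 / 2 / 2 * (3 - 4 * (p / 2 / 2 / 2)) ^ 2 =
      9 * p / 8 - 24 * p ^ 2 / 64 + p ^ 3 / 32 := by ring
    rw [e]
    have hp2 : p ^ 2 ≤ x ^ 2 := pow_le_pow_left₀ hp0 h2 2
    have hp3 : 0 ≤ p ^ 3 := by positivity
    constructor
    · nlinarith
    · have : p ^ 3 ≤ p ^ 2 * 1 := by
        rw [pow_succ]
        exact mul_le_mul_of_nonneg_left (by linarith) (sq_nonneg p)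
      nlinarith

/-- Three tosses per level alone would cover only a multiple of `8 ^ J` diagonals, where `J = depth
m`. The fourth tosses contribute the missing factor `(9 / 8) ^ J`, up to a factor 2. -/
theorem lowerDepth_spec (m : ℕ) :
    2 ^ lowerDepth m * 8 ^ depth m ≤ 9 ^ depth m ∧
      9 ^ depth m < 2 * (2 ^ lowerDepth m * 8 ^ depth m) ∧ lowerDepth m ≤ depth m := by
  unfold lowerDepth
  generalize depth m = J
  have h8 : 0 < 8 ^ J := by positivity
  have hq : 9 ^ J / 8 ^ J ≠ 0 :=
    (Nat.div_pos (Nat.pow_le_pow_left (by norm_num) J) h8).ne'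
  have h1 : 2 ^ Nat.log 2 (9 ^ J / 8 ^ J) ≤ 9 ^ J / 8 ^ J := Nat.pow_log_le_self 2 hq
  have h2 : 9 ^ J / 8 ^ J < 2 ^ (Nat.log 2 (9 ^ J / 8 ^ J) + 1) :=
    Nat.lt_pow_succ_log_self (by norm_num) _
  have h3 : 9 ^ J < 2 ^ (Nat.log 2 (9 ^ J / 8 ^ J) + 1) * 8 ^ J := (Nat.div_lt_iff_lt_mul h8).1 h2
  have h4 : 2 ^ Nat.log 2 (9 ^ J / 8 ^ J) * 8 ^ J ≤ 9 ^ J := (Nat.le_div_iff_mul_le h8).1 h1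
  refine ⟨h4, by rw [pow_succ] at h3; linarith, ?_⟩
  by_contra hcon
  have h5 : 2 ^ J ≤ 2 ^ Nat.log 2 (9 ^ J / 8 ^ J) := Nat.pow_le_pow_right (by norm_num) (by omega)
  have h6 : 2 ^ J * 8 ^ J ≤ 9 ^ J := (Nat.mul_le_mul_right _ h5).trans h4
  rw [← mul_pow] at h6
  have h7 := (Nat.pow_le_pow_left (show 9 ≤ 2 * 8 by norm_num) J)
  have h8 : 9 ^ J = (2 * 8) ^ J := le_antisymm h7 h6
  rcases Nat.eq_zero_or_pos J with hJ | hJ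
  · subst hJ; simp at hcon
  · have := Nat.pow_lt_pow_left (show 9 < 2 * 8 by norm_num) hJ.ne'
    omega

theorem two_thirds_le_amplitude_schedule (m : ℕ) : 2 / 3 ≤ amplitude (schedule m) ^ 2 := by
  obtain ⟨h1, h2, h3⟩ := lowerDepth_spec m
  have hN : 9 / 512 * (9 / 16 : ℝ) ^ lowerDepth m * (9 / 8) ^ (depth m - lowerDepth m) =
      9 / 512 * (9 ^ depth m / (2 ^ lowerDepth m * 8 ^ depth m)) := by
    obtain ⟨d, hd⟩ := Nat.exists_eq_add_of_le h3
    rw [hd, Nat.add_sub_cancel_left]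
    have : (16 : ℝ) = 2 * 8 := by norm_num
    rw [div_pow, div_pow, pow_add, pow_add, this, mul_pow]
    field_simp
  have h1' : (2 : ℝ) ^ lowerDepth m * 8 ^ depth m ≤ 9 ^ depth m := by exact_mod_cast h1
  have h2' : (9 : ℝ) ^ depth m < 2 * (2 ^ lowerDepth m * 8 ^ depth m) := by exact_mod_cast h2
  have hpos : (0 : ℝ) < 2 ^ lowerDepth m * 8 ^ depth m := by positivity
  have q1 : 1 ≤ (9 : ℝ) ^ depth m / (2 ^ lowerDepth m * 8 ^ depth m) := by
    rwa [le_div_iff₀ hpos, one_mul]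
  have q2 : (9 : ℝ) ^ depth m / (2 ^ lowerDepth m * 8 ^ depth m) ≤ 2 := by
    rw [div_le_iff₀ hpos]; exact h2'.le
  have key := amplitude_upperSchedule (lowerDepth m) (depth m - lowerDepth m)
    (by rw [hN]; linarith)
  rw [hN] at key
  generalize (9 : ℝ) ^ depth m / (2 ^ lowerDepth m * 8 ^ depth m) = q at *
  obtain ⟨k1, k2⟩ := key
  simp only [schedule, List.cons_append, List.nil_append, amplitude_false_sq]
  generalize amplitude (upperSchedule _ _) ^ 2 = y at *
  -- The ideal probability before the two final rounds is `9 / 512 * q` with `1 ≤ q ≤ 2`. The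
  -- resulting interval `[0.0157, 0.0352]` is mapped into `[0.13, 0.29]` by the first round, and the
  -- second round maps that above 2/3. The upper ends matter too, since overshooting lowers the
  -- probability.
  have y1 : 0.0157 ≤ y := by
    refine le_trans ?_ k1
    nlinarith
  have y2 : y ≤ 0.0352 := by linarith
  have y3 : 0 ≤ y ^ 2 * y := by positivity
  have y4 : y ^ 2 * y ≤ 0.0352 * y ^ 2 := by nlinarith [sq_nonneg y]
  have y5 : y * (3 - 4 * y) ^ 2 = 9 * y - 24 * y ^ 2 + 16 * (y ^ 2 * y) := by ring
  have z1 : 0.13 ≤ y * (3 - 4 * y) ^ 2 := by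
    rw [y5]
    nlinarith [mul_nonneg (sub_nonneg.2 y1) (sub_nonneg.2 y2)]
  have z2 : y * (3 - 4 * y) ^ 2 ≤ 0.29 := by
    rw [y5]
    nlinarith [mul_nonneg (sub_nonneg.2 y2) (sub_nonneg.2 y2)]
  generalize y * (3 - 4 * y) ^ 2 = z at *
  nlinarith [mul_nonneg (sub_nonneg.2 z1) (sub_nonneg.2 z2),
    mul_nonneg (mul_nonneg (sub_nonneg.2 z1) (sub_nonneg.2 z2)) (show (0:ℝ) ≤ 1 - z by linarith)]

theorem count_lowerSchedule (n : ℕ) : (lowerSchedule n).count true = 9 + 4 * n := by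
  induction n with
  | zero => rfl
  | succ n ih => rw [lowerSchedule, List.count_append, ih]; simp; ring

theorem count_upperSchedule (j n : ℕ) : (upperSchedule j n).count true = 9 + 4 * j + 3 * n := by
  induction n with
  | zero => exact count_lowerSchedule j
  | succ n ih => rw [upperSchedule, List.count_append, ih]; simp; ring

theorem count_schedule (m : ℕ) :
    (schedule m).count true = 9 + 4 * lowerDepth m + 3 * (depth m - lowerDepth m) := by
  rw [schedule, List.count_append, count_upperSchedule]
  simp

theorem lt_two_pow_count_schedule (m : ℕ) : 2 * m < 2 ^ (schedule m).count true := by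
  obtain ⟨h1, h2, h3⟩ := lowerDepth_spec m
  rw [count_schedule]
  obtain ⟨d, hd⟩ := Nat.exists_eq_add_of_le h3
  have h4 : m ≤ 9 ^ depth m := Nat.le_pow_clog (by norm_num) m
  have h5 : 2 ^ (9 + 4 * lowerDepth m + 3 * (depth m - lowerDepth m)) =
      512 * (2 ^ lowerDepth m * 8 ^ depth m) := by
    rw [hd, Nat.add_sub_cancel_left, pow_add, pow_add, pow_mul, pow_mul, pow_add,
      show 2 ^ 4 = 2 * 8 by norm_num, show 2 ^ 3 = 8 by norm_num, mul_pow]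
    ring
  rw [h5]
  omega

/-! ### The program -/

/-- The program for arrays with `r` rows and `c` columns. -/
def searchProgram (r c : ℕ) : Program :=
  if r = 0 ∨ c = 0 then (0, [])
  else
    (off ((schedule (max r c)).count true) + 2 + 2 * off ((schedule (max r c)).count true),
      [⟨.imm, off ((schedule (max r c)).count true), r, 0⟩,
        ⟨.imm, off ((schedule (max r c)).count true) + 1, c, 0⟩,
        ⟨.neg, off ((schedule (max r c)).count true) + 1, 0, 0⟩] ++
      ((searchCode r c (off ((schedule (max r c)).count true) + 2) (schedule (max r c))).1 ++
      [⟨.imm, 5, 1, 0⟩, ⟨.and, 1, 15, 5⟩, ⟨.copy, 2, 8, 0⟩, ⟨.copy, 3, 9, 0⟩]))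

theorem read_initMem (k w : ℕ) (a : ℤ) (x : ℕ) (hk : 0 < k) :
    (initMem k w a).read x = if x = 0 then BitVec.ofInt w a else 0 := by
  unfold Mem.read initMem
  split_ifs with h1 h2 h3
  · rfl
  · rfl
  · omega
  · rfl

open Classical in
theorem successProb_empty {r c k w : ℕ} (T : Fin r → Fin c → ℤ) (a : ℤ) (hk : k = 0)
    (h : r = 0 ∨ c = 0) : successProb (k := k) (w := w) T a [] = 1 := by
  subst hk
  have h1 : ∀ s : Mem 0 w, CorrectAnswer T a (answer s) := by
    intro s
    have : answer s = none := by simp [answer, Mem.read]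
    rw [this]
    intro i j
    rcases h with h | h
    · subst h; exact i.elim0
    · subst h; exact j.elim0
  unfold successProb
  simp only [h1, if_true, finalState, List.foldl_nil]
  rw [Finset.sum_eq_single (initMem 0 w a)]
  · rw [Pi.single_eq_same]; simp
  · intro b _ hb; exact absurd (Subsingleton.elim _ _) hb
  · exact fun h => absurd (Finset.mem_univ _) h

open Classical in
theorem two_thirds_le_successProb {r c w : ℕ} (T : Fin r → Fin c → ℤ) {a : ℤ} (hr1 : 1 ≤ r)
    (hc1 : 1 ≤ c) (hT : IsSortedArray w T) (ha : Fits w a) (hr : Fits w r) (hc : Fits w c) :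
    2 / 3 ≤ successProb T a ((searchProgram r c).steps w) := by
  have hne : ¬ (r = 0 ∨ c = 0) := by omega
  have hw : 2 ≤ w := by
    have h1 : 2 * (r : ℤ) < 2 ^ w := hr.2
    by_contra hcon
    have : (2 : ℤ) ^ w ≤ 2 ^ 1 := pow_le_pow_right₀ (by norm_num) (by omega)
    omega
  unfold Program.steps
  rw [searchProgram, if_neg hne]
  have hlt := lt_two_pow_count_schedule (max r c)
  have hamp := two_thirds_le_amplitude_schedule (max r c)
  generalize schedule (max r c) = l at *
  set e := l.count true with he
  have hoff := le_off e
  simp only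
  set k := off e + 2 + 2 * off e with hk
  set pre : List Instr := [⟨.imm, off e, r, 0⟩, ⟨.imm, off e + 1, c, 0⟩, ⟨.neg, off e + 1, 0, 0⟩]
    with hpre
  set post : List Instr := [⟨.imm, 5, 1, 0⟩, ⟨.and, 1, 15, 5⟩, ⟨.copy, 2, 8, 0⟩, ⟨.copy, 3, 9, 0⟩]
    with hpost
  have hprewf : ∀ I ∈ pre, I.WF k := by
    intro I hI
    simp only [hpre, List.mem_cons, List.not_mem_nil, or_false] at hI
    rcases hI with h | h | h <;> subst h <;> simp [Instr.WF, Instr.IsClassical] <;> omega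
  have hpostwf : ∀ I ∈ post, I.WF k := by
    intro I hI
    simp only [hpost, List.mem_cons, List.not_mem_nil, or_false] at hI
    rcases hI with h | h | h | h <;> subst h <;> simp [Instr.WF, Instr.IsClassical] <;> omega
  set s : Mem k w := progPerm T k w pre (initMem k w a) with hs
  have hinit : ∀ x, (initMem k w a).read x = if x = 0 then BitVec.ofInt w a else 0 := fun x =>
    read_initMem k w a x (by omega)
  have hsr : s.read = execs T (initMem k w a).read pre := read_progPerm T hprewf _
  have hsx : ∀ x, x ≠ off e → x ≠ off e + 1 → s.read x = if x = 0 then BitVec.ofInt w a else 0 := by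
    intro x h1 h2
    rw [hsr, execs_of_forall_ne, hinit]
    intro I hI
    simp only [hpre, List.mem_cons, List.not_mem_nil, or_false] at hI
    rcases hI with h | h | h <;> subst h <;> assumption
  have a1 : off e ≠ 0 := by omega
  have hsP : s.read (off e) = BitVec.ofInt w r := by
    rw [hsr]
    simp only [hpre, execs, List.foldl_cons, List.foldl_nil, Instr.exec, Instr.val,
      Function.update_apply, reduceCtorEq, if_false, if_true, hinit, a1, ofNat_eq_ofInt]
    simp
  have hsQ : s.read (off e + 1) = BitVec.ofInt w (0 - c) := by
    rw [hsr, ofInt_sub]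
    have a2 : off e + 1 ≠ off e := by omega
    have a3 : off e + 1 ≠ 0 := by omega
    simp only [hpre, execs, List.foldl_cons, List.foldl_nil, Instr.exec, Instr.val,
      Function.update_apply, reduceCtorEq, if_false, if_true, hinit, a2, a3, ofNat_eq_ofInt,
      zero_add]
    simp
  -- The walk starts in the bottom left corner `(r, 0)`, on diagonal number 0.
  have halive : Alive T a 0 (s.read (off e)) (s.read (off e + 1)) :=
    ⟨r, 0, hsP, hsQ, by omega, Bracket.start T a, by ring⟩
  have hconfig : Config T a (off e + 2) e s := by
    refine ⟨?_, ?_, fun x h1 h2 => ?_, fun x h1 => ?_, Or.inr ⟨0, halive⟩⟩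
    · rw [hsx _ (by omega) (by omega), if_pos rfl]
    · rw [hsx _ (by omega) (by omega), if_neg (by omega)]
    · rw [hsx _ (by omega) (by omega), if_neg (by omega)]
    · rw [hsx _ (by omega) (by omega), if_neg (by omega)]
  obtain ⟨f, hfs, hf, hpos⟩ := marked_searchCode (k := k) T hw hT ha hr hc hr1 hc1 l
    (M := off e + 2) le_rfl le_rfl hconfig
  have hact := actsOn_searchCode (w := w) (k := k) T (M := off e + 2) l
    (Nat.le_add_right _ _) le_rfl
  set U := progMat T k w (searchCode r c (off e + 2) l).1 with hU
  set φ : Mem k w → ℂ := U *ᵥ Pi.single s 1 with hφ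
  set π := progPerm T k w post with hπ
  have hφs : ∀ t, φ t ≠ 0 → AgreeOff {x | 8 ≤ x ∧ x < off e} t s := fun t ht =>
    hact t s (by simpa [hφ] using ht)
  have hfinal : ∀ t, finalState T a (List.map (Instr.toStep k w)
      (pre ++ ((searchCode r c (off e + 2) l).1 ++ post))) (π t) = φ t := by
    intro t
    rw [finalState_map, progMat_append, progMat_append, ← Matrix.mulVec_mulVec,
      progMat_eq_permMat T fun I hI => (hprewf I hI).1, permMat_mulVec_single, ← hs,
      ← Matrix.mulVec_mulVec, progMat_eq_permMat T fun I hI => (hpostwf I hI).1]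
    simp only [permMat, Matrix.mulVec, dotProduct, Matrix.of_apply, ite_mul, one_mul, zero_mul]
    rw [Finset.sum_eq_single t]
    · rw [if_pos rfl]; rfl
    · intro b _ hb
      rw [if_neg fun h => hb (π.injective h).symm]
    · simp
  have hπr : ∀ t, AgreeOff {x | 8 ≤ x ∧ x < off e} t s →
      (π t).read 1 = t.read 15 &&& 1 ∧ (π t).read 2 = t.read 8 ∧ (π t).read 3 = t.read 9 := by
    intro t ht
    have t1 : t.read 1 = 0 := by
      rw [ht 1 (by simp), hsx _ (by omega) (by omega), if_neg (by omega)]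
    have t2 : t.read 2 = 0 := by
      rw [ht 2 (by simp), hsx _ (by omega) (by omega), if_neg (by omega)]
    have t3 : t.read 3 = 0 := by
      rw [ht 3 (by simp), hsx _ (by omega) (by omega), if_neg (by omega)]
    have t5 : t.read 5 = 0 := by
      rw [ht 5 (by simp), hsx _ (by omega) (by omega), if_neg (by omega)]
    rw [hπ, read_progPerm T hpostwf]
    simp only [hpost, execs, List.foldl_cons, List.foldl_nil, Instr.exec, Instr.val,
      Function.update_apply, reduceCtorEq, if_false, if_true, Nat.reduceEqDiff, zero_add,
      OfNat.ofNat_ne_one, OfNat.one_ne_ofNat, t1, t2, t3, t5]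
    exact ⟨rfl, trivial, trivial⟩
  have hand : ∀ v : BitVec w, v &&& 1 = 0 ↔ v.getLsbD 0 = false := by
    intro v
    constructor
    · intro h
      have := congrArg (fun x : BitVec w => x.getLsbD 0) h
      simpa [show 0 < w by omega] using this
    · intro h
      apply BitVec.eq_of_getLsbD_eq
      intro i hi
      by_cases h0 : i = 0
      · subst h0; simp [h]
      · simp [h0]
  unfold successProb
  rw [← Equiv.sum_comp π]
  simp only [hfinal]
  by_cases hex : ∃ (i : Fin r) (j : Fin c), T i j = a
  · have hhit : Hit T a e (s.read (off e)) (s.read (off e + 1)) := by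
      obtain ⟨i, j, hij⟩ := hex
      have : ((2 ^ e : ℕ) : ℤ) = 2 ^ e := by push_cast; rfl
      -- Diagonal numbers of entries are at most `r + c - 2`, which is less than `2 * max r c` and
      -- hence than `2 ^ e`.
      exact ⟨0, halive, i, j, hij, by omega, by omega⟩
    obtain ⟨i, j, hij, hi, hj⟩ := hpos hhit
    rw [if_pos hhit] at hf
    have hαne : amplitude l ≠ 0 := fun h => by rw [h] at hamp; norm_num at hamp
    have hff : flagged f = true ∧ φ f = amplitude l := by
      have := congrFun hf f
      by_cases hflag : flagged f = true
      · exact ⟨hflag, by simpa [marked, hflag] using this⟩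
      · simp only [marked, hflag, Pi.smul_apply, Pi.single_eq_same, smul_eq_mul, mul_one] at this
        exact absurd (by simpa using this.symm) hαne
    have hcorrect : CorrectAnswer T a (answer (π f)) := by
      obtain ⟨e1, e2, e3⟩ := hπr f hfs
      have h1 : (π f).read 1 ≠ 0 := by
        rw [e1, Ne, hand]
        simpa [flagged] using hff.1
      have n1 : ((BitVec.ofInt w i).toNat : ℤ) = i :=
        toNat_ofInt_of_fits (by omega) ⟨by have := hr.1; have := hr.2; omega,
          by have := hr.2; omega⟩
      have n2 : ((BitVec.ofInt w j).toNat : ℤ) = j :=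
        toNat_ofInt_of_fits (by omega) ⟨by have := hc.1; have := hc.2; omega,
          by have := hc.2; omega⟩
      rw [answer, if_neg h1, e2, e3, hi, hj]
      exact ⟨i, j, by simp only; omega, by simp only; omega, hij⟩
    calc (2 / 3 : ℝ) ≤ amplitude l ^ 2 := hamp
      _ = (if CorrectAnswer T a (answer (π f)) then ‖φ f‖ ^ 2 else 0) := by
        rw [if_pos hcorrect, hff.2, Complex.norm_real, Real.norm_eq_abs, sq_abs]
      _ ≤ _ := Finset.single_le_sum (f := fun t => if CorrectAnswer T a (answer (π t)) then
          ‖φ t‖ ^ 2 else 0) (fun t _ => by positivity) (Finset.mem_univ f)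
  · have hnohit : ¬ Hit T a e (s.read (off e)) (s.read (off e + 1)) := by
      rintro ⟨τ, -, i, j, hij, -⟩
      exact hex ⟨i, j, hij⟩
    rw [if_neg hnohit, Complex.ofReal_zero, zero_smul] at hf
    -- If `a` does not occur, the flagged part is exactly zero and the answer "not found" is
    -- certain; the error is one-sided.
    have hall : ∀ t, (if CorrectAnswer T a (answer (π t)) then ‖φ t‖ ^ 2 else 0) = ‖φ t‖ ^ 2 := by
      intro t
      by_cases ht : φ t = 0
      · rw [ht]; simp
      · have hnf : flagged t = false := by
          by_contra hcon
          have := congrFun hf t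
          simp only [marked, Bool.not_eq_false] at this hcon
          rw [if_pos hcon] at this
          exact ht this
        have h1 : (π t).read 1 = 0 := by
          rw [(hπr t (hφs t ht)).1, hand]
          exact hnf
        rw [answer, if_pos h1, if_pos]
        intro i j hij
        exact hex ⟨i, j, hij⟩
    simp only [hall]
    rw [hφ, sum_norm_sq_mulVec (progMat_mem T k w _), Finset.sum_eq_single s]
    · simp; norm_num
    · intro b _ hb; simp [hb]
    · simp

end QSearch

/-! ### The recursion for the running time -/

namespace QSearch

/-! ### Running time -/

theorem length_stepsCode (c β o t : ℕ) : (stepsCode c β o t).length = 19 * (t + 1) := by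
  induction t with
  | zero => rfl
  | succ t ih =>
    rw [stepsCode, List.length_append, ih]
    simp only [stepCode, List.length_cons, List.length_nil]
    ring

theorem length_bitCode_le (r c e : ℕ) : (bitCode r c e).length ≤ 24 * (e + 1) := by
  rw [bitCode, List.length_cons, moveCode]
  split_ifs
  · simp only [List.length_append, List.length_cons, List.length_nil, length_stepsCode]
    omega
  · simp only [List.length_cons, List.length_nil]
    omega

theorem length_testCode (M n : ℕ) : (testCode M n).length = 1 + 2 * n := by
  induction n with
  | zero => rfl
  | succ n ih =>
    rw [testCode, List.length_append, ih]
    simp only [List.length_cons, List.length_nil]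
    ring

theorem length_reflectCode_le (M e : ℕ) : (reflectCode M e).length ≤ 104 * (e + 1) ^ 2 := by
  have h1 := length_undo_le (testCode M (off e - 8))
  have h2 : 1 ≤ (e + 1) ^ 2 := Nat.one_le_pow _ _ (by omega)
  simp only [length_testCode] at h1
  simp only [reflectCode, List.length_append, length_testCode, List.length_replicate]
  unfold off at *
  omega

/-- The length of a search algorithm, and of its inverse, is at most this number. -/
def cost (r c M : ℕ) (l : List Bool) : ℕ :=
  max (searchCode r c M l).1.length (searchCode r c M l).2.length

theorem cost_true_le (r c M : ℕ) (l : List Bool) :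
    cost r c M (true :: l) ≤ cost r c M l + 72 * (l.count true + 1) := by
  have h1 := length_bitCode_le r c (l.count true)
  have h2 := length_undo_le (bitCode r c (l.count true))
  simp only [cost, searchCode, List.length_append]
  omega

theorem cost_false_le (r c M : ℕ) (l : List Bool) :
    cost r c M (false :: l) ≤ 3 * cost r c M l + 108 * (l.count true + 1) ^ 2 := by
  have h1 := length_reflectCode_le M (l.count true)
  have h2 : 1 ≤ (l.count true + 1) ^ 2 := Nat.one_le_pow _ _ (by omega)
  simp only [cost, searchCode, List.length_append, flagCode, List.length_replicate]
  omega

/-- The additive work of a level is absorbed by the potential `2592 * N ^ 2`: cost plus potential at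
most triples. The term `288 * (e + 4)` bounds four tosses of cost `72 * (e' + 1)`, and `108 * (e +
5) ^ 2` bounds the reflection and the flag. -/
theorem cost_level (N e L L' : ℕ) (hN : 4 ≤ N) (he : e + 5 ≤ 4 * N)
    (h : L' ≤ 3 * (L + 288 * (e + 4)) + 108 * (e + 5) ^ 2) :
    L' + 2592 * (N + 1) ^ 2 ≤ 3 * (L + 2592 * N ^ 2) := by
  have h1 : (e + 5) ^ 2 ≤ (4 * N) ^ 2 := Nat.pow_le_pow_left he 2
  have h2 : 4 * N ≤ N ^ 2 := by nlinarith
  have h3 : (4 * N) ^ 2 = 16 * N ^ 2 := by ring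
  have h4 : (N + 1) ^ 2 = N ^ 2 + 2 * N + 1 := by ring
  omega

theorem cost_lowerSchedule_le (r c M n : ℕ) :
    cost r c M (lowerSchedule n) + 2592 * (n + 4) ^ 2 ≤ 62091 * 3 ^ n := by
  induction n with
  | zero =>
    have h0 : cost r c M [] ≤ 33 := by
      have := length_undo_le (baseCode c)
      have h : (baseCode c).length = 11 := rfl
      simp only [cost, searchCode]
      omega
    have hb : ∀ n, cost r c M (List.replicate n true) ≤ 33 + 72 * (∑ i ∈ Finset.range (n + 1), i) := by
      intro n
      induction n with
      | zero => simpa using h0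
      | succ n ih =>
        have := cost_true_le r c M (List.replicate n true)
        rw [List.count_replicate_self] at this
        rw [List.replicate_succ, Finset.sum_range_succ]
        omega
    -- The bottom level costs at most `3 * (33 + 72 * 45) + 108 * 10 ^ 2 = 20619`. With the
    -- potential `2592 * 4 ^ 2` this makes 62091.
    have h1 := hb 9
    have h2 := cost_false_le r c M (List.replicate 9 true)
    have h3 : ∑ i ∈ Finset.range (9 + 1), i = 45 := by decide
    rw [List.count_replicate_self] at h2
    change cost r c M (false :: List.replicate 9 true) + _ ≤ _
    omega
  | succ n ih =>
    have h := cost_false_le r c M ([true, true, true, true] ++ lowerSchedule n)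
    have t1 := cost_true_le r c M (lowerSchedule n)
    have t2 := cost_true_le r c M (true :: lowerSchedule n)
    have t3 := cost_true_le r c M (true :: true :: lowerSchedule n)
    have t4 := cost_true_le r c M (true :: true :: true :: lowerSchedule n)
    simp only [List.cons_append, List.nil_append, List.count_cons_self,
      count_lowerSchedule] at h t1 t2 t3 t4
    have := cost_level (n + 4) (9 + 4 * n) (cost r c M (lowerSchedule n))
      (cost r c M (lowerSchedule (n + 1))) (by omega) (by omega)
      (by refine h.trans (Nat.add_le_add (by omega) (le_of_eq (by ring))))
    rw [pow_succ 3]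
    have e : n + 4 + 1 = n + 1 + 4 := by ring
    rw [e] at this
    omega

theorem cost_upperSchedule_le (r c M j n : ℕ) :
    cost r c M (upperSchedule j n) + 2592 * (j + n + 4) ^ 2 ≤ 62091 * 3 ^ (j + n) := by
  induction n with
  | zero => exact cost_lowerSchedule_le r c M j
  | succ n ih =>
    have h := cost_false_le r c M ([true, true, true] ++ upperSchedule j n)
    have t1 := cost_true_le r c M (upperSchedule j n)
    have t2 := cost_true_le r c M (true :: upperSchedule j n)
    have t3 := cost_true_le r c M (true :: true :: upperSchedule j n)
    simp only [List.cons_append, List.nil_append, List.count_cons_self,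
      count_upperSchedule] at h t1 t2 t3
    have hsq : (9 + 4 * j + 3 * n + 1 + 1 + 1 + 1) ^ 2 ≤ (9 + 4 * j + 3 * n + 5) ^ 2 :=
      Nat.pow_le_pow_left (by omega) 2
    have := cost_level (j + n + 4) (9 + 4 * j + 3 * n) (cost r c M (upperSchedule j n))
      (cost r c M (upperSchedule j (n + 1))) (by omega) (by omega)
      (h.trans (Nat.add_le_add (by omega) (by omega)))
    have e : j + n + 4 + 1 = j + (n + 1) + 4 := by ring
    rw [e] at this
    rw [← add_assoc j n 1, pow_succ 3]
    rw [← add_assoc j n 1] at this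
    omega

/-- `558819 = 9 * 62091`: the two final rounds multiply by 9, and the potential left over pays for
their reflections. -/
theorem cost_schedule_le (r c M m : ℕ) :
    cost r c M (schedule m) ≤ 558819 * 3 ^ depth m := by
  have h3 := (lowerDepth_spec m).2.2
  have hu := cost_upperSchedule_le r c M (lowerDepth m) (depth m - lowerDepth m)
  have h1 := cost_false_le r c M (upperSchedule (lowerDepth m) (depth m - lowerDepth m))
  have h2 := cost_false_le r c M (false :: upperSchedule (lowerDepth m) (depth m - lowerDepth m))
  rw [List.count_cons_of_ne (by simp)] at h2
  rw [count_upperSchedule] at h1 h2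
  rw [Nat.add_sub_cancel' h3] at hu
  have hsq : (9 + 4 * lowerDepth m + 3 * (depth m - lowerDepth m) + 1) ^ 2 ≤
      (4 * (depth m + 4)) ^ 2 := Nat.pow_le_pow_left (by omega) 2
  rw [mul_pow] at hsq
  change cost r c M (false :: false :: upperSchedule (lowerDepth m) (depth m - lowerDepth m)) ≤ _
  omega

theorem three_pow_depth_le {m : ℕ} (hm : 1 ≤ m) : (3 : ℝ) ^ depth m ≤ 3 * Real.sqrt m := by
  have h1 : 9 ^ depth m ≤ 9 * m := by
    unfold depth
    rcases Nat.lt_or_ge 1 m with h | h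
    · have h2 := Nat.pow_pred_clog_lt_self (b := 9) (by norm_num) h
      have h3 : 0 < Nat.clog 9 m := Nat.clog_pos (by norm_num) h
      rw [← Nat.succ_pred_eq_of_pos h3, pow_succ]
      omega
    · have : m = 1 := by omega
      subst this
      simp
  have h2 : ((3 : ℝ) ^ depth m) ^ 2 ≤ (3 * Real.sqrt m) ^ 2 := by
    rw [mul_pow, Real.sq_sqrt (Nat.cast_nonneg m), ← pow_mul, mul_comm, pow_mul]
    norm_num
    exact_mod_cast h1
  exact le_of_sq_le_sq h2 (by positivity)

theorem searchProgram_time_le (r c : ℕ) :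
    ((searchProgram r c).time : ℝ) ≤ 2000000 * Real.sqrt (max r c : ℕ) := by
  unfold Program.time searchProgram
  split_ifs with h
  · simp only [List.length_nil, Nat.cast_zero]
    positivity
  · have hm : 1 ≤ max r c := by omega
    have h1 := cost_schedule_le r c (off ((schedule (max r c)).count true) + 2) (max r c)
    have h2 := three_pow_depth_le hm
    have h3 : (searchCode r c (off ((schedule (max r c)).count true) + 2)
        (schedule (max r c))).1.length ≤ 558819 * 3 ^ depth (max r c) :=
      (le_max_left _ _).trans h1
    have h4 : 1 ≤ Real.sqrt (max r c : ℕ) := by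
      rw [Real.one_le_sqrt]
      exact_mod_cast hm
    have h5 : ((searchCode r c (off ((schedule (max r c)).count true) + 2)
        (schedule (max r c))).1.length : ℝ) ≤ 558819 * 3 ^ depth (max r c) := by exact_mod_cast h3
    simp only [List.length_append, List.length_cons, List.length_nil]
    push_cast at *
    linarith

theorem queryCount_le_length {k w : ℕ} (A : List (Step k w)) : queryCount A ≤ A.length := by
  unfold queryCount
  refine (List.sum_le_card_nsmul _ 1 ?_).trans (by simp)
  intro x hx
  obtain ⟨u, -, rfl⟩ := List.mem_map.1 hx
  cases u <;> simp [Step.queryCost]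

theorem queryCount_steps_le_time (P : Program) (w : ℕ) : queryCount (P.steps w) ≤ P.time :=
  (queryCount_le_length _).trans (by simp [Program.steps, Program.time])

theorem searches_searchProgram {r c w : ℕ} (hr : Fits w r) (hc : Fits w c) :
    Searches r c fun _ => (searchProgram r c).steps w := by
  intro a ha T hT
  by_cases h : r = 0 ∨ c = 0
  · have : (searchProgram r c).steps w = [] := by
      simp [Program.steps, searchProgram, h]
    rw [this, successProb_empty T a (by simp [searchProgram, h]) h]
    norm_num
  · exact two_thirds_le_successProb T (by omega) (by omega) hT ha hr hc

end QSearch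

/-! ### The program is primitive recursive in the dimensions -/

namespace QSearch

/-! ### Computability of the program -/

section
variable {α β : Type} [Primcodable α] [Primcodable β]

theorem primrec_add {f g : α → ℕ} (hf : Primrec f) (hg : Primrec g) :
    Primrec fun a => f a + g a := Primrec.nat_add.comp hf hg

theorem primrec_mul {f g : α → ℕ} (hf : Primrec f) (hg : Primrec g) :
    Primrec fun a => f a * g a := Primrec.nat_mul.comp hf hg

theorem primrec_sub {f g : α → ℕ} (hf : Primrec f) (hg : Primrec g) :
    Primrec fun a => f a - g a := Primrec.nat_sub.comp hf hg

theorem primrec_pow {f g : α → ℕ} (hf : Primrec f) (hg : Primrec g) :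
    Primrec fun a => f a ^ g a :=
  (Primrec₂.unpaired'.1 Nat.Primrec.pow : Primrec₂ fun m n : ℕ => m ^ n).comp hf hg

theorem primrec_cons {f : α → β} {g : α → List β} (hf : Primrec f) (hg : Primrec g) :
    Primrec fun a => f a :: g a := Primrec.list_cons.comp hf hg

theorem primrec_append {f g : α → List β} (hf : Primrec f) (hg : Primrec g) :
    Primrec fun a => f a ++ g a := Primrec.list_append.comp hf hg

theorem primrec_instr (op : Op) {d x y : α → ℕ} (hd : Primrec d) (hx : Primrec x)
    (hy : Primrec y) : Primrec fun a => (⟨op, d a, x a, y a⟩ : Instr) :=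
  (Primrec.of_equiv_symm (e := Instr.equivProd)).comp
    ((Primrec.const op).pair (hd.pair (hx.pair hy)))

theorem primrec_instr_undo : Primrec Instr.undo := by
  have hI : Primrec Instr.equivProd := Primrec.of_equiv
  have hop : Primrec Instr.op := Primrec.fst.comp hI
  have hd : Primrec Instr.d := (Primrec.fst.comp Primrec.snd).comp hI
  have hneg : Primrec fun I : Instr => (⟨.neg, I.d, 0, 0⟩ : Instr) :=
    primrec_instr _ hd (Primrec.const _) (Primrec.const _)
  exact Primrec.ite ((Primrec.eq.comp hop (Primrec.const _)).or
      (Primrec.eq.comp hop (Primrec.const _)))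
    (primrec_cons Primrec.id (Primrec.const _))
    (primrec_cons hneg (primrec_cons Primrec.id (primrec_cons hneg (Primrec.const _))))

theorem primrec_undo {f : α → List Instr} (hf : Primrec f) : Primrec fun a => undo (f a) :=
  Primrec.list_flatMap (Primrec.list_reverse.comp hf)
    (primrec_instr_undo.comp₂ Primrec₂.right)

theorem primrec_off {e : α → ℕ} (he : Primrec e) : Primrec fun a => off (e a) := by
  unfold off
  repeat' first
    | exact Primrec.const _ | assumption | apply primrec_pow | apply primrec_add
    | apply primrec_mul

attribute [local irreducible] off

theorem primrec_stepCode {c β n d : α → ℕ} (hc : Primrec c) (hβ : Primrec β) (hn : Primrec n)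
    (hd : Primrec d) : Primrec fun a => stepCode (c a) (β a) (n a) (d a) := by
  unfold stepCode
  repeat' first
    | exact Primrec.const _ | assumption | apply primrec_cons | apply primrec_instr
    | apply primrec_add

theorem primrec_stepsCode {c β o t : α → ℕ} (hc : Primrec c) (hβ : Primrec β) (ho : Primrec o)
    (ht : Primrec t) : Primrec fun a => stepsCode (c a) (β a) (o a) (t a) := by
  have hn : Primrec fun p : α × ℕ × List Instr => p.2.1 := Primrec.fst.comp Primrec.snd
  have h : Primrec₂ fun (a : α) (p : ℕ × List Instr) =>
      stepCode (c a) (β a) (o a + 10 * (p.1 + 1)) (2 ^ p.1) ++ p.2 :=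
    primrec_append (primrec_stepCode (hc.comp Primrec.fst) (hβ.comp Primrec.fst)
      (primrec_add (ho.comp Primrec.fst) (primrec_mul (Primrec.const _)
        (primrec_add hn (Primrec.const _)))) (primrec_pow (Primrec.const _) hn))
      (Primrec.snd.comp Primrec.snd)
  refine (Primrec.nat_rec' ht (primrec_stepCode hc hβ ho (Primrec.const 1)) h).of_eq fun a => ?_
  induction t a with
  | zero => rfl
  | succ n ih => rw [stepsCode, ← ih]

theorem primrec_moveCode {r c e : α → ℕ} (hr : Primrec r) (hc : Primrec c) (he : Primrec e) :
    Primrec fun a => moveCode (r a) (c a) (e a) := by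
  have ho := primrec_off he
  have ho' := primrec_off (primrec_add he (Primrec.const 1))
  unfold moveCode
  refine Primrec.ite (Primrec.nat_le.comp ?_ ?_) ?_ ?_
  all_goals repeat' first
    | exact Primrec.const _ | assumption | apply primrec_append | apply primrec_cons
    | apply primrec_instr | apply primrec_stepsCode | apply primrec_add | apply primrec_mul
    | apply primrec_pow

theorem primrec_bitCode {r c e : α → ℕ} (hr : Primrec r) (hc : Primrec c) (he : Primrec e) :
    Primrec fun a => bitCode (r a) (c a) (e a) := by
  have ho := primrec_off he
  unfold bitCode
  repeat' first
    | exact Primrec.const _ | assumption | apply primrec_moveCode | apply primrec_cons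
    | apply primrec_instr | apply primrec_add | apply primrec_mul

theorem primrec_baseCode {c : α → ℕ} (hc : Primrec c) : Primrec fun a => baseCode (c a) := by
  unfold baseCode
  repeat' first
    | exact Primrec.const _ | assumption | apply primrec_cons | apply primrec_instr

theorem primrec_testCode {M n : α → ℕ} (hM : Primrec M) (hn : Primrec n) :
    Primrec fun a => testCode (M a) (n a) := by
  have h1 : Primrec fun p : α × ℕ × List Instr => M p.1 := hM.comp Primrec.fst
  have h2 : Primrec fun p : α × ℕ × List Instr => p.2.1 := Primrec.fst.comp Primrec.snd
  have h3 : Primrec fun p : α × ℕ × List Instr => p.2.2 := Primrec.snd.comp Primrec.snd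
  have h : Primrec₂ fun (a : α) (p : ℕ × List Instr) =>
      p.2 ++ [(⟨.eq, M a + 2 * p.1 + 1, 8 + p.1, 4⟩ : Instr),
        ⟨.sel, M a + 2 * p.1 + 2, M a + 2 * p.1 + 1, M a + 2 * p.1⟩] := by
    unfold Primrec₂
    repeat' first
      | exact Primrec.const _ | assumption | apply primrec_append | apply primrec_cons
      | apply primrec_instr | apply primrec_add | apply primrec_mul
  refine (Primrec.nat_rec' hn (primrec_cons (primrec_instr .imm hM (Primrec.const 1)
    (Primrec.const 0)) (Primrec.const [])) h).of_eq fun a => ?_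
  induction n a with
  | zero => rfl
  | succ n ih => rw [testCode, ← ih]

theorem primrec_reflectCode {M e : α → ℕ} (hM : Primrec M) (he : Primrec e) :
    Primrec fun a => reflectCode (M a) (e a) := by
  have ho := primrec_off he
  unfold reflectCode
  simp only [List.replicate]
  repeat' first
    | exact Primrec.const _ | assumption | apply primrec_append | apply primrec_undo
    | apply primrec_testCode | apply primrec_cons | apply primrec_instr | apply primrec_add
    | apply primrec_mul | apply primrec_sub

theorem primrec_count_true {f : α → List Bool} (hf : Primrec f) :
    Primrec fun a => (f a).count true := by
  have h : Primrec₂ fun (_ : α) (p : Bool × ℕ) => bif p.1 then p.2 + 1 else p.2 :=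
    Primrec.cond (Primrec.fst.comp Primrec.snd)
      (primrec_add (Primrec.snd.comp Primrec.snd) (Primrec.const 1))
      (Primrec.snd.comp Primrec.snd)
  refine (Primrec.list_foldr hf (Primrec.const 0) h).of_eq fun a => ?_
  induction f a with
  | nil => rfl
  | cons b l ih => cases b <;> simp_all

theorem primrec_searchCode {r c M : α → ℕ} {f : α → List Bool} (hr : Primrec r) (hc : Primrec c)
    (hM : Primrec M) (hf : Primrec f) :
    Primrec fun a => searchCode (r a) (c a) (M a) (f a) := by
  let γ := α × Bool × List Bool × List Instr × List Instr
  have hr' : Primrec fun p : γ => r p.1 := hr.comp Primrec.fst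
  have hc' : Primrec fun p : γ => c p.1 := hc.comp Primrec.fst
  have hM' : Primrec fun p : γ => M p.1 := hM.comp Primrec.fst
  have hb : Primrec fun p : γ => p.2.1 := Primrec.fst.comp Primrec.snd
  have hl : Primrec fun p : γ => p.2.2.1.count true :=
    primrec_count_true (Primrec.fst.comp (Primrec.snd.comp Primrec.snd))
  have h1 : Primrec fun p : γ => p.2.2.2.1 :=
    Primrec.fst.comp (Primrec.snd.comp (Primrec.snd.comp Primrec.snd))
  have h2 : Primrec fun p : γ => p.2.2.2.2 :=
    Primrec.snd.comp (Primrec.snd.comp (Primrec.snd.comp Primrec.snd))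
  have h : Primrec₂ fun (a : α) (p : Bool × List Bool × List Instr × List Instr) =>
      bif p.1 then
        (bitCode (r a) (c a) (p.2.1.count true) ++ p.2.2.1,
          p.2.2.2 ++ undo (bitCode (r a) (c a) (p.2.1.count true)))
      else
        (p.2.2.1 ++ flagCode ++ p.2.2.2 ++ reflectCode (M a) (p.2.1.count true) ++ p.2.2.1,
          p.2.2.2 ++ reflectCode (M a) (p.2.1.count true) ++ p.2.2.1 ++ flagCode ++ p.2.2.2) := by
    refine Primrec.cond hb (Primrec.pair ?_ ?_) (Primrec.pair ?_ ?_)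
    all_goals repeat' first
      | exact Primrec.const _ | assumption | apply primrec_bitCode | apply primrec_reflectCode
      | apply primrec_undo | apply primrec_append
  refine (Primrec.list_rec hf ((primrec_baseCode hc).pair
    (primrec_undo (primrec_baseCode hc))) h).of_eq fun a => ?_
  induction f a with
  | nil => rfl
  | cons b l ih => cases b <;> simp only [searchCode, ← ih, cond_true, cond_false]

/-- A positive `k` is at most `Nat.clog 9 m` exactly if `9 ^ (k - 1) < m`, so the logarithm is found
by a bounded search for the greatest such `k`. The same works for `lowerDepth`. -/
theorem primrec_depth {m : α → ℕ} (hm : Primrec m) : Primrec fun a => depth (m a) := by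
  have h : PrimrecRel fun (a : α) (k : ℕ) => 9 ^ (k - 1) < m a :=
    Primrec.nat_lt.comp (primrec_pow (Primrec.const 9) (primrec_sub Primrec.snd (Primrec.const 1)))
      (hm.comp Primrec.fst)
  refine (Primrec.nat_findGreatest hm h).of_eq fun a => ?_
  rw [Nat.findGreatest_eq_iff]
  have key : ∀ k, 1 ≤ k → (9 ^ (k - 1) < m a ↔ k ≤ depth (m a)) := by
    intro k hk
    have := Nat.lt_clog_iff_pow_lt (b := 9) (x := m a) (y := k - 1) (by norm_num)
    rw [← this, depth]
    omega
  refine ⟨?_, fun h0 => (key _ (by omega)).2 le_rfl, fun n hn _ h' => ?_⟩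
  · by_contra hcon
    have h1 := (key (m a + 1) (by omega)).2 (by omega)
    have := (Nat.lt_pow_self (n := m a) (a := 9) (by norm_num))
    simp only [Nat.add_sub_cancel] at h1
    omega
  · have := (key n (by omega)).1 h'
    omega

theorem primrec_lowerDepth {m : α → ℕ} (hm : Primrec m) : Primrec fun a => lowerDepth (m a) := by
  have hq : Primrec fun a => 9 ^ depth (m a) / 8 ^ depth (m a) :=
    Primrec.nat_div.comp (primrec_pow (Primrec.const 9) (primrec_depth hm))
      (primrec_pow (Primrec.const 8) (primrec_depth hm))
  have h : PrimrecRel fun (a : α) (k : ℕ) => 2 ^ k ≤ 9 ^ depth (m a) / 8 ^ depth (m a) :=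
    Primrec.nat_le.comp (primrec_pow (Primrec.const 2) Primrec.snd) (hq.comp Primrec.fst)
  refine (Primrec.nat_findGreatest hq h).of_eq fun a => ?_
  rw [Nat.findGreatest_eq_iff]
  have h0 : 9 ^ depth (m a) / 8 ^ depth (m a) ≠ 0 := by
    refine (Nat.div_pos ?_ (by positivity)).ne'
    exact Nat.pow_le_pow_left (by norm_num) _
  refine ⟨Nat.log_le_self _ _, fun _ => Nat.pow_log_le_self 2 h0, fun n hn _ h' => ?_⟩
  have := Nat.le_log_of_pow_le (by norm_num) h'
  unfold lowerDepth at hn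
  omega

theorem primrec_schedule {m : α → ℕ} (hm : Primrec m) : Primrec fun a => schedule (m a) := by
  have h1 : Primrec fun n => lowerSchedule n := by
    have h : Primrec₂ fun (_ : ℕ) (l : List Bool) => [false, true, true, true, true] ++ l :=
      primrec_append (Primrec.const _) Primrec.snd
    refine (Primrec.nat_rec₁ (lowerSchedule 0) h).of_eq fun n => ?_
    induction n with
    | zero => rfl
    | succ n ih => exact congrArg ([false, true, true, true, true] ++ ·) ih
  have h2 : Primrec₂ fun (_ : α) (p : ℕ × List Bool) => [false, true, true, true] ++ p.2 :=
    primrec_append (Primrec.const _) (Primrec.snd.comp Primrec.snd)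
  have h3 := Primrec.nat_rec' (primrec_sub (primrec_depth hm) (primrec_lowerDepth hm))
    (h1.comp (primrec_lowerDepth hm)) h2
  refine primrec_append (Primrec.const _) (h3.of_eq fun a => ?_)
  induction depth (m a) - lowerDepth (m a) with
  | zero => rfl
  | succ n ih => rw [upperSchedule, ← ih]

end

theorem computable_searchProgram : Computable₂ searchProgram := by
  have hm : Primrec fun p : ℕ × ℕ => schedule (max p.1 p.2) :=
    primrec_schedule (Primrec.nat_max.comp Primrec.fst Primrec.snd)
  have ho := primrec_off (primrec_count_true hm)
  have hs := primrec_searchCode Primrec.fst Primrec.snd (primrec_add ho (Primrec.const 2)) hm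
  have hk := primrec_add (primrec_add ho (Primrec.const 2)) (primrec_mul (Primrec.const 2) ho)
  have hpre : Primrec fun p : ℕ × ℕ =>
      [(⟨.imm, off ((schedule (max p.1 p.2)).count true), p.1, 0⟩ : Instr),
        ⟨.imm, off ((schedule (max p.1 p.2)).count true) + 1, p.2, 0⟩,
        ⟨.neg, off ((schedule (max p.1 p.2)).count true) + 1, 0, 0⟩] :=
    primrec_cons (primrec_instr _ ho Primrec.fst (Primrec.const 0))
      (primrec_cons (primrec_instr _ (primrec_add ho (Primrec.const 1)) Primrec.snd
        (Primrec.const 0)) (primrec_cons (primrec_instr _ (primrec_add ho (Primrec.const 1))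
          (Primrec.const 0) (Primrec.const 0)) (Primrec.const [])))
  have hcode := primrec_append hpre (primrec_append (Primrec.fst.comp hs)
    (Primrec.const [(⟨.imm, 5, 1, 0⟩ : Instr), ⟨.and, 1, 15, 5⟩, ⟨.copy, 2, 8, 0⟩,
      ⟨.copy, 3, 9, 0⟩]))
  have h0 : PrimrecPred fun p : ℕ × ℕ => p.1 = 0 ∨ p.2 = 0 :=
    (Primrec.eq.comp Primrec.fst (Primrec.const 0)).or
      (Primrec.eq.comp Primrec.snd (Primrec.const 0))
  have h := Primrec.ite h0 (Primrec.const ((0, []) : Program)) (hk.pair hcode)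
  exact Primrec₂.to_comp (h.of_eq fun p => by rw [searchProgram])

end QSearch

/-! ### The lower bound on the number of queries -/

namespace QSearch

open Matrix

/-! ### The hybrid argument -/

section
variable {ι : Type} [Fintype ι]

/-- The Euclidean norm of a vector. -/
noncomputable def l2 (f : ι → ℂ) : ℝ := Real.sqrt (∑ i, ‖f i‖ ^ 2)

theorem l2_add_le (f g : ι → ℂ) : l2 (fun i => f i + g i) ≤ l2 f + l2 g := by
  have h := norm_add_le (WithLp.toLp 2 f : EuclideanSpace ℂ ι) (WithLp.toLp 2 g)
  simp only [EuclideanSpace.norm_eq] at h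
  exact h

theorem permMat_mulVec [DecidableEq ι] (σ : Equiv.Perm ι) (ψ : ι → ℂ) (t : ι) :
    (permMat σ *ᵥ ψ) t = ψ (σ.symm t) := by
  simp only [permMat, Matrix.mulVec, dotProduct, Matrix.of_apply, ite_mul, one_mul, zero_mul]
  rw [Finset.sum_eq_single (σ.symm t)]
  · simp
  · intro b _ hb
    rw [if_neg fun h => hb (by rw [h, Equiv.symm_apply_apply])]
  · exact fun h => absurd (Finset.mem_univ _) h

/-- A component can differ only if its preimages differ, and both preimages are then states on which
the permutations disagree. Use `|u - v|² ≤ 2|u|² + 2|v|²` and sum over each kind of preimage. -/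
theorem sum_norm_sq_permMat_sub_le [DecidableEq ι] (σ τ : Equiv.Perm ι) (ψ : ι → ℂ) :
    ∑ t, ‖(permMat σ *ᵥ ψ) t - (permMat τ *ᵥ ψ) t‖ ^ 2 ≤
      4 * ∑ s, if σ s ≠ τ s then ‖ψ s‖ ^ 2 else 0 := by
  have h1 : ∑ t, (if σ (σ.symm t) ≠ τ (σ.symm t) then ‖ψ (σ.symm t)‖ ^ 2 else 0) =
      ∑ s, if σ s ≠ τ s then ‖ψ s‖ ^ 2 else 0 :=
    σ.symm.sum_comp fun s => if σ s ≠ τ s then ‖ψ s‖ ^ 2 else 0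
  have h2 : ∑ t, (if σ (τ.symm t) ≠ τ (τ.symm t) then ‖ψ (τ.symm t)‖ ^ 2 else 0) =
      ∑ s, if σ s ≠ τ s then ‖ψ s‖ ^ 2 else 0 :=
    τ.symm.sum_comp fun s => if σ s ≠ τ s then ‖ψ s‖ ^ 2 else 0
  calc _ ≤ ∑ t, (2 * (if σ (σ.symm t) ≠ τ (σ.symm t) then ‖ψ (σ.symm t)‖ ^ 2 else 0) +
        2 * (if σ (τ.symm t) ≠ τ (τ.symm t) then ‖ψ (τ.symm t)‖ ^ 2 else 0)) := by
        refine Finset.sum_le_sum fun t _ => ?_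
        rw [permMat_mulVec, permMat_mulVec]
        by_cases h : σ.symm t = τ.symm t
        · rw [h, sub_self, norm_zero, zero_pow two_ne_zero]
          split_ifs <;> positivity
        · rw [if_pos, if_pos]
          · have := norm_sub_le (ψ (σ.symm t)) (ψ (τ.symm t))
            nlinarith [norm_nonneg (ψ (σ.symm t) - ψ (τ.symm t)),
              sq_nonneg (‖ψ (σ.symm t)‖ - ‖ψ (τ.symm t)‖)]
          · rw [Equiv.apply_symm_apply]
            exact fun h' => h (by rw [Equiv.symm_apply_eq, h'])
          · rw [Equiv.apply_symm_apply]
            exact fun h' => h (by rw [eq_comm, Equiv.symm_apply_eq, ← h'])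
    _ = _ := by
        rw [Finset.sum_add_distrib, ← Finset.mul_sum, ← Finset.mul_sum, h1, h2]
        ring

end

section
variable {r c k w : ℕ} {P : Type} (T₀ : Fin r → Fin c → ℤ)
  (T : P → Fin r → Fin c → ℤ)

theorem eq_of_queryPerm_ne
    (hT : ∀ (x y : BitVec w) p q, entry T₀ x y ≠ entry (T p) x y →
      entry T₀ x y ≠ entry (T q) x y → p = q) {d x y : ℕ} {s : Mem k w} {p q : P}
    (hp : queryPerm T₀ d x y s ≠ queryPerm (T p) d x y s)
    (hq : queryPerm T₀ d x y s ≠ queryPerm (T q) d x y s) : p = q := by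
  unfold queryPerm addReg at hp hq
  split_ifs at hp hq with h
  · refine hT ((Mem.read (Function.update s ⟨d, h⟩ 0) x))
      ((Mem.read (Function.update s ⟨d, h⟩ 0) y)) p q (fun h' => hp ?_) fun h' => hq ?_ <;>
    simp only [addInto, Equiv.coe_fn_mk, h']
  · exact absurd rfl hp

variable [Fintype P]

/-- The modified arrays differ from `T₀` in disjoint sets of cells, so a basis state is affected by
at most one of them. The squared deviations caused by one query, summed over all arrays at once, are
thus at most four times the norm squared of `ψ`. -/
theorem l2_query_le
    (hT : ∀ (x y : BitVec w) p q, entry T₀ x y ≠ entry (T p) x y →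
      entry T₀ x y ≠ entry (T q) x y → p = q) (d x y : ℕ) {ψ : Mem k w → ℂ}
    (hψ : ∑ s, ‖ψ s‖ ^ 2 ≤ 1) :
    l2 (fun i : P × Mem k w => (permMat (queryPerm T₀ d x y) *ᵥ ψ) i.2 -
      (permMat (queryPerm (T i.1) d x y) *ᵥ ψ) i.2) ≤ 2 := by
  classical
  refine Real.sqrt_le_iff.2 ⟨by norm_num, ?_⟩
  rw [Fintype.sum_prod_type]
  calc _ ≤ ∑ p : P, 4 * ∑ s : Mem k w,
        (if queryPerm T₀ d x y s ≠ queryPerm (T p) d x y s then ‖ψ s‖ ^ 2 else 0) :=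
        Finset.sum_le_sum fun p _ => sum_norm_sq_permMat_sub_le _ _ ψ
    _ = 4 * ∑ s : Mem k w, ∑ p : P,
        (if queryPerm T₀ d x y s ≠ queryPerm (T p) d x y s then ‖ψ s‖ ^ 2 else 0) := by
        rw [← Finset.mul_sum, Finset.sum_comm]
    _ ≤ 4 * ∑ s : Mem k w, ‖ψ s‖ ^ 2 := by
        refine mul_le_mul_of_nonneg_left (Finset.sum_le_sum fun s _ => ?_) (by norm_num)
        rw [← Finset.sum_filter, Finset.sum_const, nsmul_eq_mul]
        have hcard : (Finset.univ.filter fun p : P =>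
            queryPerm T₀ d x y s ≠ queryPerm (T p) d x y s).card ≤ 1 := by
          rw [Finset.card_le_one]
          intro p hp q hq
          exact eq_of_queryPerm_ne T₀ T hT (Finset.mem_filter.1 hp).2 (Finset.mem_filter.1 hq).2
        have hcard' := (Nat.cast_le (α := ℝ)).2 hcard
        rw [Nat.cast_one] at hcard'
        nlinarith [sq_nonneg ‖ψ s‖]
    _ ≤ 2 ^ 2 := by linarith

theorem l2_mulVec_sub (u : P → Matrix (Mem k w) (Mem k w) ℂ)
    (hu : ∀ p, u p ∈ Matrix.unitaryGroup (Mem k w) ℂ) (f : P → Mem k w → ℂ) :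
    l2 (fun i : P × Mem k w => (u i.1 *ᵥ f i.1) i.2) = l2 (fun i : P × Mem k w => f i.1 i.2) := by
  unfold l2
  rw [Fintype.sum_prod_type, Fintype.sum_prod_type]
  congr 1
  exact Finset.sum_congr rfl fun p _ => sum_norm_sq_mulVec (hu p) (f p)

/-- Treating all runs as a single vector indexed by `P × Mem k w` lets the triangle inequality act
once per step. Each run's deviation so far is carried along isometrically, and a new one arises only
at a query, by applying both oracles to the state of the reference run. -/
theorem l2_foldl_sub_le
    (hT : ∀ (x y : BitVec w) p q, entry T₀ x y ≠ entry (T p) x y →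
      entry T₀ x y ≠ entry (T q) x y → p = q) (A : List (Step k w)) {ψ₀ : Mem k w → ℂ}
    (hψ : ∑ s, ‖ψ₀ s‖ ^ 2 ≤ 1) (ψ : P → Mem k w → ℂ) :
    l2 (fun i : P × Mem k w => A.foldl (fun φ u => u.mat T₀ *ᵥ φ) ψ₀ i.2 -
        A.foldl (fun φ u => u.mat (T i.1) *ᵥ φ) (ψ i.1) i.2) ≤
      l2 (fun i : P × Mem k w => ψ₀ i.2 - ψ i.1 i.2) + 2 * queryCount A := by
  induction A generalizing ψ₀ ψ with
  | nil => simp [queryCount]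
  | cons u A ih =>
    have hnorm : ∑ s, ‖(u.mat T₀ *ᵥ ψ₀) s‖ ^ 2 ≤ 1 := by
      rwa [sum_norm_sq_mulVec (u.mat_mem T₀)]
    have hstep : l2 (fun i : P × Mem k w => (u.mat T₀ *ᵥ ψ₀) i.2 -
        (u.mat (T i.1) *ᵥ ψ i.1) i.2) ≤
        l2 (fun i : P × Mem k w => ψ₀ i.2 - ψ i.1 i.2) + 2 * u.queryCost := by
      have h1 := l2_mulVec_sub (fun p => u.mat (T p)) (fun p => u.mat_mem (T p))
        fun p => ψ₀ - ψ p
      have h2 := l2_add_le (fun i : P × Mem k w => (u.mat (T i.1) *ᵥ (ψ₀ - ψ i.1)) i.2)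
        fun i => (u.mat T₀ *ᵥ ψ₀) i.2 - (u.mat (T i.1) *ᵥ ψ₀) i.2
      rw [h1] at h2
      have h3 : l2 (fun i : P × Mem k w => (u.mat T₀ *ᵥ ψ₀) i.2 - (u.mat (T i.1) *ᵥ ψ₀) i.2) ≤
          2 * u.queryCost := by
        cases u with
        | query d x y =>
          simp only [Step.queryCost, Nat.cast_one, mul_one]
          exact l2_query_le T₀ T hT d x y hψ
        | unitary U => simp [l2, Step.mat, Step.queryCost]
      refine le_trans (le_of_eq ?_) (h2.trans (add_le_add_right h3 _))
      congr 1
      funext i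
      rw [Matrix.mulVec_sub, Pi.sub_apply]
      ring
    have := ih hnorm fun p => u.mat (T p) *ᵥ ψ p
    rw [List.foldl_cons]
    simp only [List.foldl_cons]
    have hq : queryCount (u :: A) = u.queryCost + queryCount A := by simp [queryCount]
    rw [hq]
    push_cast
    linarith

end

theorem sum_norm_sq_finalState {r c k w : ℕ} (T : Fin r → Fin c → ℤ) (a : ℤ)
    (A : List (Step k w)) : ∑ s, ‖finalState T a A s‖ ^ 2 = 1 := by
  have h : ∀ ψ : Mem k w → ℂ,
      ∑ s, ‖A.foldl (fun φ u => u.mat T *ᵥ φ) ψ s‖ ^ 2 = ∑ s, ‖ψ s‖ ^ 2 := by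
    intro ψ
    induction A generalizing ψ with
    | nil => rfl
    | cons u A ih => rw [List.foldl_cons, ih, sum_norm_sq_mulVec (u.mat_mem T)]
  unfold finalState
  rw [h, Finset.sum_eq_single (initMem k w a)]
  · simp
  · intro b _ hb; simp [hb]
  · exact fun h => absurd (Finset.mem_univ _) h

open Classical in
-- No answer is correct for both arrays. By `(y + d) ^ 2 ≤ 3 / 2 * y ^ 2 + 3 * d ^ 2`, summing gives
-- `2 / 3 + 3 / 2 * (2 / 3) ≤ 3 / 2 + 3 * Δ` for the squared distance `Δ`, so `Δ ≥ 1 / 18`. The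
-- smaller constant `1 / 25` is a square.
theorem le_sum_norm_sq_sub {r c k w : ℕ} {T₀ T : Fin r → Fin c → ℤ} {a : ℤ} {A : List (Step k w)}
    (h₀ : ∀ i j, T₀ i j ≠ a) (h : ∃ i j, T i j = a) (hs₀ : 2 / 3 ≤ successProb T₀ a A)
    (hs : 2 / 3 ≤ successProb T a A) :
    1 / 25 ≤ ∑ s, ‖finalState T₀ a A s - finalState T a A s‖ ^ 2 := by
  have n1 := sum_norm_sq_finalState T a A
  unfold successProb at hs₀ hs
  have e : ∑ s : Mem k w, ((if CorrectAnswer T₀ a (answer s) then ‖finalState T₀ a A s‖ ^ 2 else 0) +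
      3 / 2 * (if CorrectAnswer T a (answer s) then ‖finalState T a A s‖ ^ 2 else 0)) ≤
      ∑ s : Mem k w, (3 / 2 * ‖finalState T a A s‖ ^ 2 +
        3 * ‖finalState T₀ a A s - finalState T a A s‖ ^ 2) := by
    refine Finset.sum_le_sum fun s _ => ?_
    have htri : ‖finalState T₀ a A s‖ ≤
        ‖finalState T a A s‖ + ‖finalState T₀ a A s - finalState T a A s‖ := norm_le_insert' _ _
    have hx := norm_nonneg (finalState T₀ a A s)
    have hy := norm_nonneg (finalState T a A s)
    have hd := norm_nonneg (finalState T₀ a A s - finalState T a A s)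
    generalize ‖finalState T₀ a A s‖ = x at *
    generalize ‖finalState T a A s‖ = y at *
    generalize ‖finalState T₀ a A s - finalState T a A s‖ = d at *
    rcases hans : answer s with _ | p
    · have : ¬ CorrectAnswer T a none := fun hc => by
        obtain ⟨i, j, hij⟩ := h
        exact hc i j hij
      rw [if_neg this]
      split_ifs
      · nlinarith [sq_nonneg (y - 2 * d)]
      · nlinarith
    · have : ¬ CorrectAnswer T₀ a (some p) := fun ⟨i, j, _, _, hij⟩ => h₀ i j hij
      rw [if_neg this]
      split_ifs <;> nlinarith
  rw [Finset.sum_add_distrib, Finset.sum_add_distrib, ← Finset.mul_sum, ← Finset.mul_sum,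
    ← Finset.mul_sum, n1] at e
  linarith

/-! ### Arrays that are hard to search -/

/-- The number of positions before `(i, j)` in the order by antidiagonals. -/
def rank (m i j : ℕ) : ℕ :=
  (Finset.univ.filter fun q : Fin m × Fin m =>
    ((q.1 : ℕ) + q.2) * m + q.1 < (i + j) * m + i).card

theorem rank_lt_rank {m i j i' j' : ℕ} (hi : i < m) (hj : j < m)
    (h : (i + j) * m + i < (i' + j') * m + i') : rank m i j < rank m i' j' := by
  refine Finset.card_lt_card (Finset.ssubset_iff_of_subset ?_ |>.2
    ⟨(⟨i, hi⟩, ⟨j, hj⟩), by simpa using h, by simp⟩)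
  intro q hq
  simp only [Finset.mem_filter, Finset.mem_univ, true_and] at hq ⊢
  omega

theorem rank_lt_rank_of_add_lt {m i j i' j' : ℕ} (hi : i < m) (hj : j < m)
    (h : i + j < i' + j') : rank m i j < rank m i' j' := by
  refine rank_lt_rank hi hj ?_
  have := Nat.mul_le_mul_right m (Nat.succ_le_of_lt h)
  rw [Nat.succ_mul] at this
  omega

theorem rank_lt_sq {m i j : ℕ} (hi : i < m) (hj : j < m) : rank m i j < m ^ 2 := by
  have h : rank m i j < (Finset.univ : Finset (Fin m × Fin m)).card :=
    Finset.card_lt_card (Finset.ssubset_iff_of_subset (Finset.subset_univ _) |>.2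
      ⟨(⟨i, hi⟩, ⟨j, hj⟩), Finset.mem_univ _, by simp⟩)
  simpa [sq] using h

/-- The value at position `(i, j)`, where `o` is the row that contains the value `rank m 0 m`, in
the longest antidiagonal. -/
def hardValue (m : ℕ) (o : Option ℕ) (i j : ℕ) : ℕ :=
  if o = some i ∧ i + j + 1 = m then rank m 0 m
  else if i + j < m then rank m i j else rank m i j + 1

theorem rank_lt_rank_mid {m i j : ℕ} (hi : i < m) (hj : j < m) (h : i + j < m) :
    rank m i j < rank m 0 m := rank_lt_rank_of_add_lt hi hj (by omega)

theorem rank_mid_le_rank {m i j : ℕ} (h : m ≤ i + j) : rank m 0 m ≤ rank m i j := by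
  refine Finset.card_le_card fun q hq => ?_
  simp only [Finset.mem_filter, Finset.mem_univ, true_and] at hq ⊢
  have := Nat.mul_le_mul_right m h
  rw [zero_add, add_zero] at hq
  omega

theorem hardValue_lt {m : ℕ} (o : Option ℕ) {i j i' j' : ℕ} (hi : i < m) (hj : j < m)
    (h : i + j < i' + j') :
    hardValue m o i j < hardValue m o i' j' := by
  have h1 := rank_lt_rank_of_add_lt hi hj h
  unfold hardValue
  by_cases ha : i + j < m <;> by_cases hb : i' + j' < m
  · have h2 := rank_lt_rank_mid hi hj ha
    split_ifs <;> omega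
  · have h2 := rank_lt_rank_mid hi hj ha
    have h3 := rank_mid_le_rank (not_lt.1 hb)
    split_ifs <;> omega
  · omega
  · split_ifs <;> omega

theorem hardValue_injective {m : ℕ} (o : Option ℕ) {i j i' j' : ℕ} (hi : i < m) (hj : j < m)
    (hi' : i' < m) (hj' : j' < m) (h : hardValue m o i j = hardValue m o i' j') :
    i = i' ∧ j = j' := by
  rcases lt_trichotomy (i + j) (i' + j') with h1 | h1 | h1
  · exact absurd h (hardValue_lt o hi hj h1).ne
  · suffices i = i' by omega
    by_contra hne
    have hr : rank m i j ≠ rank m i' j' := by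
      rcases Nat.lt_or_gt_of_ne hne with h2 | h2
      · exact (rank_lt_rank hi hj (by rw [h1]; omega)).ne
      · exact (rank_lt_rank hi' hj' (by rw [h1]; omega)).ne'
    unfold hardValue at h
    rw [← h1] at h
    by_cases ha : i + j < m
    · have h2 := rank_lt_rank_mid hi hj ha
      have h3 := rank_lt_rank_mid hi' hj' (by omega)
      have h4 : ∀ x, o = some i → o = some i' → x := by
        intro x h5 h6
        rw [h5] at h6
        exact absurd (Option.some.inj h6) hne
      split_ifs at h with h5 h6 h6
      · exact h4 _ h5.1 h6.1
      all_goals omega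
    · rw [if_neg (by omega), if_neg (by omega), if_neg (by omega), if_neg (by omega)] at h
      omega
  · exact absurd h (hardValue_lt o hi' hj' h1).ne'

theorem hardValue_le_sq {m : ℕ} (o : Option ℕ) {i j : ℕ} (hi : i < m) (hj : j < m) :
    hardValue m o i j ≤ m ^ 2 := by
  have h1 := rank_lt_sq hi hj
  have h2 : rank m 0 m ≤ m ^ 2 := (Finset.card_le_univ _).trans (by simp [sq])
  unfold hardValue
  split_ifs <;> omega

theorem hardValue_none_ne {m i j : ℕ} (hi : i < m) (hj : j < m) :
    hardValue m none i j ≠ rank m 0 m := by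
  unfold hardValue
  rw [if_neg (by simp)]
  split_ifs with h
  · exact (rank_lt_rank_mid hi hj h).ne
  · have := rank_mid_le_rank (not_lt.1 h)
    omega

/-- The sorted array with the values `hardValue`, starting from the least `w`-bit integer. -/
def hardArray (m w : ℕ) (o : Option ℕ) (i j : Fin m) : ℤ :=
  hardValue m o i j - 2 ^ (w - 1)

theorem fits_sub {w n : ℕ} (hw : 1 ≤ w) (hn : n < 2 ^ w) : Fits w ((n : ℤ) - 2 ^ (w - 1)) := by
  obtain ⟨v, rfl⟩ := Nat.exists_eq_add_of_le' hw
  have h : (n : ℤ) < 2 ^ (v + 1) := by exact_mod_cast hn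
  unfold Fits
  rw [Nat.add_sub_cancel]
  rw [pow_succ] at *
  constructor <;> omega

theorem isSortedArray_hardArray {m w : ℕ} (hw : 1 ≤ w) (hm : m ^ 2 < 2 ^ w) (o : Option ℕ) :
    IsSortedArray w (hardArray m w o) where
  row_sorted i j j' h := by
    rcases h.eq_or_lt with h | h
    · rw [h]
    · have := hardValue_lt (i' := i) (j' := j') o i.2 j.2 (by have := Fin.lt_def.1 h; omega)
      unfold hardArray
      omega
  col_sorted j i i' h := by
    rcases h.eq_or_lt with h | h
    · rw [h]
    · have := hardValue_lt (i' := i') (j' := j) o i.2 j.2 (by have := Fin.lt_def.1 h; omega)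
      simp only [hardArray]
      omega
  distinct := by
    rintro ⟨i, j⟩ ⟨i', j'⟩ h
    simp only [hardArray] at h
    obtain ⟨h1, h2⟩ := hardValue_injective o i.2 j.2 i'.2 j'.2 (by omega)
    rw [Fin.ext h1, Fin.ext h2]
  fits i j := fits_sub hw ((hardValue_le_sq o i.2 j.2).trans_lt hm)

theorem row_eq_of_entry_hardArray_ne {m w : ℕ} {x y : BitVec w} {p : ℕ}
    (h : entry (hardArray m w none) x y ≠ entry (hardArray m w (some p)) x y) : x.toNat = p := by
  by_contra hne
  refine h ?_
  unfold entry hardArray hardValue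
  split_ifs with h1 h2 h3 h4 h5 <;> simp_all

theorem sqrt_le_of_searches {m w k t : ℕ} (hm : m ^ 2 < 2 ^ w) {A : ℤ → List (Step k w)}
    (hA : ∀ a, Fits w a → queryCount (A a) ≤ t) (hS : Searches m m A) :
    1 / 10 * Real.sqrt m ≤ t := by
  rcases Nat.eq_zero_or_pos m with rfl | hm0
  · simp
  have hw : 1 ≤ w := by
    by_contra h
    have : 1 ≤ m ^ 2 := Nat.one_le_pow _ _ hm0
    rw [show w = 0 by omega] at hm
    omega
  have hmid : rank m 0 m ≤ m ^ 2 := (Finset.card_le_univ _).trans (by simp [sq])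
  -- This is the value skipped by the unmodified array; the modified array for `p` contains it in
  -- row `p` only.
  set a : ℤ := (rank m 0 m : ℤ) - 2 ^ (w - 1) with ha
  have hfit : Fits w a := fits_sub hw (by omega)
  have h₀ : ∀ i j, hardArray m w none i j ≠ a := by
    intro i j h
    have := hardValue_none_ne i.2 j.2
    simp only [hardArray, ha] at h
    omega
  have h₁ : ∀ p : Fin m, ∃ i j, hardArray m w (some p) i j = a := by
    intro p
    refine ⟨p, ⟨m - 1 - p, by omega⟩, ?_⟩
    simp only [hardArray, hardValue]
    rw [if_pos ⟨trivial, by omega⟩]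
  have hyb := l2_foldl_sub_le (hardArray m w none) (fun p : Fin m => hardArray m w (some p))
    (fun x y p q hp hq => Fin.ext
      ((row_eq_of_entry_hardArray_ne hp).symm.trans (row_eq_of_entry_hardArray_ne hq)))
    (A a) (ψ₀ := Pi.single (initMem k w a) 1)
    (sum_norm_sq_finalState (hardArray m w none) a []).le fun _ => Pi.single (initMem k w a) 1
  have hz : l2 (fun i : Fin m × Mem k w => (Pi.single (initMem k w a) 1 : Mem k w → ℂ) i.2 -
      (Pi.single (initMem k w a) 1 : Mem k w → ℂ) i.2) = 0 := by simp [l2]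
  rw [hz, zero_add] at hyb
  -- Each of the `m` modified arrays contributes at least `1 / 25`. Comparing with `2 * t` from the
  -- hybrid argument gives the constant `1 / 10`.
  have hlow : 1 / 5 * Real.sqrt m ≤ l2 (fun i : Fin m × Mem k w =>
      finalState (hardArray m w none) a (A a) i.2 -
        finalState (hardArray m w (some i.1)) a (A a) i.2) := by
    refine Real.le_sqrt_of_sq_le ?_
    rw [Fintype.sum_prod_type, mul_pow, Real.sq_sqrt (Nat.cast_nonneg m)]
    calc (1 / 5) ^ 2 * (m : ℝ) = ∑ p : Fin m, (1 / 25 : ℝ) := by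
          rw [Finset.sum_const, Finset.card_univ, Fintype.card_fin, nsmul_eq_mul]
          ring
      _ ≤ _ := Finset.sum_le_sum fun p _ => le_sum_norm_sq_sub h₀ (h₁ p)
          (hS a hfit _ (isSortedArray_hardArray hw hm _))
          (hS a hfit _ (isSortedArray_hardArray hw hm _))
  have hq : (queryCount (A a) : ℝ) ≤ t := by exact_mod_cast hA a hfit
  have := hlow.trans hyb
  linarith

end QSearch

theorem mainTheorem2 :
    -- a bounded-error algorithm with running time, and number of queries, `O(√(max r c))`
    (∃ (P : ℕ → ℕ → QSearch.Program) (K : ℝ), Computable₂ P ∧ 0 < K ∧ ∀ r c : ℕ,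
      ((P r c).time : ℝ) ≤ K * Real.sqrt (max r c : ℕ) ∧
      ∀ w : ℕ, QSearch.Fits w r → QSearch.Fits w c →
        (QSearch.queryCount ((P r c).steps w) : ℝ) ≤ K * Real.sqrt (max r c : ℕ) ∧
        QSearch.Searches r c fun _ => (P r c).steps w) ∧
    -- no bounded-error quantum query algorithm does better
    (∃ κ : ℝ, 0 < κ ∧ ∀ m w k t : ℕ, m ^ 2 < 2 ^ w →
      ∀ A : ℤ → List (QSearch.Step k w), 
        (∀ a, QSearch.Fits w a → QSearch.queryCount (A a) ≤ t) →
        QSearch.Searches m m A → κ * Real.sqrt m ≤ t) := by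
  refine ⟨⟨QSearch.searchProgram, 2000000, QSearch.computable_searchProgram, by norm_num,
    fun r c => ⟨QSearch.searchProgram_time_le r c, fun w hr hc => ⟨?_, ?_⟩⟩⟩, ?_⟩
  · refine le_trans ?_ (QSearch.searchProgram_time_le r c)
    exact_mod_cast QSearch.queryCount_steps_le_time _ w
  · exact QSearch.searches_searchProgram hr hc
  · exact ⟨1 / 10, by norm_num, fun m w k t hm A hA hS =>
      QSearch.sqrt_le_of_searches hm hA hS⟩
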